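/- **Setting.** Fix $d$ and constants $\sigma>0$, $C_0>0$, $D\ge 1$, $C>0$, $\mu>0$, $\overline\rho$, $A$, $K$. For each sample size $n$ let $p=p_n$, $s=s_n\ge 1$, and consider the linear model $$Y=X\theta^*+Z\gamma^*+w,\qquad w\sim\mathcal N(0,\sigma^2I_n),\quad X\in\mathbb R^{n\times d},\ Z\in\mathbb R^{n\times p},$$ where $w$ is independent of the design, and the rows $U^i=(X^i,Z^i)$ of the design are i.i.d. with mean zero and sub-Gaussian tails: $\mathbb E\,e^{U^ih}\le e^{C_0\|h\|^2/2}$ for all $h\in\mathbb R^{d+p}$. The law of the rows and $\theta^*,\gamma^*$ may depend on $n$. Put $\Sigma_{Z,Z}=\mathbb E[(Z^i)^TZ^i]$, $\Sigma_{Z,X}=\mathbb E[(Z^i)^TX^i]$, $\alpha^*=\Sigma_{Z,Z}^{-1}\Sigma_{Z,X}$ and $$\Omega^*=\big(\mathbb E[(X^i-Z^i\alpha^*)^T(X^i-Z^i\alpha^*)]\big)^{-1},$$ both inverted matrices being positive definite. Assume: 1. $\max_j\|\alpha^*_j\|_1\le A$, and $\Omega^*$ does not depend on $n$ (or, more generally,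 converges as $n\to\infty$, the limit again being written $\Omega^*$ in (i) below). 2. $\gamma^*$ has at most $s$ nonzero entries, with support $S$, and $\|\gamma^*\|_1\le\overline\rho$. 3. With probability tending to one, the restricted eigenvalue condition holds, i.e. $n^{-1}\|Zu\|^2\ge\mu\|u\|^2$ for all $u\in\mathbb R^p$ with $\|u_{S^c}\|_1\le 3\|u_S\|_1$, and $\|n^{-1/2}X_j\|^2\le C$, $\|n^{-1/2}Z_k\|^2\le C$ for all columns $X_j$, $Z_k$. 4. $\alpha=\alpha(X,Z)\in\mathbb R^{p\times d}$ is obtained by node-wise Lasso: with probability tending to one, each column satisfies $\alpha_j\in\arg\min_{a\in\mathbb R^p}\{\frac1{2n}\|X_j-Za\|^2+\lambda_j\|a\|_1\}$ with $\lambda_j=2C_0D\sqrt{n^{-1}\log p}$. Write $\widetilde X=X-Z\alpha$. 5. The penalty level $\lambda=\lambda_n$ satisfies, for all large $n$, $\lambda\le K\sqrt{n^{-1}\log p}$ and, with probability tending to one, $$\lambda\ \ge\ 2\sigma\sqrt{\frac{2C\log p}{n}}+\frac{4\sigma C^2d}{\sqrt n}+8Cd\,\overline\rho\,\tau,\qquad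 \tau=\|n^{-1}\widetilde X^TZ\|_\infty=\max_{j,k}|(n^{-1}\widetilde X^TZ)_{jk}|.$$ 6. $(\widehat\theta,\widehat\gamma)$ is a Constrained Lasso estimator: with probability tending to one, $\frac1n\widetilde X^T(Y-X\widehat\theta-Z\widehat\gamma)=0$ and $\widehat\gamma\in\arg\min_{\|r\|_1\le\overline\rho}\{\frac1{2n}\|Y-X\widehat\theta-Zr\|^2+\lambda\|r\|_1\}$. **Conclusion.** If $n\to\infty$, $p\to\infty$ and $s\log p/\sqrt n\to0$, then: (i) $\sqrt n\,(\widehat\theta-\theta^*)\xrightarrow{d}\mathcal N(0,\sigma^2\Omega^*)$; (ii) for every $n$, $\sigma^2\Omega^*$ (with the $\Omega^*$ of that $n$) is the semiparametric Cramér–Rao bound for $\theta$: its inverse is the efficient information, that is, it is the Fisher information per observation at $t=0$ of one of the submodels $t\mapsto(\theta^*+t,\gamma^*-at)$, $a\in\mathbb R^{p\times d}$, and it is dominated in the positive semidefinite order by the Fisher information of every such submodel. -/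

import Mathlib

open MeasureTheory ProbabilityTheory Filter Topology Matrix

noncomputable section

namespace CLasso

/-- One row `(Xⁱ, Zⁱ)` of the design: `d` covariates of interest, `p` nuisance covariates. -/
abbrev Row (d p : ℕ) : Type := (Fin d → ℝ) × (Fin p → ℝ)

/-- The `n × d` design matrix `X` of the parameter of interest, read off from the rows. -/
def designX {n d p : ℕ} (U : Fin n → Row d p) : Matrix (Fin n) (Fin d) ℝ :=
  Matrix.of fun i => (U i).1

/-- The `n × p` design matrix `Z` of the nuisance parameter, read off from the rows. -/
def designZ {n d p : ℕ} (U : Fin n → Row d p) : Matrix (Fin n) (Fin p) ℝ :=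
  Matrix.of fun i => (U i).2

/-- The `ℓ₁` norm of a vector. -/
def l1 {ι : Type*} [Fintype ι] (a : ι → ℝ) : ℝ := ∑ i, |a i|

/-- The squared Euclidean norm of a vector. -/
def sqNorm {ι : Type*} [Fintype ι] (a : ι → ℝ) : ℝ := ∑ i, a i ^ 2

/-- The elementwise sup norm of a (finite) matrix. -/
def supNorm {ι κ : Type*} (A : Matrix ι κ ℝ) : ℝ := ⨆ q : ι × κ, |A q.1 q.2|

/-- The Lasso objective `(1/2n) ‖y - Z r‖² + lam ‖r‖₁`. -/
def lassoObj {n p : ℕ} (y : Fin n → ℝ) (Z : Matrix (Fin n) (Fin p) ℝ) (lam : ℝ)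
    (r : Fin p → ℝ) : ℝ :=
  1 / (2 * (n : ℝ)) * sqNorm (y - Z *ᵥ r) + lam * l1 r

/-- `α` solves the node-wise regression with penalty level `lam`: each column `α_j` minimizes
`a ↦ (1/2n) ‖X_j - Z a‖² + lam ‖a‖₁`. -/
def IsNodewiseLasso {n d p : ℕ} (X : Matrix (Fin n) (Fin d) ℝ) (Z : Matrix (Fin n) (Fin p) ℝ)
    (lam : ℝ) (α : Matrix (Fin p) (Fin d) ℝ) : Prop :=
  ∀ j, IsMinOn (lassoObj (fun i => X i j) Z lam) Set.univ (fun k => α k j)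

/-- The residual matrix `X - Z α`. -/
def resid {n d p : ℕ} (X : Matrix (Fin n) (Fin d) ℝ) (Z : Matrix (Fin n) (Fin p) ℝ)
    (α : Matrix (Fin p) (Fin d) ℝ) : Matrix (Fin n) (Fin d) ℝ := X - Z * α

/-- `(θ, γ)` solves the Constrained Lasso problem: the zero-bias equation
`(1/n) (X - Z α)ᵀ (Y - X θ - Z γ) = 0` holds, and `γ` minimizes
`(1/2n) ‖Y - X θ - Z r‖² + lam ‖r‖₁` over the `ℓ₁` ball `‖r‖₁ ≤ ρ`. -/
def IsCLasso {n d p : ℕ} (X : Matrix (Fin n) (Fin d) ℝ) (Z : Matrix (Fin n) (Fin p) ℝ)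
    (Y : Fin n → ℝ) (α : Matrix (Fin p) (Fin d) ℝ) (lam ρ : ℝ)
    (θ : Fin d → ℝ) (γ : Fin p → ℝ) : Prop :=
  (1 / (n : ℝ)) • ((resid X Z α)ᵀ *ᵥ (Y - X *ᵥ θ - Z *ᵥ γ)) = 0 ∧
  l1 γ ≤ ρ ∧ IsMinOn (lassoObj (Y - X *ᵥ θ) Z lam) {r | l1 r ≤ ρ} γ

/-- Support of a vector. -/
def supp {p : ℕ} (γ : Fin p → ℝ) : Finset (Fin p) := Finset.univ.filter fun k => γ k ≠ 0

/-- Restricted eigenvalue condition with constant `μ` over the cone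
`{u : ‖u_{Sᶜ}‖₁ ≤ 3 ‖u_S‖₁}`. -/
def REC {n p : ℕ} (Z : Matrix (Fin n) (Fin p) ℝ) (S : Finset (Fin p)) (μ : ℝ) : Prop :=
  ∀ u : Fin p → ℝ, ∑ k ∈ Sᶜ, |u k| ≤ 3 * ∑ k ∈ S, |u k| →
    μ * sqNorm u ≤ 1 / (n : ℝ) * sqNorm (Z *ᵥ u)

/-- The columns of `X` and `Z` are normalized: `‖n^{-1/2} X_j‖² ≤ C`, `‖n^{-1/2} Z_k‖² ≤ C`. -/
def ColumnsNormalized {n d p : ℕ} (X : Matrix (Fin n) (Fin d) ℝ)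
    (Z : Matrix (Fin n) (Fin p) ℝ) (C : ℝ) : Prop :=
  (∀ j, 1 / (n : ℝ) * sqNorm (fun i => X i j) ≤ C) ∧
  (∀ k, 1 / (n : ℝ) * sqNorm (fun i => Z i k) ≤ C)

/-- The events `E n` hold with probability tending to one: the (outer) probability of the
complement of `E n` tends to zero. -/
def WHP {Ω : ℕ → Type*} [∀ n, MeasurableSpace (Ω n)] (Pr : ∀ n, Measure (Ω n))
    (E : ∀ n, Ω n → Prop) : Prop :=
  Tendsto (fun n => Pr n {ω | ¬ E n ω}) atTop (𝓝 0)

/-- Mean zero and sub-Gaussian tails with constant `C₀` for the law `P` of a row: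
`E exp(Uⁱ h) ≤ exp((C₀ / 2) ‖h‖²)` for every `h = (a, b) ∈ ℝ^{d+p}`. -/
structure SubGaussianRow {d p : ℕ} (P : Measure (Row d p)) (C₀ : ℝ) : Prop where
  mean_fst : ∀ j, Integrable (fun u : Row d p => u.1 j) P ∧ ∫ u, u.1 j ∂P = 0
  mean_snd : ∀ k, Integrable (fun u : Row d p => u.2 k) P ∧ ∫ u, u.2 k ∂P = 0
  mgf_le : ∀ (a : Fin d → ℝ) (b : Fin p → ℝ),
    Integrable (fun u : Row d p => Real.exp (u.1 ⬝ᵥ a + u.2 ⬝ᵥ b)) P ∧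
    ∫ u, Real.exp (u.1 ⬝ᵥ a + u.2 ⬝ᵥ b) ∂P ≤ Real.exp (C₀ / 2 * (sqNorm a + sqNorm b))

/-- `Σ_{Z,Z} = E[(Zⁱ)ᵀ Zⁱ]`. -/
def SigmaZZ {d p : ℕ} (P : Measure (Row d p)) : Matrix (Fin p) (Fin p) ℝ :=
  Matrix.of fun k l => ∫ u, u.2 k * u.2 l ∂P

/-- `Σ_{Z,X} = E[(Zⁱ)ᵀ Xⁱ]`. -/
def SigmaZX {d p : ℕ} (P : Measure (Row d p)) : Matrix (Fin p) (Fin d) ℝ :=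
  Matrix.of fun k j => ∫ u, u.2 k * u.1 j ∂P

/-- The least favourable direction `α* = Σ_{Z,Z}⁻¹ Σ_{Z,X}`. -/
def alphaStar {d p : ℕ} (P : Measure (Row d p)) : Matrix (Fin p) (Fin d) ℝ :=
  (SigmaZZ P)⁻¹ * SigmaZX P

/-- The second moment matrix `E[(Xⁱ - Zⁱ a)ᵀ (Xⁱ - Zⁱ a)]`. -/
def residCov {d p : ℕ} (P : Measure (Row d p)) (a : Matrix (Fin p) (Fin d) ℝ) :
    Matrix (Fin d) (Fin d) ℝ :=
  Matrix.of fun j k => ∫ u, (u.1 - u.2 ᵥ* a) j * (u.1 - u.2 ᵥ* a) k ∂P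

/-- `Ω* = (E[(Xⁱ - Zⁱ α*)ᵀ (Xⁱ - Zⁱ α*)])⁻¹`. -/
def OmegaStar {d p : ℕ} (P : Measure (Row d p)) : Matrix (Fin d) (Fin d) ℝ :=
  (residCov P (alphaStar P))⁻¹

/-- The `j`-th score at `t = 0` of the `d`-dimensional submodel `t ↦ (θ + t, γ - a t)` of the
Gaussian linear model, for one observation with covariates `u` and response `y`: the partial
derivative in `t_j` of the log density of `N(x (θ + t) + z (γ - a t), σ²)` at `y`. -/
def score {d p : ℕ} (σ : NNReal) (θ : Fin d → ℝ) (γ : Fin p → ℝ)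
    (a : Matrix (Fin p) (Fin d) ℝ) (j : Fin d) (u : Row d p) (y : ℝ) : ℝ :=
  deriv (fun t : ℝ => Real.log (gaussianPDFReal
    (u.1 ⬝ᵥ (θ + t • Pi.single j 1) + u.2 ⬝ᵥ (γ - a *ᵥ (t • Pi.single j 1))) (σ ^ 2) y)) 0

/-- Fisher information (per observation) at `t = 0` of the submodel `t ↦ (θ + t, γ - a t)`:
covariates have law `P`, and `y` given `(x, z)` has law `N(x θ + z γ, σ²)`. -/
def submodelInfo {d p : ℕ} (P : Measure (Row d p)) (σ : NNReal) (θ : Fin d → ℝ)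
    (γ : Fin p → ℝ) (a : Matrix (Fin p) (Fin d) ℝ) : Matrix (Fin d) (Fin d) ℝ :=
  Matrix.of fun j k => ∫ u, ∫ y, score σ θ γ a j u y * score σ θ γ a k u y
    ∂(gaussianReal (u.1 ⬝ᵥ θ + u.2 ⬝ᵥ γ) (σ ^ 2)) ∂P

/-- `I` is the efficient information matrix for `θ`: the Fisher information of a hardest
(least favourable) submodel, i.e. it is attained by some direction and, in the positive
semidefinite order, no direction has smaller information.  Its inverse is the semiparametric
Cramér-Rao bound for the asymptotic covariance of estimators of `θ`. -/
def IsEfficientInformation {d p : ℕ} (P : Measure (Row d p)) (σ : NNReal) (θ : Fin d → ℝ)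
    (γ : Fin p → ℝ) (I : Matrix (Fin d) (Fin d) ℝ) : Prop :=
  (∃ a, submodelInfo P σ θ γ a = I) ∧ ∀ a, (submodelInfo P σ θ γ a - I).PosSemidef

end CLasso

end

/-!
The estimator of `θ` solves the estimating equation `X̃ᵀ (Y - X θ̂ - Z γ̂) = 0`, where the residuals
`X̃ = X - Z α` of the node-wise Lasso are nearly orthogonal to `Z`. Substituting the linear model,
`(n⁻¹ X̃ᵀ X) √n (θ̂ - θ*) = n^{-1/2} X̃ᵀ w - √n (n⁻¹ X̃ᵀ Z) (γ̂ - γ*)`. Three facts give the limit law.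

* The KKT conditions of the node-wise Lasso bound the entries of `n⁻¹ X̃ᵀ Z` by a multiple of
  `√(log p / n)`, so the last term is negligible as soon as `‖γ̂ - γ*‖₁ = O(s √(log p / n))`, because
  `s log p / √n → 0`. For this rate (`whp_l1_rate`) the usual Lasso argument is run with the response
  `Y - X θ̂`, which is contaminated by `X (θ* - θ̂)`. By the estimating equation the
  contamination is itself controlled by `‖γ̂ - γ*‖₁` and the score (`IsCLasso.l1_error_le`). The slack
  of order `1 / √n` in the penalty level absorbs it (`contamination_le`).
* Both `n⁻¹ X̃ᵀ X` and `n⁻¹ X̃ᵀ X̃` converge to the inverse of `Ω*` (`whp_gram`). This holds by the slow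
  rate of the Lasso once the node-wise penalty dominates the correlations of the population
  residuals `X - Z α*` with `Z` (`whp_nodewise_noise`). For the columns `Z_k` whose product with
  the population residual has variance below `(3/2) C₀²`, this follows from Bernstein's inequality
  and a union bound. By sub-Gaussianity of the row, the other columns are bounded in number,
  independently of `p` (`card_le_of_large_variance`), so Chebyshev's inequality suffices for them.
* Given the design, the score `n^{-1/2} X̃ᵀ w` is Gaussian with covariance `σ² n⁻¹ X̃ᵀ X̃`, because `α`
  is a function of the design alone. Its characteristic function therefore converges
  (`tendsto_charFun_score`), and Lévy's theorem applies (`tendstoInDistribution_of_expansion`).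

The Fisher information of the submodel in the direction `a` is `σ⁻² E[(x - z a)ᵀ (x - z a)]`. By
Pythagoras it exceeds the information of `α*` by the positive semidefinite matrix
`σ⁻² (a - α*)ᵀ Σ_{Z,Z} (a - α*)`, as `x - z α*` is orthogonal to `z`
(`isEfficientInformation_of_posDef`).
-/

open MeasureTheory ProbabilityTheory Filter Topology Matrix

namespace CLasso

/-! ### Deterministic properties of the Lasso -/

section Deterministic

variable {ι : Type*} [Fintype ι]

lemma l1_nonneg (a : ι → ℝ) : 0 ≤ l1 a := Finset.sum_nonneg fun _ _ => abs_nonneg _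

lemma l1_add_le (a b : ι → ℝ) : l1 (a + b) ≤ l1 a + l1 b := by
  unfold l1
  rw [← Finset.sum_add_distrib]
  exact Finset.sum_le_sum fun i _ => abs_add_le _ _

lemma l1_smul (t : ℝ) (a : ι → ℝ) : l1 (t • a) = |t| * l1 a := by
  simp [l1, abs_mul, Finset.mul_sum]

lemma l1_neg (a : ι → ℝ) : l1 (-a) = l1 a := by simp [l1]

lemma l1_sub_le (a b : ι → ℝ) : l1 (a - b) ≤ l1 a + l1 b := by
  simpa [sub_eq_add_neg, l1_neg] using l1_add_le a (-b)

lemma abs_dotProduct_le {a v : ι → ℝ} {B : ℝ} (h : ∀ k, |a k| ≤ B) :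
    |a ⬝ᵥ v| ≤ B * l1 v := by
  unfold dotProduct l1
  rw [Finset.mul_sum]
  refine (Finset.abs_sum_le_sum_abs _ _).trans (Finset.sum_le_sum fun k _ => ?_)
  rw [abs_mul]
  exact mul_le_mul_of_nonneg_right (h k) (abs_nonneg _)

lemma sqNorm_eq_dotProduct (a : ι → ℝ) : sqNorm a = a ⬝ᵥ a := by
  simp [sqNorm, dotProduct, sq]

lemma sqNorm_nonneg (a : ι → ℝ) : 0 ≤ sqNorm a := Finset.sum_nonneg fun _ _ => sq_nonneg _

lemma sqNorm_add (a b : ι → ℝ) : sqNorm (a + b) = sqNorm a + 2 * (a ⬝ᵥ b) + sqNorm b := by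
  simp only [sqNorm_eq_dotProduct, add_dotProduct, dotProduct_add, dotProduct_comm b a]
  ring

lemma sqNorm_smul (t : ℝ) (a : ι → ℝ) : sqNorm (t • a) = t ^ 2 * sqNorm a := by
  simp [sqNorm, mul_pow, Finset.mul_sum]

lemma sqNorm_neg (a : ι → ℝ) : sqNorm (-a) = sqNorm a := by simp [sqNorm]

lemma dotProduct_sq_le (a b : ι → ℝ) : (a ⬝ᵥ b) ^ 2 ≤ sqNorm a * sqNorm b :=
  Finset.sum_mul_sq_le_sq_mul_sq _ _ _

lemma convex_l1_ball (ρ : ℝ) : Convex ℝ {r : ι → ℝ | l1 r ≤ ρ} := by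
  intro a ha b hb s t hs ht hst
  have := l1_add_le (s • a) (t • b)
  rw [l1_smul, l1_smul, abs_of_nonneg hs, abs_of_nonneg ht] at this
  have h1 : s * l1 a ≤ s * ρ := mul_le_mul_of_nonneg_left ha hs
  have h2 : t * l1 b ≤ t * ρ := mul_le_mul_of_nonneg_left hb ht
  have h3 : s * ρ + t * ρ = ρ := by rw [← add_mul, hst, one_mul]
  change l1 (s • a + t • b) ≤ ρ
  linarith

variable {n p d : ℕ}

/-- Variational inequality for a minimizer `a` of the Lasso objective over a convex set. -/
lemma lasso_variational {y : Fin n → ℝ} {Z : Matrix (Fin n) (Fin p) ℝ} {lam : ℝ} (hlam : 0 ≤ lam)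
    {S : Set (Fin p → ℝ)} (hS : Convex ℝ S) {a b : Fin p → ℝ} (ha : a ∈ S) (hb : b ∈ S)
    (h : IsMinOn (lassoObj y Z lam) S a) :
    1 / (n : ℝ) * ((y - Z *ᵥ a) ⬝ᵥ (Z *ᵥ (b - a))) ≤ lam * (l1 b - l1 a) := by
  set r := y - Z *ᵥ a with hr
  set q := Z *ᵥ (b - a) with hq
  set c : ℝ := 1 / (2 * (n : ℝ)) * sqNorm q with hc
  have hc0 : 0 ≤ c := mul_nonneg (by positivity) (sqNorm_nonneg q)
  have key : ∀ t : ℝ, 0 < t → t ≤ 1 →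
      1 / (n : ℝ) * (r ⬝ᵥ q) ≤ lam * (l1 b - l1 a) + t * c := by
    intro t ht ht1
    have hmem : a + t • (b - a) ∈ S := hS.add_smul_sub_mem ha hb ⟨ht.le, ht1⟩
    have hle : lassoObj y Z lam a ≤ lassoObj y Z lam (a + t • (b - a)) := h hmem
    have h1 : y - Z *ᵥ (a + t • (b - a)) = r + (-t) • q := by
      rw [hr, hq, mulVec_add, mulVec_smul, neg_smul]
      abel
    have h2 : l1 (a + t • (b - a)) ≤ (1 - t) * l1 a + t * l1 b := by
      have e : a + t • (b - a) = (1 - t) • a + t • b := by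
        ext k
        simp only [Pi.add_apply, Pi.smul_apply, Pi.sub_apply, smul_eq_mul]
        ring
      rw [e]
      refine (l1_add_le _ _).trans ?_
      rw [l1_smul, l1_smul, abs_of_nonneg (sub_nonneg.2 ht1), abs_of_pos ht]
    unfold lassoObj at hle
    rw [h1, sqNorm_add, sqNorm_smul, dotProduct_smul, ← hr] at hle
    have h3 := mul_le_mul_of_nonneg_left h2 hlam
    have e2 : 1 / (2 * (n : ℝ)) = 1 / (n : ℝ) / 2 := by rw [mul_comm, ← div_div]
    rw [smul_eq_mul] at hle
    rw [e2] at hle hc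
    have h4 : t * (1 / (n : ℝ) * (r ⬝ᵥ q)) ≤ t * (lam * (l1 b - l1 a) + t * c) := by
      rw [hc]
      linarith
    exact le_of_mul_le_mul_left h4 ht
  refine le_of_forall_pos_le_add fun ε hε => ?_
  have hpos : 0 < min 1 (ε / (c + 1)) := lt_min one_pos (by positivity)
  refine (key _ hpos (min_le_left _ _)).trans ?_
  have h5 : min 1 (ε / (c + 1)) * c ≤ ε / (c + 1) * c :=
    mul_le_mul_of_nonneg_right (min_le_right _ _) hc0
  have h6 : ε / (c + 1) * c ≤ ε := by
    rw [div_mul_eq_mul_div, div_le_iff₀ (by positivity)]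
    nlinarith
  linarith

/-- Stationarity of the Lasso: the correlations of the residual with the columns are at most the
penalty level. -/
lemma lasso_kkt {y : Fin n → ℝ} {Z : Matrix (Fin n) (Fin p) ℝ} {lam : ℝ} (hlam : 0 ≤ lam)
    {a : Fin p → ℝ} (h : IsMinOn (lassoObj y Z lam) Set.univ a) (k : Fin p) :
    |1 / (n : ℝ) * ((y - Z *ᵥ a) ᵥ* Z) k| ≤ lam := by
  have main : ∀ s : ℝ, |s| = 1 → s * (1 / (n : ℝ) * ((y - Z *ᵥ a) ᵥ* Z) k) ≤ lam := by
    intro s hs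
    have := lasso_variational hlam convex_univ (Set.mem_univ a)
      (Set.mem_univ (a + s • Pi.single k 1)) h
    have hl : l1 (Pi.single k (1 : ℝ)) = 1 := by
      simp [l1, Pi.single_apply, apply_ite abs]
    have h2 := l1_add_le a (s • Pi.single k 1)
    rw [l1_smul, hs, hl] at h2
    rw [add_sub_cancel_left, dotProduct_mulVec, dotProduct_smul, dotProduct_single_one,
      smul_eq_mul] at this
    have h3 : lam * (l1 (a + s • Pi.single k 1) - l1 a) ≤ lam * 1 :=
      mul_le_mul_of_nonneg_left (by linarith) hlam
    linarith
  have h1 := main 1 (by simp)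
  have h2 := main (-1) (by simp)
  exact abs_le.2 ⟨by linarith, by linarith⟩

lemma lasso_resid_sqNorm_le {y : Fin n → ℝ} {Z : Matrix (Fin n) (Fin p) ℝ} {lam : ℝ}
    (hlam : 0 ≤ lam) {a : Fin p → ℝ} (h : IsMinOn (lassoObj y Z lam) Set.univ a) :
    1 / (n : ℝ) * sqNorm (y - Z *ᵥ a) ≤ 1 / (n : ℝ) * sqNorm y := by
  have h0 : lassoObj y Z lam a ≤ lassoObj y Z lam 0 := h (Set.mem_univ _)
  have hl : 0 ≤ lam * l1 a := mul_nonneg hlam (l1_nonneg a)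
  have e2 : 1 / (2 * (n : ℝ)) = 1 / (n : ℝ) / 2 := by rw [mul_comm, ← div_div]
  have e3 : l1 (0 : Fin p → ℝ) = 0 := by simp [l1]
  unfold lassoObj at h0
  rw [mulVec_zero, sub_zero, e3, e2] at h0
  linarith

/-- Slow rate for the Lasso prediction error: it is at most the penalty level times twice the
`ℓ₁` norm of any `b` whose noise is dominated by the penalty. -/
lemma lasso_slow_rate {y : Fin n → ℝ} {Z : Matrix (Fin n) (Fin p) ℝ} {lam : ℝ} (hlam : 0 ≤ lam)
    {a b : Fin p → ℝ} (h : IsMinOn (lassoObj y Z lam) Set.univ a)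
    (hb : ∀ k, |1 / (n : ℝ) * ((y - Z *ᵥ b) ᵥ* Z) k| ≤ lam) :
    1 / (n : ℝ) * sqNorm (Z *ᵥ (b - a)) ≤ 2 * lam * l1 b := by
  have h1 := lasso_variational hlam convex_univ (Set.mem_univ a) (Set.mem_univ b) h
  have e : y - Z *ᵥ a = (y - Z *ᵥ b) + Z *ᵥ (b - a) := by
    rw [mulVec_sub]
    abel
  rw [e, add_dotProduct, ← sqNorm_eq_dotProduct, dotProduct_mulVec, mul_add] at h1
  have h2 := abs_dotProduct_le (a := fun k => 1 / (n : ℝ) * ((y - Z *ᵥ b) ᵥ* Z) k)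
    (v := b - a) hb
  have h3 : (fun k => 1 / (n : ℝ) * ((y - Z *ᵥ b) ᵥ* Z) k) ⬝ᵥ (b - a)
      = 1 / (n : ℝ) * ((y - Z *ᵥ b) ᵥ* Z ⬝ᵥ (b - a)) := by
    simp [dotProduct, Finset.mul_sum, mul_assoc]
  rw [h3] at h2
  have h4 := mul_le_mul_of_nonneg_left (l1_sub_le b a) hlam
  have h5 := neg_le_of_abs_le h2
  nlinarith

/-- `ℓ₁` rate for the Lasso over an `ℓ₁` ball, when the response is contaminated by the
error `X δ` of a plugged-in low-dimensional estimate.  Cauchy-Schwarz trades the contamination for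
a quarter of the prediction error plus `C ‖δ‖₁²`, which the slack `η` in the noise bound
absorbs; the cone condition with constant `3` survives. -/
lemma constrained_lasso_l1_rate {y w : Fin n → ℝ} {X : Matrix (Fin n) (Fin d) ℝ}
    {Z : Matrix (Fin n) (Fin p) ℝ} {lam η ρ C μ : ℝ} (hlam : 0 < lam) (hC : 0 ≤ C)
    (hμ : 0 < μ) {γh γs : Fin p → ℝ} {δ : Fin d → ℝ}
    (hγh : l1 γh ≤ ρ) (hγs : l1 γs ≤ ρ)
    (hmin : IsMinOn (lassoObj y Z lam) {r | l1 r ≤ ρ} γh)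
    (hy : y = X *ᵥ δ + Z *ᵥ γs + w)
    (hw : ∀ k, |1 / (n : ℝ) * (w ᵥ* Z) k| ≤ lam / 2 - η)
    (hX : ∀ j, 1 / (n : ℝ) * sqNorm (fun i => X i j) ≤ C)
    (hδ : C * l1 δ ^ 2 ≤ η * l1 (γh - γs))
    (hREC : REC Z (supp γs) μ) :
    l1 (γh - γs) ≤ 8 * lam * (supp γs).card / μ := by
  set v := γh - γs with hv
  set S := supp γs with hS
  set Q := 1 / (n : ℝ) * sqNorm (Z *ᵥ v) with hQ
  have hn0 : 0 ≤ 1 / (n : ℝ) := by positivity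
  have hQ0 : 0 ≤ Q := mul_nonneg hn0 (sqNorm_nonneg _)
  have h1 := lasso_variational hlam.le (convex_l1_ball ρ) hγh hγs hmin
  have e1 : y - Z *ᵥ γh = X *ᵥ δ + w - Z *ᵥ v := by
    rw [hy, hv, mulVec_sub]
    abel
  have e2 : γs - γh = -v := by rw [hv]; abel
  rw [e1, e2, mulVec_neg, dotProduct_neg, sub_dotProduct, ← sqNorm_eq_dotProduct,
    add_dotProduct] at h1
  -- the slack `η` is kept in the noise bound, to pay for the contamination
  have h2 : 1 / (n : ℝ) * (w ⬝ᵥ Z *ᵥ v) ≤ (lam / 2 - η) * l1 v := by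
    have := abs_dotProduct_le (a := fun k => 1 / (n : ℝ) * (w ᵥ* Z) k) (v := v) hw
    rw [dotProduct_mulVec]
    refine le_trans (le_of_eq ?_) ((le_abs_self _).trans this)
    simp [dotProduct, Finset.mul_sum, mul_assoc]
  -- Young's inequality leaves a quarter of the prediction error
  have h3 : 1 / (n : ℝ) * (X *ᵥ δ ⬝ᵥ Z *ᵥ v) ≤ Q / 4 + C * l1 δ ^ 2 := by
    have hj : ∀ j, |1 / (n : ℝ) * ((Z *ᵥ v) ᵥ* X) j| ≤ √C * √Q := by
      intro j
      rw [← Real.sqrt_mul hC]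
      refine Real.abs_le_sqrt ?_
      have hcs := dotProduct_sq_le (Z *ᵥ v) (fun i => X i j)
      have ej : ((Z *ᵥ v) ᵥ* X) j = (Z *ᵥ v) ⬝ᵥ (fun i => X i j) := rfl
      rw [ej, mul_pow]
      calc (1 / (n : ℝ)) ^ 2 * ((Z *ᵥ v) ⬝ᵥ fun i => X i j) ^ 2
          ≤ (1 / (n : ℝ)) ^ 2 * (sqNorm (Z *ᵥ v) * sqNorm fun i => X i j) := by gcongr
        _ = (1 / (n : ℝ) * sqNorm fun i => X i j) * Q := by rw [hQ]; ring
        _ ≤ C * Q := mul_le_mul_of_nonneg_right (hX j) hQ0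
    have := abs_dotProduct_le (v := δ) hj
    have e : (fun j => 1 / (n : ℝ) * ((Z *ᵥ v) ᵥ* X) j) ⬝ᵥ δ
        = 1 / (n : ℝ) * (X *ᵥ δ ⬝ᵥ Z *ᵥ v) := by
      rw [dotProduct_comm (X *ᵥ δ), dotProduct_mulVec]
      simp [dotProduct, Finset.mul_sum, mul_assoc]
    rw [e] at this
    have h4 := (le_abs_self _).trans this
    have h5 : (√C * l1 δ - √Q / 2) ^ 2 ≥ 0 := sq_nonneg _
    have h6 := Real.sq_sqrt hC
    have h7 := Real.sq_sqrt hQ0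
    nlinarith
  -- `γs` vanishes off `S`, so the penalty of `γh` there is that of the error
  have h8 : l1 v = ∑ k ∈ S, |v k| + ∑ k ∈ Sᶜ, |v k| := (Finset.sum_add_sum_compl S _).symm
  have h9 : l1 γs - l1 γh ≤ ∑ k ∈ S, |v k| - ∑ k ∈ Sᶜ, |v k| := by
    unfold l1
    rw [← Finset.sum_add_sum_compl S (fun k => |γs k|), ← Finset.sum_add_sum_compl S
      (fun k => |γh k|)]
    have a1 : ∑ k ∈ Sᶜ, |γs k| = 0 := by
      refine Finset.sum_eq_zero fun k hk => ?_
      simpa [hS, supp] using hk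
    have a2 : ∑ k ∈ Sᶜ, |γh k| = ∑ k ∈ Sᶜ, |v k| := by
      refine Finset.sum_congr rfl fun k hk => ?_
      have : γs k = 0 := by simpa [hS, supp] using hk
      simp [hv, this]
    have a3 : ∑ k ∈ S, |γs k| ≤ ∑ k ∈ S, |γh k| + ∑ k ∈ S, |v k| := by
      rw [← Finset.sum_add_distrib]
      refine Finset.sum_le_sum fun k _ => ?_
      have := abs_sub_abs_le_abs_sub (γs k) (γh k)
      rw [abs_sub_comm] at this
      simp only [hv, Pi.sub_apply]
      linarith
    linarith
  set a := ∑ k ∈ S, |v k| with ha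
  set b := ∑ k ∈ Sᶜ, |v k| with hb
  have h10 : 3 / 4 * Q ≤ lam * (3 / 2 * a - 1 / 2 * b) := by
    have := mul_le_mul_of_nonneg_left h9 hlam.le
    rw [h8] at h2 hδ
    have hexp : 1 / (n : ℝ) * sqNorm (Z *ᵥ v) = Q := rfl
    have : Q ≤ 1 / (n : ℝ) * (X *ᵥ δ ⬝ᵥ Z *ᵥ v) + 1 / (n : ℝ) * (w ⬝ᵥ Z *ᵥ v)
        + lam * (l1 γs - l1 γh) := by
      rw [hQ]; linarith
    nlinarith
  have hcone : b ≤ 3 * a := by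
    by_contra! hcon
    have : lam * (3 / 2 * a - 1 / 2 * b) < 0 := mul_neg_of_pos_of_neg hlam (by linarith)
    linarith
  have h11 : μ * sqNorm v ≤ Q := hREC v hcone
  have ha0 : 0 ≤ a := Finset.sum_nonneg fun _ _ => abs_nonneg _
  have hb0 : 0 ≤ b := Finset.sum_nonneg fun _ _ => abs_nonneg _
  have h12 : a ^ 2 ≤ S.card * sqNorm v := by
    have h := sq_sum_le_card_mul_sum_sq (s := S) (f := fun k => |v k|)
    simp only [sq_abs] at h
    refine h.trans (mul_le_mul_of_nonneg_left ?_ (Nat.cast_nonneg _))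
    exact Finset.sum_le_sum_of_subset_of_nonneg (Finset.subset_univ _) fun _ _ _ => sq_nonneg _
  have h13 : Q ≤ 2 * lam * a := by nlinarith
  have h14 : μ * a ^ 2 ≤ S.card * (2 * lam * a) := by
    calc μ * a ^ 2 ≤ μ * (S.card * sqNorm v) := by gcongr
      _ = S.card * (μ * sqNorm v) := by ring
      _ ≤ S.card * (2 * lam * a) :=
        mul_le_mul_of_nonneg_left (h11.trans h13) (Nat.cast_nonneg _)
  have h15 : μ * a ≤ 2 * lam * S.card := by
    rcases ha0.eq_or_lt with h0 | h0
    · rw [← h0]; simp; positivity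
    · nlinarith
  rw [h8, le_div_iff₀ hμ]
  nlinarith

end Deterministic

/-! ### Exponential moments of squares of sub-Gaussian variables -/

section GaussianTrick

open scoped ENNReal NNReal

lemma lintegral_exp_sq_gaussianReal {V β : ℝ} (hβ : 0 < β) (h : 2 * V * β < 1) :
    ∫⁻ x, ENNReal.ofReal (Real.exp (V / 2 * x ^ 2)) ∂(gaussianReal 0 (2 * β).toNNReal)
      = ENNReal.ofReal (1 / √(1 - 2 * V * β)) := by
  have hv : (2 * β).toNNReal ≠ 0 := by simpa using hβ
  have hc : 0 < (1 - 2 * V * β) / (4 * β) := div_pos (by linarith) (by linarith)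
  rw [gaussianReal_of_var_ne_zero _ hv, lintegral_withDensity_eq_lintegral_mul _
    (measurable_gaussianPDF _ _) (by fun_prop)]
  have e : ∀ x : ℝ, (gaussianPDF 0 (2 * β).toNNReal *
      fun x => ENNReal.ofReal (Real.exp (V / 2 * x ^ 2))) x
      = ENNReal.ofReal ((√(4 * Real.pi * β))⁻¹ *
        Real.exp (-((1 - 2 * V * β) / (4 * β)) * x ^ 2)) := by
    intro x
    rw [Pi.mul_apply, gaussianPDF, ← ENNReal.ofReal_mul (gaussianPDFReal_nonneg _ _ _),
      gaussianPDFReal, mul_assoc, ← Real.exp_add, Real.coe_toNNReal _ (by positivity)]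
    congr 3
    · congr 1; ring
    · field_simp
      ring_nf
  simp_rw [e]
  rw [← ofReal_integral_eq_lintegral_ofReal ((integrable_exp_neg_mul_sq hc).const_mul _)
    (ae_of_all _ fun x => by positivity), integral_const_mul, integral_gaussian,
    ← Real.sqrt_inv, ← Real.sqrt_mul (by positivity), one_div, ← Real.sqrt_inv]
  congr 2
  have := Real.pi_pos
  have h3 : 1 - 2 * V * β ≠ 0 := by linarith
  field_simp

variable {Ω : Type*} [MeasurableSpace Ω] {P : Measure Ω} [IsProbabilityMeasure P]

/-- If the vector `L` is sub-Gaussian with variance proxy `V`, then `exp (β ‖L‖²)` has the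
expectation bound of a standard Gaussian vector of variance `V`: write
`exp (β ‖L‖²)` as a Gaussian average of exponentials of linear forms in `L`. -/
lemma lintegral_exp_sum_sq_le {κ : Type*} [Fintype κ] {L : κ → Ω → ℝ}
    (hLm : ∀ k, Measurable (L k)) {V β : ℝ} (hβ : 0 < β) (h2 : 2 * V * β < 1)
    (h : ∀ b : κ → ℝ, Integrable (fun ω => Real.exp (∑ k, b k * L k ω)) P ∧
      ∫ ω, Real.exp (∑ k, b k * L k ω) ∂P ≤ Real.exp (V / 2 * ∑ k, b k ^ 2)) :
    ∫⁻ ω, ENNReal.ofReal (Real.exp (β * ∑ k, L k ω ^ 2)) ∂P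
      ≤ ENNReal.ofReal ((1 / √(1 - 2 * V * β)) ^ Fintype.card κ) := by
  set G : Measure (κ → ℝ) := Measure.pi fun _ => gaussianReal 0 (2 * β).toNNReal with hG
  -- Gaussian linearization of the square
  have h1 : ∀ ω, ENNReal.ofReal (Real.exp (β * ∑ k, L k ω ^ 2))
      = ∫⁻ b, ENNReal.ofReal (Real.exp (∑ k, b k * L k ω)) ∂G := by
    intro ω
    have hint : ∀ k, Integrable (fun x => Real.exp (x * L k ω))
        (gaussianReal 0 (2 * β).toNNReal) := by
      intro k
      simpa [mul_comm] using integrable_exp_mul_gaussianReal (μ := 0)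
        (v := (2 * β).toNNReal) (L k ω)
    have hi := Integrable.fintype_prod (μ := fun _ : κ => gaussianReal 0 (2 * β).toNNReal) hint
    simp_rw [Real.exp_sum]
    rw [← ofReal_integral_eq_lintegral_ofReal hi
      (ae_of_all _ fun b => Finset.prod_nonneg fun k _ => (Real.exp_pos _).le),
      integral_fintype_prod_eq_prod (fun k x => Real.exp (x * L k ω)), Finset.mul_sum,
      Real.exp_sum]
    congr 1
    refine Finset.prod_congr rfl fun k _ => ?_
    have := congrFun (mgf_fun_id_gaussianReal (μ := 0) (v := (2 * β).toNNReal)) (L k ω)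
    simp only [mgf] at this
    simp_rw [mul_comm _ (L k ω)]
    rw [this, Real.coe_toNNReal _ (by positivity)]
    congr 1
    ring
  simp_rw [h1]
  rw [lintegral_lintegral_swap]
  · have h3 : ∀ b : κ → ℝ, ∫⁻ ω, ENNReal.ofReal (Real.exp (∑ k, b k * L k ω)) ∂P
        ≤ ENNReal.ofReal (∏ k, Real.exp (V / 2 * b k ^ 2)) := by
      intro b
      rw [← ofReal_integral_eq_lintegral_ofReal (h b).1 (ae_of_all _ fun _ => (Real.exp_pos _).le)]
      refine ENNReal.ofReal_le_ofReal ((h b).2.trans (le_of_eq ?_))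
      rw [Finset.mul_sum, Real.exp_sum]
    refine (lintegral_mono h3).trans ?_
    have h4 : Integrable (fun x => Real.exp (V / 2 * x ^ 2))
        (gaussianReal 0 (2 * β).toNNReal) := by
      refine ⟨by fun_prop, ?_⟩
      rw [hasFiniteIntegral_iff_ofReal (ae_of_all _ fun _ => (Real.exp_pos _).le),
        lintegral_exp_sq_gaussianReal hβ h2]
      exact ENNReal.ofReal_lt_top
    have h5 : ∫ x, Real.exp (V / 2 * x ^ 2) ∂(gaussianReal 0 (2 * β).toNNReal)
        = 1 / √(1 - 2 * V * β) := by
      rw [integral_eq_lintegral_of_nonneg_ae (ae_of_all _ fun _ => (Real.exp_pos _).le)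
        (by fun_prop), lintegral_exp_sq_gaussianReal hβ h2, ENNReal.toReal_ofReal (by positivity)]
    rw [← ofReal_integral_eq_lintegral_ofReal (Integrable.fintype_prod fun _ => h4)
      (ae_of_all _ fun b => Finset.prod_nonneg fun k _ => (Real.exp_pos _).le),
      integral_fintype_prod_eq_pow (fun x => Real.exp (V / 2 * x ^ 2)), h5]
  · refine Measurable.aemeasurable ?_
    unfold Function.uncurry
    fun_prop

/-- The scalar form of sub-Gaussianity used below: `L` is measurable and its moment generating
function is at most that of a centred Gaussian of variance `V`. -/
structure IsSubG (P : Measure Ω) (L : Ω → ℝ) (V : ℝ) : Prop where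
  meas : Measurable L
  mgf_le : ∀ t : ℝ, Integrable (fun ω => Real.exp (t * L ω)) P ∧
    ∫ ω, Real.exp (t * L ω) ∂P ≤ Real.exp (V / 2 * t ^ 2)

lemma IsSubG.exp_sq {L : Ω → ℝ} {V : ℝ} (hL : IsSubG P L V) (hV : 0 < V) :
    Integrable (fun ω => Real.exp (L ω ^ 2 / (4 * V))) P ∧
      ∫ ω, Real.exp (L ω ^ 2 / (4 * V)) ∂P ≤ 2 := by
  have hm := hL.meas
  have h2 : 2 * V * (1 / (4 * V)) = 1 / 2 := by field_simp; norm_num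
  have h := lintegral_exp_sum_sq_le (κ := Unit) (L := fun _ => L) (P := P) (fun _ => hL.meas)
    (V := V) (β := 1 / (4 * V)) (by positivity) (by rw [h2]; norm_num)
    (fun b => by simpa using hL.mgf_le (b ()))
  rw [h2] at h
  simp only [Finset.univ_unique, Finset.sum_singleton, Fintype.card_unit, pow_one] at h
  have e : ∀ ω, 1 / (4 * V) * L ω ^ 2 = L ω ^ 2 / (4 * V) := fun ω => by ring
  simp_rw [e] at h
  have hs : 1 / √(1 - 1 / 2 : ℝ) ≤ 2 := by
    rw [div_le_iff₀ (by positivity)]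
    have : (1 / 2 : ℝ) ≤ √(1 - 1 / 2) := Real.le_sqrt_of_sq_le (by norm_num)
    linarith
  refine ⟨⟨by fun_prop, ?_⟩, ?_⟩
  · rw [hasFiniteIntegral_iff_ofReal (ae_of_all _ fun _ => (Real.exp_pos _).le)]
    exact h.trans_lt ENNReal.ofReal_lt_top
  · rw [integral_eq_lintegral_of_nonneg_ae (ae_of_all _ fun _ => (Real.exp_pos _).le)
      (by fun_prop)]
    refine (ENNReal.toReal_mono ENNReal.ofReal_ne_top h).trans ?_
    rwa [ENNReal.toReal_ofReal (by positivity)]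

lemma IsSubG.pow_four {L : Ω → ℝ} {V : ℝ} (hL : IsSubG P L V) (hV : 0 < V) :
    Integrable (fun ω => L ω ^ 4) P ∧ ∫ ω, L ω ^ 4 ∂P ≤ 64 * V ^ 2 := by
  have hm := hL.meas
  obtain ⟨hi, hb⟩ := hL.exp_sq hV
  have hle : ∀ ω, L ω ^ 4 ≤ 32 * V ^ 2 * Real.exp (L ω ^ 2 / (4 * V)) := by
    intro ω
    have h0 : 0 ≤ L ω ^ 2 / (4 * V) := by positivity
    have := Real.quadratic_le_exp_of_nonneg h0
    have h1 : (L ω ^ 2 / (4 * V)) ^ 2 / 2 ≤ Real.exp (L ω ^ 2 / (4 * V)) := by linarith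
    calc L ω ^ 4 = 32 * V ^ 2 * ((L ω ^ 2 / (4 * V)) ^ 2 / 2) := by field_simp; ring
      _ ≤ _ := by gcongr
  have hint : Integrable (fun ω => L ω ^ 4) P := by
    refine (hi.const_mul (32 * V ^ 2)).mono' (by fun_prop) (ae_of_all _ fun ω => ?_)
    rw [Real.norm_of_nonneg (by positivity)]
    exact hle ω
  refine ⟨hint, (integral_mono hint (hi.const_mul _) hle).trans ?_⟩
  rw [integral_const_mul]
  nlinarith [sq_nonneg V]

lemma IsSubG.memLp_four {L : Ω → ℝ} {V : ℝ} (hL : IsSubG P L V) (hV : 0 < V) : MemLp L 4 P := by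
  have h := (hL.pow_four hV).1
  rw [← integrable_norm_rpow_iff hL.meas.aestronglyMeasurable (by norm_num) (by norm_num)]
  refine h.congr (ae_of_all _ fun ω => ?_)
  simp only [Real.norm_eq_abs]
  rw [show ((4 : ℝ≥0∞).toReal) = ((4 : ℕ) : ℝ) by simp, Real.rpow_natCast]
  exact (Even.pow_abs (by decide) _).symm

lemma IsSubG.memLp_two {L : Ω → ℝ} {V : ℝ} (hL : IsSubG P L V) (hV : 0 < V) : MemLp L 2 P :=
  (hL.memLp_four hV).mono_exponent (by norm_num)

lemma IsSubG.integrable_mul {L₁ L₂ : Ω → ℝ} {V₁ V₂ : ℝ} (h₁ : IsSubG P L₁ V₁)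
    (h₂ : IsSubG P L₂ V₂) (hV₁ : 0 < V₁) (hV₂ : 0 < V₂) :
    Integrable (fun ω => L₁ ω * L₂ ω) P :=
  (h₁.memLp_two hV₁).integrable_mul (h₂.memLp_two hV₂)

lemma IsSubG.mul_sq {L₁ L₂ : Ω → ℝ} {V : ℝ} (h₁ : IsSubG P L₁ V) (h₂ : IsSubG P L₂ V)
    (hV : 0 < V) :
    Integrable (fun ω => (L₁ ω * L₂ ω) ^ 2) P ∧ ∫ ω, (L₁ ω * L₂ ω) ^ 2 ∂P ≤ 64 * V ^ 2 := by
  have hm₁ := h₁.meas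
  have hm₂ := h₂.meas
  obtain ⟨i₁, b₁⟩ := h₁.pow_four hV
  obtain ⟨i₂, b₂⟩ := h₂.pow_four hV
  have hle : ∀ ω, (L₁ ω * L₂ ω) ^ 2 ≤ (L₁ ω ^ 4 + L₂ ω ^ 4) / 2 := by
    intro ω
    nlinarith [sq_nonneg (L₁ ω ^ 2 - L₂ ω ^ 2)]
  have hint : Integrable (fun ω => (L₁ ω * L₂ ω) ^ 2) P := by
    refine ((i₁.add i₂).div_const 2).mono' (by fun_prop) (ae_of_all _ fun ω => ?_)
    rw [Real.norm_of_nonneg (by positivity)]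
    exact hle ω
  refine ⟨hint, (integral_mono hint ((i₁.add i₂).div_const 2) hle).trans ?_⟩
  rw [integral_div]
  simp only [Pi.add_apply]
  rw [integral_add i₁ i₂]
  linarith

lemma one_add_sq_div_two_le_cosh (x : ℝ) : 1 + x ^ 2 / 2 ≤ Real.cosh x := by
  have h1 : Real.cosh x = 1 + 2 * Real.sinh (|x| / 2) ^ 2 := by
    rw [← Real.cosh_abs x]
    have h := Real.cosh_two_mul (|x| / 2)
    rw [mul_div_cancel₀ _ two_ne_zero, Real.cosh_sq] at h
    linarith
  have h2 : |x| / 2 ≤ Real.sinh (|x| / 2) := Real.self_le_sinh_iff.2 (by positivity)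
  have h3 : (|x| / 2) ^ 2 ≤ Real.sinh (|x| / 2) ^ 2 := by gcongr
  rw [div_pow, sq_abs] at h3
  linarith

lemma IsSubG.sq_le {L : Ω → ℝ} {V : ℝ} (hL : IsSubG P L V) (hV : 0 < V) :
    ∫ ω, L ω ^ 2 ∂P ≤ V := by
  have hi : Integrable (fun ω => L ω ^ 2) P := by
    simpa [sq] using hL.integrable_mul hL hV hV
  -- compare `1 + (tL)²/2 ≤ cosh (tL)` in expectation and let `t → 0`
  have key : ∀ s : ℝ, 0 < s → V / 2 * s ≤ 1 → ∫ ω, L ω ^ 2 ∂P ≤ V + V ^ 2 / 2 * s := by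
    intro s hs hs1
    have hss : √s ^ 2 = s := Real.sq_sqrt hs.le
    obtain ⟨i₁, b₁⟩ := hL.mgf_le (√s)
    obtain ⟨i₂, b₂⟩ := hL.mgf_le (-√s)
    rw [neg_sq, hss] at b₂
    rw [hss] at b₁
    have hle : ∀ ω, 1 + s / 2 * L ω ^ 2 ≤
        (Real.exp (√s * L ω) + Real.exp (-√s * L ω)) / 2 := by
      intro ω
      have := one_add_sq_div_two_le_cosh (√s * L ω)
      rw [Real.cosh_eq, mul_pow, hss, ← neg_mul] at this
      linarith
    have h := integral_mono ((integrable_const (1 : ℝ)).add (hi.const_mul (s / 2)))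
      ((i₁.add i₂).div_const 2) hle
    simp only [Pi.add_apply] at h
    rw [integral_add (integrable_const _) (hi.const_mul _), integral_div, integral_add i₁ i₂,
      integral_const_mul] at h
    simp only [integral_const, probReal_univ, smul_eq_mul, mul_one] at h
    have h2 : Real.exp (V / 2 * s) ≤ 1 + V / 2 * s + (V / 2 * s) ^ 2 := by
      have := Real.abs_exp_sub_one_sub_id_le (x := V / 2 * s)
        (by rw [abs_of_nonneg (by positivity)]; exact hs1)
      linarith [le_abs_self (Real.exp (V / 2 * s) - 1 - V / 2 * s)]
    have h3 : s * ∫ ω, L ω ^ 2 ∂P ≤ s * (V + V ^ 2 / 2 * s) := by nlinarith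
    exact le_of_mul_le_mul_left h3 hs
  refine le_of_forall_pos_le_add fun ε hε => ?_
  have hpos : 0 < min (2 / V) (2 * ε / V ^ 2) := by positivity
  have h1 : V / 2 * min (2 / V) (2 * ε / V ^ 2) ≤ 1 := by
    calc V / 2 * min (2 / V) (2 * ε / V ^ 2) ≤ V / 2 * (2 / V) := by
          gcongr; exact min_le_left _ _
      _ = 1 := by field_simp
  refine (key _ hpos h1).trans ?_
  have h2 : V ^ 2 / 2 * min (2 / V) (2 * ε / V ^ 2) ≤ V ^ 2 / 2 * (2 * ε / V ^ 2) := by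
    gcongr; exact min_le_right _ _
  have h3 : V ^ 2 / 2 * (2 * ε / V ^ 2) = ε := by field_simp
  linarith

end GaussianTrick

/-! ### Deviation inequalities for sums of independent variables -/

section Deviation

lemma exp_le_quadratic_add (x : ℝ) :
    Real.exp x ≤ 1 + x + x ^ 2 / 2 + |x| ^ 3 * Real.exp |x| := by
  have h := Complex.norm_exp_sub_sum_le_norm_mul_exp (x : ℂ) 3
  have e : Complex.exp (x : ℂ) - ∑ m ∈ Finset.range 3, (x : ℂ) ^ m / (m.factorial : ℂ)
      = ((Real.exp x - (1 + x + x ^ 2 / 2) : ℝ) : ℂ) := by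
    simp [Finset.sum_range_succ, Nat.factorial]
  rw [e, Complex.norm_real, Complex.norm_real, Real.norm_eq_abs, Real.norm_eq_abs] at h
  linarith [le_abs_self (Real.exp x - (1 + x + x ^ 2 / 2))]

variable {Ω : Type*} [MeasurableSpace Ω] {P : Measure Ω} [IsProbabilityMeasure P]

/-- Bernstein-type bound, with the exact variance in the leading term, for the moment generating
function of a centred product of two sub-Gaussian variables. -/
lemma IsSubG.mgf_mul_le {L₁ L₂ : Ω → ℝ} {V v : ℝ} (h₁ : IsSubG P L₁ V) (h₂ : IsSubG P L₂ V)
    (hV : 0 < V) (h0 : ∫ ω, L₁ ω * L₂ ω ∂P = 0) (hv : ∫ ω, (L₁ ω * L₂ ω) ^ 2 ∂P ≤ v)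
    {t : ℝ} (ht : |t| ≤ 1 / (8 * V)) :
    Integrable (fun ω => Real.exp (t * (L₁ ω * L₂ ω))) P ∧
    ∫ ω, Real.exp (t * (L₁ ω * L₂ ω)) ∂P
      ≤ Real.exp (v / 2 * t ^ 2 + 12 * (8 * V) ^ 3 * |t| ^ 3) := by
  have hm₁ := h₁.meas
  have hm₂ := h₂.meas
  obtain ⟨i₁, b₁⟩ := h₁.exp_sq hV
  obtain ⟨i₂, b₂⟩ := h₂.exp_sq hV
  have hW := h₁.integrable_mul h₂ hV hV
  obtain ⟨hW2, -⟩ := h₁.mul_sq h₂ hV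
  set c := 1 / (8 * V) with hc
  have hcpos : 0 < c := by positivity
  have hexp : ∀ ω, Real.exp (2 * c * |L₁ ω * L₂ ω|) ≤
      (Real.exp (L₁ ω ^ 2 / (4 * V)) + Real.exp (L₂ ω ^ 2 / (4 * V))) / 2 := by
    intro ω
    set x := Real.exp (L₁ ω ^ 2 / (8 * V)) with hx
    set y := Real.exp (L₂ ω ^ 2 / (8 * V)) with hy
    have e1 : Real.exp (L₁ ω ^ 2 / (4 * V)) = x ^ 2 := by
      rw [hx, ← Real.exp_nat_mul]; congr 1; push_cast; field_simp; ring
    have e2 : Real.exp (L₂ ω ^ 2 / (4 * V)) = y ^ 2 := by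
      rw [hy, ← Real.exp_nat_mul]; congr 1; push_cast; field_simp; ring
    have e3 : Real.exp (2 * c * |L₁ ω * L₂ ω|) ≤ x * y := by
      rw [hx, hy, ← Real.exp_add]
      refine Real.exp_le_exp.2 ?_
      have h : 2 * |L₁ ω * L₂ ω| ≤ L₁ ω ^ 2 + L₂ ω ^ 2 := by
        rw [abs_mul]
        nlinarith [sq_nonneg (|L₁ ω| - |L₂ ω|), sq_abs (L₁ ω), sq_abs (L₂ ω)]
      calc 2 * c * |L₁ ω * L₂ ω| = c * (2 * |L₁ ω * L₂ ω|) := by ring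
        _ ≤ c * (L₁ ω ^ 2 + L₂ ω ^ 2) := by gcongr
        _ = _ := by rw [hc]; ring
    rw [e1, e2]
    nlinarith [sq_nonneg (x - y)]
  have hi : Integrable (fun ω => Real.exp (2 * c * |L₁ ω * L₂ ω|)) P := by
    refine ((i₁.add i₂).div_const 2).mono' (by fun_prop) (ae_of_all _ fun ω => ?_)
    rw [Real.norm_of_nonneg (Real.exp_pos _).le]
    exact hexp ω
  have hib : ∫ ω, Real.exp (2 * c * |L₁ ω * L₂ ω|) ∂P ≤ 2 := by
    refine (integral_mono hi ((i₁.add i₂).div_const 2) hexp).trans ?_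
    rw [integral_div]
    simp only [Pi.add_apply]
    rw [integral_add i₁ i₂]
    linarith
  have htW : ∀ ω, |t * (L₁ ω * L₂ ω)| ≤ c * |L₁ ω * L₂ ω| := fun ω => by
    rw [abs_mul]; gcongr
  have hbound : ∀ ω, Real.exp (t * (L₁ ω * L₂ ω)) ≤ (1 + t * (L₁ ω * L₂ ω))
      + (t ^ 2 / 2 * (L₁ ω * L₂ ω) ^ 2
        + |t| ^ 3 * (6 * (8 * V) ^ 3) * Real.exp (2 * c * |L₁ ω * L₂ ω|)) := by
    intro ω
    set W := L₁ ω * L₂ ω with hWd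
    have hq := exp_le_quadratic_add (t * W)
    have h3 : (c * |W|) ^ 3 / 6 ≤ Real.exp (c * |W|) := by
      have := Real.pow_div_factorial_le_exp (x := c * |W|) (by positivity) 3
      simpa [Nat.factorial] using this
    have h4 : |W| ^ 3 ≤ 6 * (8 * V) ^ 3 * Real.exp (c * |W|) := by
      calc |W| ^ 3 = 6 * (8 * V) ^ 3 * ((c * |W|) ^ 3 / 6) := by
            rw [hc]; field_simp
        _ ≤ _ := by gcongr
    have h5 : Real.exp |t * W| ≤ Real.exp (c * |W|) := Real.exp_le_exp.2 (htW ω)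
    have h6 : |t * W| ^ 3 * Real.exp |t * W| ≤
        |t| ^ 3 * (6 * (8 * V) ^ 3) * Real.exp (2 * c * |W|) := by
      rw [abs_mul t W, mul_pow]
      rw [abs_mul t W] at h5
      calc |t| ^ 3 * |W| ^ 3 * Real.exp (|t| * |W|)
          ≤ |t| ^ 3 * (6 * (8 * V) ^ 3 * Real.exp (c * |W|)) * Real.exp (c * |W|) := by gcongr
        _ = |t| ^ 3 * (6 * (8 * V) ^ 3) * (Real.exp (c * |W|) * Real.exp (c * |W|)) := by ring
        _ = _ := by rw [← Real.exp_add]; ring_nf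
    have h7 : (t * W) ^ 2 / 2 = t ^ 2 / 2 * W ^ 2 := by ring
    linarith
  have hint : Integrable (fun ω => Real.exp (t * (L₁ ω * L₂ ω))) P := by
    refine hi.mono' (by fun_prop) (ae_of_all _ fun ω => ?_)
    rw [Real.norm_of_nonneg (Real.exp_pos _).le]
    refine Real.exp_le_exp.2 ((le_abs_self _).trans ((htW ω).trans ?_))
    have : 0 ≤ c * |L₁ ω * L₂ ω| := by positivity
    linarith
  refine ⟨hint, ?_⟩
  have ia : Integrable (fun ω => 1 + t * (L₁ ω * L₂ ω)) P :=
    (integrable_const _).add (hW.const_mul _)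
  have ib : Integrable (fun ω => t ^ 2 / 2 * (L₁ ω * L₂ ω) ^ 2
        + |t| ^ 3 * (6 * (8 * V) ^ 3) * Real.exp (2 * c * |L₁ ω * L₂ ω|)) P :=
    (hW2.const_mul _).add (hi.const_mul _)
  have h := integral_mono hint (ia.add ib) hbound
  simp only [Pi.add_apply] at h
  rw [integral_add ia ib, integral_add (integrable_const _) (hW.const_mul _),
    integral_add (hW2.const_mul _) (hi.const_mul _), integral_const_mul, integral_const_mul,
    integral_const_mul, h0] at h
  simp only [integral_const, probReal_univ, smul_eq_mul, mul_one, mul_zero, add_zero] at h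
  have h8 : t ^ 2 / 2 * ∫ ω, (L₁ ω * L₂ ω) ^ 2 ∂P ≤ t ^ 2 / 2 * v := by gcongr
  have h9 : |t| ^ 3 * (6 * (8 * V) ^ 3) * ∫ ω, Real.exp (2 * c * |L₁ ω * L₂ ω|) ∂P
      ≤ |t| ^ 3 * (6 * (8 * V) ^ 3) * 2 := by gcongr
  have h10 := Real.add_one_le_exp (v / 2 * t ^ 2 + 12 * (8 * V) ^ 3 * |t| ^ 3)
  linarith

/-- Two-sided Chernoff bound from the moment generating function at `t` and `-t`. -/
lemma chernoff_two_sided {S : Ω → ℝ} {t c y : ℝ} (ht : 0 ≤ t)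
    (h₁ : Integrable (fun ω => Real.exp (t * S ω)) P)
    (h₂ : Integrable (fun ω => Real.exp (-t * S ω)) P)
    (b₁ : ∫ ω, Real.exp (t * S ω) ∂P ≤ Real.exp c)
    (b₂ : ∫ ω, Real.exp (-t * S ω) ∂P ≤ Real.exp c) :
    P.real {ω | y ≤ |S ω|} ≤ 2 * Real.exp (c - t * y) := by
  have hsub : {ω | y ≤ |S ω|} ⊆ {ω | y ≤ S ω} ∪ {ω | S ω ≤ -y} := by
    intro ω hω
    rcases le_abs.1 (show y ≤ |S ω| from hω) with h | h
    · exact Or.inl h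
    · exact Or.inr (show S ω ≤ -y by linarith)
  have u := measure_ge_le_exp_mul_mgf (μ := P) (X := S) y ht h₁
  have l := measure_le_le_exp_mul_mgf (μ := P) (X := S) (-y) (neg_nonpos.2 ht) h₂
  have e : Real.exp (c - t * y) = Real.exp (-t * y) * Real.exp c := by
    rw [← Real.exp_add]; ring_nf
  have u' : Real.exp (-t * y) * mgf S P t ≤ Real.exp (c - t * y) := by
    rw [e]; exact mul_le_mul_of_nonneg_left b₁ (Real.exp_pos _).le
  have l' : Real.exp (- -t * -y) * mgf S P (-t) ≤ Real.exp (c - t * y) := by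
    rw [e, show - -t * -y = -t * y by ring]
    exact mul_le_mul_of_nonneg_left b₂ (Real.exp_pos _).le
  calc P.real {ω | y ≤ |S ω|} ≤ P.real ({ω | y ≤ S ω} ∪ {ω | S ω ≤ -y}) :=
        measureReal_mono hsub
    _ ≤ _ := measureReal_union_le _ _
    _ ≤ _ := by linarith

lemma chernoff_iid_sum {f : Ω → ℝ} {n : ℕ} {t c y : ℝ} (ht : 0 ≤ t)
    (h₁ : Integrable (fun ω => Real.exp (t * f ω)) P)
    (h₂ : Integrable (fun ω => Real.exp (-t * f ω)) P)
    (b₁ : ∫ ω, Real.exp (t * f ω) ∂P ≤ Real.exp c)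
    (b₂ : ∫ ω, Real.exp (-t * f ω) ∂P ≤ Real.exp c) :
    (Measure.pi fun _ : Fin n => P).real {x | y ≤ |∑ i, f (x i)|}
      ≤ 2 * Real.exp (n * c - t * y) := by
  have aux : ∀ s : ℝ, Integrable (fun ω => Real.exp (s * f ω)) P →
      ∫ ω, Real.exp (s * f ω) ∂P ≤ Real.exp c →
      Integrable (fun x : Fin n → Ω => Real.exp (s * ∑ i, f (x i)))
        (Measure.pi fun _ : Fin n => P) ∧
      ∫ x : Fin n → Ω, Real.exp (s * ∑ i, f (x i)) ∂(Measure.pi fun _ : Fin n => P)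
        ≤ Real.exp (n * c) := by
    intro s hi hb
    simp_rw [Finset.mul_sum, Real.exp_sum]
    refine ⟨Integrable.fintype_prod fun _ => hi, ?_⟩
    rw [integral_fintype_prod_eq_pow (fun ω => Real.exp (s * f ω)), Fintype.card_fin,
      Real.exp_nat_mul]
    exact pow_le_pow_left₀ (integral_nonneg fun _ => (Real.exp_pos _).le) hb n
  exact chernoff_two_sided ht (aux t h₁ b₁).1 (aux (-t) h₂ b₂).1 (aux t h₁ b₁).2 (aux (-t) h₂ b₂).2

lemma chebyshev_iid_sum {f : Ω → ℝ} (hf : MemLp f 2 P) {n : ℕ} {m v y : ℝ}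
    (hm : ∫ ω, f ω ∂P = m) (hv : ∫ ω, f ω ^ 2 ∂P ≤ v) (hy : 0 < y) :
    (Measure.pi fun _ : Fin n => P).real {x | y ≤ |∑ i, f (x i) - n * m|} ≤ n * v / y ^ 2 := by
  have hmp : ∀ i : Fin n, MemLp (fun x : Fin n → Ω => f (x i)) 2 (Measure.pi fun _ => P) :=
    fun i => hf.comp_measurePreserving (measurePreserving_eval (fun _ : Fin n => P) i)
  have hS : MemLp (∑ i, fun x : Fin n → Ω => f (x i)) 2 (Measure.pi fun _ : Fin n => P) :=
    memLp_finsetSum' _ fun i _ => hmp i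
  have hvar := variance_sum_pi (μ := fun _ : Fin n => P) (X := fun _ => f) fun _ => hf
  have hmean : ∫ x, (∑ i, fun x : Fin n → Ω => f (x i)) x ∂(Measure.pi fun _ : Fin n => P)
      = n * m := by
    simp only [Finset.sum_apply]
    rw [integral_finsetSum _ fun i _ => (hmp i).integrable (by norm_num)]
    have : ∀ i : Fin n, ∫ x : Fin n → Ω, f (x i) ∂(Measure.pi fun _ : Fin n => P) = m := by
      intro i
      have hmpe := measurePreserving_eval (fun _ : Fin n => P) i
      have h := integral_map (μ := Measure.pi fun _ : Fin n => P) (f := f)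
        hmpe.measurable.aemeasurable (by rw [hmpe.map_eq]; exact hf.aestronglyMeasurable)
      rw [hmpe.map_eq, hm] at h
      exact h.symm
    simp [this]
  have hch := meas_ge_le_variance_div_sq hS hy
  rw [hvar, hmean] at hch
  have hvf : Var[f; P] ≤ v := by
    rw [variance_eq_sub hf]
    have : 0 ≤ (∫ ω, f ω ∂P) ^ 2 := sq_nonneg _
    simp only [Pi.pow_apply]
    linarith
  have h1 : (∑ _i : Fin n, Var[f; P]) / y ^ 2 ≤ n * v / y ^ 2 := by
    simp only [Finset.sum_const, Finset.card_univ, Fintype.card_fin, nsmul_eq_mul]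
    gcongr
  have hv0 : 0 ≤ v := (integral_nonneg fun _ => sq_nonneg _).trans hv
  have h2 : (Measure.pi fun _ : Fin n => P) {x | y ≤ |∑ i, f (x i) - n * m|}
      ≤ ENNReal.ofReal (n * v / y ^ 2) := by
    refine le_trans (le_of_eq ?_) (hch.trans (ENNReal.ofReal_le_ofReal h1))
    simp only [Finset.sum_apply]
  exact ENNReal.toReal_le_of_le_ofReal (by positivity) h2

/-- Gaussian tail of a linear form in the noise. -/
lemma gaussian_linear_tail {n : ℕ} (σ : NNReal) (z : Fin n → ℝ) {V y : ℝ} (hV : 0 < V)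
    (hσ : 0 < σ) (hz : sqNorm z ≤ V) (hy : 0 ≤ y) :
    (Measure.pi fun _ : Fin n => gaussianReal 0 (σ ^ 2)).real {w | y ≤ |w ⬝ᵥ z|}
      ≤ 2 * Real.exp (-(y ^ 2 / (2 * σ ^ 2 * V))) := by
  have hσ' : (0 : ℝ) < σ := hσ
  have aux : ∀ t : ℝ, Integrable (fun w : Fin n → ℝ => Real.exp (t * (w ⬝ᵥ z)))
        (Measure.pi fun _ : Fin n => gaussianReal 0 (σ ^ 2)) ∧
      ∫ w : Fin n → ℝ, Real.exp (t * (w ⬝ᵥ z))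
        ∂(Measure.pi fun _ : Fin n => gaussianReal 0 (σ ^ 2))
        ≤ Real.exp (t ^ 2 * σ ^ 2 * V / 2) := by
    intro t
    have e : ∀ w : Fin n → ℝ, Real.exp (t * (w ⬝ᵥ z)) = ∏ i, Real.exp ((t * z i) * w i) := by
      intro w
      rw [← Real.exp_sum, dotProduct, Finset.mul_sum]
      congr 1
      exact Finset.sum_congr rfl fun i _ => by ring
    simp_rw [e]
    refine ⟨Integrable.fintype_prod (f := fun i x => Real.exp ((t * z i) * x))
      fun i => integrable_exp_mul_gaussianReal _, ?_⟩
    rw [integral_fintype_prod_eq_prod (fun i x => Real.exp ((t * z i) * x))]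
    have h : ∀ i, ∫ x, Real.exp ((t * z i) * x) ∂(gaussianReal 0 (σ ^ 2))
        = Real.exp (t ^ 2 * σ ^ 2 / 2 * z i ^ 2) := by
      intro i
      have := congrFun (mgf_fun_id_gaussianReal (μ := 0) (v := σ ^ 2)) (t * z i)
      simp only [mgf] at this
      rw [this]
      push_cast
      ring_nf
    simp_rw [h]
    rw [← Real.exp_sum, ← Finset.mul_sum]
    refine Real.exp_le_exp.2 ?_
    change t ^ 2 * σ ^ 2 / 2 * sqNorm z ≤ _
    nlinarith [mul_le_mul_of_nonneg_left hz (show 0 ≤ t ^ 2 * (σ : ℝ) ^ 2 / 2 by positivity)]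
  set t := y / (σ ^ 2 * V) with ht
  have b₂ := (aux (-t)).2
  rw [neg_sq] at b₂
  refine (chernoff_two_sided (t := t) (c := t ^ 2 * σ ^ 2 * V / 2) (by positivity) (aux t).1
    (aux (-t)).1 (aux t).2 b₂).trans (le_of_eq ?_)
  congr 2
  rw [ht]
  field_simp
  ring

end Deviation

/-! ### Population quantities of a sub-Gaussian row -/

section Row

variable {d p : ℕ} {P : Measure (Row d p)} {C₀ : ℝ}

/-- The population residual `(x - z a)_j` of the `j`-th covariate of interest. -/
noncomputable def rowResid (a : Matrix (Fin p) (Fin d) ℝ) (j : Fin d) (u : Row d p) : ℝ :=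
  (u.1 - u.2 ᵥ* a) j

lemma rowResid_eq (a : Matrix (Fin p) (Fin d) ℝ) (j : Fin d) (u : Row d p) :
    rowResid a j u = u.1 j - ∑ k, u.2 k * a k j := rfl

lemma IsSubG.mono {Ω : Type*} [MeasurableSpace Ω] {Q : Measure Ω} {L : Ω → ℝ} {V V' : ℝ}
    (h : IsSubG Q L V) (hV : V ≤ V') : IsSubG Q L V' :=
  ⟨h.meas, fun t => ⟨(h.mgf_le t).1, (h.mgf_le t).2.trans (Real.exp_le_exp.2 (by gcongr))⟩⟩

lemma SubGaussianRow.isSubG (hP : SubGaussianRow P C₀) (a : Fin d → ℝ) (b : Fin p → ℝ) :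
    IsSubG P (fun u => u.1 ⬝ᵥ a + u.2 ⬝ᵥ b) (C₀ * (sqNorm a + sqNorm b)) := by
  refine ⟨by unfold dotProduct; fun_prop, fun t => ?_⟩
  have h := hP.mgf_le (t • a) (t • b)
  have e : ∀ u : Row d p, u.1 ⬝ᵥ (t • a) + u.2 ⬝ᵥ (t • b) = t * (u.1 ⬝ᵥ a + u.2 ⬝ᵥ b) := by
    intro u
    rw [dotProduct_smul, dotProduct_smul, smul_eq_mul, smul_eq_mul, mul_add]
  simp_rw [e] at h
  refine ⟨h.1, h.2.trans (le_of_eq ?_)⟩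
  rw [sqNorm_smul, sqNorm_smul]
  ring_nf

lemma sqNorm_single {ι : Type*} [Fintype ι] [DecidableEq ι] (k : ι) :
    sqNorm (Pi.single k (1 : ℝ)) = 1 := by
  simp [sqNorm, Pi.single_apply]

lemma sqNorm_zero {ι : Type*} [Fintype ι] : sqNorm (0 : ι → ℝ) = 0 := by simp [sqNorm]

lemma SubGaussianRow.isSubG_fst (hP : SubGaussianRow P C₀) (j : Fin d) :
    IsSubG P (fun u => u.1 j) C₀ := by
  simpa [sqNorm_single, sqNorm_zero] using hP.isSubG (Pi.single j 1) 0

lemma SubGaussianRow.isSubG_snd (hP : SubGaussianRow P C₀) (k : Fin p) :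
    IsSubG P (fun u => u.2 k) C₀ := by
  simpa [sqNorm_single, sqNorm_zero] using hP.isSubG 0 (Pi.single k 1)

lemma SubGaussianRow.isSubG_rowResid' (hP : SubGaussianRow P C₀)
    (a : Matrix (Fin p) (Fin d) ℝ) (j : Fin d) :
    IsSubG P (rowResid a j) (C₀ * (1 + sqNorm fun k => a k j)) := by
  have h := hP.isSubG (Pi.single j 1) (-fun k => a k j)
  rw [sqNorm_single, sqNorm_neg] at h
  convert h using 2 with u
  rw [rowResid_eq, dotProduct_neg, dotProduct_single_one, sub_eq_add_neg]
  rfl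

lemma sqNorm_le_l1_sq {ι : Type*} [Fintype ι] (a : ι → ℝ) : sqNorm a ≤ l1 a ^ 2 := by
  have h := Finset.sum_sq_le_sq_sum_of_nonneg (s := Finset.univ) (f := fun i => |a i|)
    fun i _ => abs_nonneg _
  simpa [sqNorm, l1] using h

lemma SubGaussianRow.isSubG_rowResid (hP : SubGaussianRow P C₀) (hC₀ : 0 < C₀)
    {a : Matrix (Fin p) (Fin d) ℝ} {j : Fin d} {A : ℝ} (hA : l1 (fun k => a k j) ≤ A) :
    IsSubG P (rowResid a j) (C₀ * (1 + A ^ 2)) := by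
  refine (hP.isSubG_rowResid' a j).mono ?_
  have h1 := sqNorm_le_l1_sq fun k => a k j
  have h2 : l1 (fun k => a k j) ^ 2 ≤ A ^ 2 := pow_le_pow_left₀ (l1_nonneg _) hA 2
  gcongr
  linarith

lemma SubGaussianRow.integrable_snd_mul_rowResid [IsProbabilityMeasure P]
    (hP : SubGaussianRow P C₀) (hC₀ : 0 < C₀)
    (a : Matrix (Fin p) (Fin d) ℝ) (k : Fin p) (j : Fin d) :
    Integrable (fun u => u.2 k * rowResid a j u) P :=
  (hP.isSubG_snd k).integrable_mul (hP.isSubG_rowResid' a j) hC₀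
    (mul_pos hC₀ (by linarith [sqNorm_nonneg fun k => a k j]))

lemma SubGaussianRow.integrable_rowResid_mul [IsProbabilityMeasure P]
    (hP : SubGaussianRow P C₀) (hC₀ : 0 < C₀)
    (a b : Matrix (Fin p) (Fin d) ℝ) (j k : Fin d) :
    Integrable (fun u => rowResid a j u * rowResid b k u) P :=
  (hP.isSubG_rowResid' a j).integrable_mul (hP.isSubG_rowResid' b k)
    (mul_pos hC₀ (by linarith [sqNorm_nonneg fun k => a k j]))
    (mul_pos hC₀ (by linarith [sqNorm_nonneg fun i => b i k]))

/-- Normal equations: the population residual of the least favourable direction is uncorrelated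
with the nuisance covariates. -/
lemma SubGaussianRow.integral_snd_mul_rowResid [IsProbabilityMeasure P]
    (hP : SubGaussianRow P C₀) (hC₀ : 0 < C₀)
    (hZZ : (SigmaZZ P).PosDef) (k : Fin p) (j : Fin d) :
    ∫ u, u.2 k * rowResid (alphaStar P) j u ∂P = 0 := by
  have e : ∀ u : Row d p, u.2 k * rowResid (alphaStar P) j u
      = u.2 k * u.1 j - ∑ l, u.2 k * u.2 l * alphaStar P l j := by
    intro u
    rw [rowResid_eq, mul_sub, Finset.mul_sum]
    simp_rw [mul_assoc]
  have i₁ : Integrable (fun u : Row d p => u.2 k * u.1 j) P :=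
    (hP.isSubG_snd k).integrable_mul (hP.isSubG_fst j) hC₀ hC₀
  have i₂ : ∀ l, Integrable (fun u : Row d p => u.2 k * u.2 l * alphaStar P l j) P := fun l =>
    ((hP.isSubG_snd k).integrable_mul (hP.isSubG_snd l) hC₀ hC₀).mul_const _
  simp_rw [e]
  rw [integral_sub i₁ (integrable_finsetSum _ fun l _ => i₂ l), integral_finsetSum _ fun l _ => i₂ l]
  simp_rw [integral_mul_const]
  have h : SigmaZZ P * alphaStar P = SigmaZX P := by
    rw [alphaStar, ← Matrix.mul_assoc, Matrix.mul_nonsing_inv _ hZZ.det_pos.ne'.isUnit,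
      Matrix.one_mul]
  have h' := congrFun (congrFun h k) j
  rw [Matrix.mul_apply] at h'
  simp only [SigmaZZ, SigmaZX, Matrix.of_apply] at h'
  rw [h', sub_self]

/-- Pythagoras for the population residuals. -/
lemma SubGaussianRow.residCov_eq [IsProbabilityMeasure P]
    (hP : SubGaussianRow P C₀) (hC₀ : 0 < C₀)
    (hZZ : (SigmaZZ P).PosDef) (a : Matrix (Fin p) (Fin d) ℝ) :
    residCov P a = residCov P (alphaStar P)
      + (alphaStar P - a)ᵀ * SigmaZZ P * (alphaStar P - a) := by
  ext j k
  set b := alphaStar P - a with hb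
  have e0 : ∀ (i : Fin d) (u : Row d p),
      rowResid a i u = rowResid (alphaStar P) i u + ∑ l, u.2 l * b l i := by
    intro i u
    rw [rowResid_eq, rowResid_eq]
    simp only [hb, Matrix.sub_apply, mul_sub, Finset.sum_sub_distrib]
    ring
  have e : ∀ u : Row d p, rowResid a j u * rowResid a k u
      = rowResid (alphaStar P) j u * rowResid (alphaStar P) k u
        + (∑ l, u.2 l * rowResid (alphaStar P) k u * b l j
          + ∑ l, u.2 l * rowResid (alphaStar P) j u * b l k
          + ∑ m, ∑ l, b l j * (u.2 l * u.2 m) * b m k) := by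
    intro u
    have h1 : ∑ m, ∑ l, b l j * (u.2 l * u.2 m) * b m k
        = (∑ l, u.2 l * b l j) * ∑ m, u.2 m * b m k := by
      rw [Finset.mul_sum]
      refine Finset.sum_congr rfl fun m _ => ?_
      rw [Finset.sum_mul]
      exact Finset.sum_congr rfl fun l _ => by ring
    have h2 : ∑ l, u.2 l * rowResid (alphaStar P) k u * b l j
        = (∑ l, u.2 l * b l j) * rowResid (alphaStar P) k u := by
      rw [Finset.sum_mul]
      exact Finset.sum_congr rfl fun l _ => by ring
    have h3 : ∑ l, u.2 l * rowResid (alphaStar P) j u * b l k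
        = (∑ l, u.2 l * b l k) * rowResid (alphaStar P) j u := by
      rw [Finset.sum_mul]
      exact Finset.sum_congr rfl fun l _ => by ring
    rw [h1, h2, h3, e0, e0]
    ring
  have iε := hP.integrable_rowResid_mul hC₀ (alphaStar P) (alphaStar P) j k
  have i₁ : ∀ i i', ∀ l ∈ Finset.univ, Integrable (fun u : Row d p =>
      u.2 l * rowResid (alphaStar P) i u * b l i') P := fun i i' l _ =>
    (hP.integrable_snd_mul_rowResid hC₀ _ l i).mul_const _
  have i₂ : ∀ m ∈ Finset.univ, ∀ l ∈ Finset.univ, Integrable (fun u : Row d p =>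
      b l j * (u.2 l * u.2 m) * b m k) P := fun m _ l _ =>
    (((hP.isSubG_snd l).integrable_mul (hP.isSubG_snd m) hC₀ hC₀).const_mul _).mul_const _
  have i₂' : ∀ m ∈ Finset.univ, Integrable (fun u : Row d p =>
      ∑ l, b l j * (u.2 l * u.2 m) * b m k) P := fun m hm => integrable_finsetSum _ (i₂ m hm)
  change ∫ u, rowResid a j u * rowResid a k u ∂P = _
  simp_rw [e]
  have j₁ : Integrable (fun u : Row d p => ∑ l, u.2 l * rowResid (alphaStar P) k u * b l j) P :=
    integrable_finsetSum _ (i₁ k j)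
  have j₂ : Integrable (fun u : Row d p => ∑ l, u.2 l * rowResid (alphaStar P) j u * b l k) P :=
    integrable_finsetSum _ (i₁ j k)
  have j₃ : Integrable (fun u : Row d p => ∑ m, ∑ l, b l j * (u.2 l * u.2 m) * b m k) P :=
    integrable_finsetSum _ i₂'
  have j₁₂ : Integrable (fun u : Row d p => ∑ l, u.2 l * rowResid (alphaStar P) k u * b l j
      + ∑ l, u.2 l * rowResid (alphaStar P) j u * b l k) P := j₁.add j₂
  have j₁₂₃ : Integrable (fun u : Row d p => ∑ l, u.2 l * rowResid (alphaStar P) k u * b l j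
      + ∑ l, u.2 l * rowResid (alphaStar P) j u * b l k
      + ∑ m, ∑ l, b l j * (u.2 l * u.2 m) * b m k) P := j₁₂.add j₃
  rw [integral_add iε j₁₂₃, integral_add j₁₂ j₃, integral_add j₁ j₂,
    integral_finsetSum _ (i₁ k j), integral_finsetSum _ (i₁ j k), integral_finsetSum _ i₂']
  simp_rw [integral_mul_const, hP.integral_snd_mul_rowResid hC₀ hZZ, zero_mul,
    Finset.sum_const_zero, zero_add]
  rw [Matrix.add_apply]
  congr 1
  rw [Matrix.mul_apply]
  refine Finset.sum_congr rfl fun m _ => ?_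
  rw [integral_finsetSum _ (i₂ m (Finset.mem_univ m)), Matrix.mul_apply, Finset.sum_mul]
  refine Finset.sum_congr rfl fun l _ => ?_
  rw [integral_mul_const, integral_const_mul]
  rfl

lemma SubGaussianRow.integral_rowResid_sq_le [IsProbabilityMeasure P]
    (hP : SubGaussianRow P C₀) (hC₀ : 0 < C₀)
    (hZZ : (SigmaZZ P).PosDef) (j : Fin d) :
    ∫ u, rowResid (alphaStar P) j u ^ 2 ∂P ≤ C₀ := by
  have h := congrFun (congrFun (hP.residCov_eq hC₀ hZZ 0) j) j
  rw [sub_zero, Matrix.add_apply] at h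
  have h1 : 0 ≤ ((alphaStar P)ᵀ * SigmaZZ P * alphaStar P) j j := by
    have := (hZZ.posSemidef.conjTranspose_mul_mul_same (alphaStar P)).diag_nonneg (i := j)
    simpa [conjTranspose_eq_transpose_of_trivial] using this
  have h2 : residCov P (0 : Matrix (Fin p) (Fin d) ℝ) j j ≤ C₀ := by
    have := (hP.isSubG_fst j).sq_le hC₀
    simpa [residCov, sq] using this
  have h3 : residCov P (alphaStar P) j j = ∫ u, rowResid (alphaStar P) j u ^ 2 ∂P := by
    simp only [sq]
    rfl
  linarith

/-! ### Efficient information -/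

lemma score_eq {σ : NNReal} (hσ : 0 < σ) (θ : Fin d → ℝ) (γ : Fin p → ℝ)
    (a : Matrix (Fin p) (Fin d) ℝ) (j : Fin d) (u : Row d p) (y : ℝ) :
    score σ θ γ a j u y
      = rowResid a j u * (y - (u.1 ⬝ᵥ θ + u.2 ⬝ᵥ γ)) / (σ : ℝ) ^ 2 := by
  have hσ' : (σ : ℝ) ≠ 0 := by exact_mod_cast hσ.ne'
  set m := u.1 ⬝ᵥ θ + u.2 ⬝ᵥ γ with hm
  set r := rowResid a j u with hr
  have hmean : ∀ t : ℝ, u.1 ⬝ᵥ (θ + t • Pi.single j 1) + u.2 ⬝ᵥ (γ - a *ᵥ (t • Pi.single j 1))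
      = m + t * r := by
    intro t
    rw [dotProduct_add, dotProduct_sub, dotProduct_smul, mulVec_smul, dotProduct_smul,
      dotProduct_mulVec, dotProduct_single_one, dotProduct_single_one, hr, rowResid,
      Pi.sub_apply]
    simp only [smul_eq_mul]
    ring
  have hlog : ∀ t : ℝ, Real.log (gaussianPDFReal (m + t * r) (σ ^ 2) y)
      = Real.log ((√(2 * Real.pi * (σ : ℝ) ^ 2))⁻¹)
        + -(y - (m + t * r)) ^ 2 / (2 * (σ : ℝ) ^ 2) := by
    intro t
    have hpos : (√(2 * Real.pi * (σ : ℝ) ^ 2))⁻¹ ≠ 0 := by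
      have := Real.pi_pos
      positivity
    rw [gaussianPDFReal, NNReal.coe_pow, Real.log_mul hpos (Real.exp_pos _).ne', Real.log_exp]
  unfold score
  simp_rw [hmean, hlog]
  have hd : HasDerivAt (fun t : ℝ => Real.log ((√(2 * Real.pi * (σ : ℝ) ^ 2))⁻¹)
        + -(y - (m + t * r)) ^ 2 / (2 * (σ : ℝ) ^ 2))
      (-((2 : ℕ) * (y - (m + 0 * r)) ^ (2 - 1) * -(1 * r)) / (2 * (σ : ℝ) ^ 2)) 0 := by
    have h1 : HasDerivAt (fun t : ℝ => y - (m + t * r)) (-(1 * r)) 0 :=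
      (((hasDerivAt_id (0 : ℝ)).mul_const r).const_add m).const_sub y
    exact (((h1.pow 2).neg).div_const _).const_add _
  rw [hd.deriv, div_eq_div_iff (by positivity) (by positivity)]
  push_cast
  ring

lemma submodelInfo_eq {σ : NNReal} (hσ : 0 < σ) (θ : Fin d → ℝ) (γ : Fin p → ℝ)
    (a : Matrix (Fin p) (Fin d) ℝ) :
    submodelInfo P σ θ γ a = ((σ : ℝ) ^ 2)⁻¹ • residCov P a := by
  have hσ' : (σ : ℝ) ≠ 0 := by exact_mod_cast hσ.ne'
  ext j k
  simp only [submodelInfo, Matrix.of_apply, Matrix.smul_apply, smul_eq_mul, score_eq hσ]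
  have hin : ∀ u : Row d p,
      ∫ y, rowResid a j u * (y - (u.1 ⬝ᵥ θ + u.2 ⬝ᵥ γ)) / (σ : ℝ) ^ 2
        * (rowResid a k u * (y - (u.1 ⬝ᵥ θ + u.2 ⬝ᵥ γ)) / (σ : ℝ) ^ 2)
        ∂(gaussianReal (u.1 ⬝ᵥ θ + u.2 ⬝ᵥ γ) (σ ^ 2))
      = ((σ : ℝ) ^ 2)⁻¹ * (rowResid a j u * rowResid a k u) := by
    intro u
    set m := u.1 ⬝ᵥ θ + u.2 ⬝ᵥ γ with hm
    have hvar : ∫ y, (y - m) ^ 2 ∂(gaussianReal m (σ ^ 2)) = (σ : ℝ) ^ 2 := by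
      have h := variance_fun_id_gaussianReal (μ := m) (v := σ ^ 2)
      rw [variance_eq_integral (by fun_prop), integral_id_gaussianReal] at h
      simpa using h
    have e : ∀ y, rowResid a j u * (y - m) / (σ : ℝ) ^ 2 * (rowResid a k u * (y - m) / (σ : ℝ) ^ 2)
        = rowResid a j u * rowResid a k u / (σ : ℝ) ^ 4 * (y - m) ^ 2 := by
      intro y
      field_simp
    simp_rw [e]
    rw [integral_const_mul, hvar]
    field_simp
  simp_rw [hin]
  rw [integral_const_mul]
  rfl

/-- The least favourable direction is `α*`, and its information is the inverse of `σ² Ω*`. -/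
lemma isEfficientInformation_of_posDef [IsProbabilityMeasure P]
    (hP : SubGaussianRow P C₀) (hC₀ : 0 < C₀)
    (hZZ : (SigmaZZ P).PosDef) (hres : (residCov P (alphaStar P)).PosDef) {σ : NNReal}
    (hσ : 0 < σ) (θ : Fin d → ℝ) (γ : Fin p → ℝ) :
    IsEfficientInformation P σ θ γ (((σ : ℝ) ^ 2 • OmegaStar P)⁻¹) := by
  have hσ' : (0 : ℝ) < (σ : ℝ) ^ 2 := by
    have : (0 : ℝ) < σ := hσ
    positivity
  have hI : ((σ : ℝ) ^ 2 • OmegaStar P)⁻¹ = ((σ : ℝ) ^ 2)⁻¹ • residCov P (alphaStar P) := by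
    refine Matrix.inv_eq_left_inv ?_
    rw [OmegaStar, Matrix.smul_mul, Matrix.mul_smul, smul_smul, inv_mul_cancel₀ hσ'.ne', one_smul,
      Matrix.mul_nonsing_inv _ hres.det_pos.ne'.isUnit]
  rw [hI]
  refine ⟨⟨alphaStar P, submodelInfo_eq hσ θ γ _⟩, fun a => ?_⟩
  rw [submodelInfo_eq hσ, ← smul_sub, hP.residCov_eq hC₀ hZZ a, add_sub_cancel_left]
  refine Matrix.PosSemidef.smul ?_ (inv_nonneg.2 hσ'.le)
  have := hZZ.posSemidef.conjTranspose_mul_mul_same (alphaStar P - a)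
  rwa [conjTranspose_eq_transpose_of_trivial] at this

end Row

/-! ### Uniform control of the node-wise noise -/

section Counting

variable {Ω : Type*} [MeasurableSpace Ω] {P : Measure Ω} [IsProbabilityMeasure P]

/-- At most boundedly many coordinates `L k` of a sub-Gaussian vector with proxy `V` can have
`E (L k ε)² ≥ (3/2) V²`, for a variable `ε` with `E ε² ≤ V`.  Indeed `∑ (L k)²` exceeds
`V N` only by `O(√N)` in mean square, so on average over `k` the variance of `L k ε` is at most
`V E ε² + O(1/√N)`. -/
lemma card_le_of_large_variance {κ : Type*} [Fintype κ] {L : κ → Ω → ℝ} {ε : Ω → ℝ}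
    {V V' : ℝ} (hV : 0 < V) (hV' : 0 < V') (hLm : ∀ k, Measurable (L k))
    (hL : ∀ b : κ → ℝ, Integrable (fun ω => Real.exp (∑ k, b k * L k ω)) P ∧
      ∫ ω, Real.exp (∑ k, b k * L k ω) ∂P ≤ Real.exp (V / 2 * ∑ k, b k ^ 2))
    (hε : IsSubG P ε V') (hε2 : ∫ ω, ε ω ^ 2 ∂P ≤ V)
    (hint : ∀ k, Integrable (fun ω => (L k ω * ε ω) ^ 2) P)
    (hbig : ∀ k, 3 / 2 * V ^ 2 ≤ ∫ ω, (L k ω * ε ω) ^ 2 ∂P) :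
    (Fintype.card κ : ℝ) ≤ (128 * V' / V) ^ 2 := by
  rcases Nat.eq_zero_or_pos (Fintype.card κ) with h0 | hN
  · rw [h0, Nat.cast_zero]; positivity
  have hεm := hε.meas
  set N : ℝ := (Fintype.card κ : ℝ) with hNdef
  have hN1 : (1 : ℝ) ≤ N := by rw [hNdef]; exact_mod_cast hN
  set q := √N with hq
  have hqq : q ^ 2 = N := Real.sq_sqrt (by positivity)
  have hq1 : 1 ≤ q := Real.one_le_sqrt.2 hN1
  have hq0 : 0 < q := by linarith
  set β := 1 / (4 * V * q) with hβ
  have hβ0 : 0 < β := by positivity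
  have hx : 2 * V * β = 1 / (2 * q) := by rw [hβ]; field_simp; norm_num
  have hx2 : 1 / (2 * q) ≤ 1 / 2 := by
    rw [div_le_div_iff₀ (by positivity) (by norm_num)]; linarith
  set x := 1 / (2 * q) with hxd
  have hx0 : 0 < x := by positivity
  have hmgf := lintegral_exp_sum_sq_le (P := P) hLm hβ0 (V := V) (by rw [hx]; linarith) hL
  rw [hx] at hmgf
  -- the Gaussian normalizing factor at `β`
  have hfac : 1 / √(1 - x) ≤ Real.exp (x / 2 + x ^ 2) := by
    have h1 : 1 ≤ (1 - x) * Real.exp (x + 2 * x ^ 2) := by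
      have := Real.add_one_le_exp (x + 2 * x ^ 2)
      nlinarith [mul_le_mul_of_nonneg_left this (by linarith : 0 ≤ 1 - x), sq_nonneg x]
    have h2 : Real.exp (x / 2 + x ^ 2) = √(Real.exp (x + 2 * x ^ 2)) := by
      rw [Real.sqrt_eq_rpow, ← Real.exp_mul]; ring_nf
    rw [h2, div_le_iff₀ (Real.sqrt_pos.2 (by linarith)), ← Real.sqrt_mul (Real.exp_pos _).le,
      mul_comm]
    exact Real.one_le_sqrt.2 h1
  have hpow : (1 / √(1 - x)) ^ Fintype.card κ ≤ 2 * Real.exp (β * (V * N)) := by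
    refine (pow_le_pow_left₀ (by positivity) hfac _).trans ?_
    rw [← Real.exp_nat_mul, ← hNdef]
    have e1 : N * (x / 2 + x ^ 2) = 1 / 4 + β * (V * N) := by
      have e2 : N * x ^ 2 = 1 / 4 := by rw [hxd, ← hqq]; field_simp; norm_num
      have e3 : N * (x / 2) = β * (V * N) := by rw [← hx]; ring
      rw [mul_add, e2, e3]; ring
    rw [e1, Real.exp_add]
    have h3 : Real.exp (1 / 4) ≤ 2 := by
      have := Real.exp_bound' (x := 1 / 4) (by norm_num) (by norm_num) (n := 2) (by norm_num)
      norm_num [Finset.sum_range_succ, Nat.factorial] at this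
      linarith
    gcongr
  set Q : Ω → ℝ := fun ω => ∑ k, L k ω ^ 2 with hQ
  have hQm : Measurable Q := by fun_prop
  have hEi : Integrable (fun ω => Real.exp (β * Q ω)) P := by
    refine ⟨by fun_prop, ?_⟩
    rw [hasFiniteIntegral_iff_ofReal (ae_of_all _ fun _ => (Real.exp_pos _).le)]
    exact hmgf.trans_lt ENNReal.ofReal_lt_top
  have hEb : ∫ ω, Real.exp (β * Q ω) ∂P ≤ 2 * Real.exp (β * (V * N)) := by
    rw [integral_eq_lintegral_of_nonneg_ae (ae_of_all _ fun _ => (Real.exp_pos _).le)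
      (by fun_prop)]
    refine (ENNReal.toReal_mono ENNReal.ofReal_ne_top hmgf).trans ?_
    rwa [ENNReal.toReal_ofReal (by positivity)]
  obtain ⟨i4, b4⟩ := hε.pow_four hV'
  have i2 : Integrable (fun ω => ε ω ^ 2) P := by
    simpa [sq] using hε.integrable_mul hε hV' hV'
  set s := q * V / V' with hs
  have hs0 : 0 < s := by positivity
  set c := Real.exp (-(β * (V * N))) / (β ^ 2 * s) with hc
  have hc0 : 0 < c := by positivity
  have hpt : ∀ ω, ∑ k, (L k ω * ε ω) ^ 2 ≤
      V * N * ε ω ^ 2 + (c * Real.exp (β * Q ω) + s / 2 * ε ω ^ 4) := by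
    intro ω
    have e1 : ∑ k, (L k ω * ε ω) ^ 2 = Q ω * ε ω ^ 2 := by
      rw [hQ, Finset.sum_mul]
      exact Finset.sum_congr rfl fun k _ => by ring
    rw [e1]
    rcases le_total (Q ω) (V * N) with h | h
    · have := mul_le_mul_of_nonneg_right h (sq_nonneg (ε ω))
      have h4 : 0 ≤ c * Real.exp (β * Q ω) + s / 2 * ε ω ^ 4 := by positivity
      linarith
    · set y := Q ω - V * N with hy
      have hy0 : 0 ≤ y := by linarith
      have h1 : (β * y) ^ 2 / 2 ≤ Real.exp (β * y) := by
        have := Real.quadratic_le_exp_of_nonneg (x := β * y) (by positivity)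
        have : 0 ≤ β * y := by positivity
        linarith
      have h2 : y ^ 2 / (2 * s) ≤ c * Real.exp (β * Q ω) := by
        have e2 : c * Real.exp (β * Q ω) = Real.exp (β * y) / (β ^ 2 * s) := by
          rw [hc, div_mul_eq_mul_div, ← Real.exp_add, hy]
          congr 2
          ring
        rw [e2, div_le_div_iff₀ (by positivity) (by positivity)]
        nlinarith [mul_le_mul_of_nonneg_right h1 (by positivity : 0 ≤ 2 * s)]
      have h3 : y * ε ω ^ 2 ≤ y ^ 2 / (2 * s) + s / 2 * ε ω ^ 4 := by
        have e3 : y ^ 2 / (2 * s) + s / 2 * ε ω ^ 4 - y * ε ω ^ 2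
            = (y - s * ε ω ^ 2) ^ 2 / (2 * s) := by
          field_simp
          ring
        have : 0 ≤ (y - s * ε ω ^ 2) ^ 2 / (2 * s) := by positivity
        linarith
      have e4 : Q ω * ε ω ^ 2 = V * N * ε ω ^ 2 + y * ε ω ^ 2 := by rw [hy]; ring
      linarith
  have hI := integral_mono (integrable_finsetSum Finset.univ fun k _ => hint k)
    ((i2.const_mul (V * N)).add ((hEi.const_mul c).add (i4.const_mul (s / 2)))) hpt
  simp only [Pi.add_apply] at hI
  have j₁ : Integrable (fun ω => c * Real.exp (β * Q ω) + s / 2 * ε ω ^ 4) P :=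
    (hEi.const_mul c).add (i4.const_mul (s / 2))
  rw [integral_finsetSum _ fun k _ => hint k, integral_add (i2.const_mul _) j₁,
    integral_add (hEi.const_mul c) (i4.const_mul _), integral_const_mul, integral_const_mul,
    integral_const_mul] at hI
  have h1 : N * (3 / 2 * V ^ 2) ≤ ∑ k, ∫ ω, (L k ω * ε ω) ^ 2 ∂P := by
    have := Finset.sum_le_sum fun k (_ : k ∈ Finset.univ) => hbig k
    simpa using this
  have h2 : V * N * ∫ ω, ε ω ^ 2 ∂P ≤ V * N * V := by gcongr
  have h3 : c * ∫ ω, Real.exp (β * Q ω) ∂P ≤ 32 * V * V' * q := by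
    calc c * ∫ ω, Real.exp (β * Q ω) ∂P ≤ c * (2 * Real.exp (β * (V * N))) := by gcongr
      _ = 2 / (β ^ 2 * s) := by
          rw [hc, div_mul_eq_mul_div, mul_left_comm, ← Real.exp_add]
          simp
      _ = 32 * V * V' * q := by
          rw [hβ, hs]
          field_simp
          norm_num
  have h4 : s / 2 * ∫ ω, ε ω ^ 4 ∂P ≤ 32 * V * V' * q := by
    calc s / 2 * ∫ ω, ε ω ^ 4 ∂P ≤ s / 2 * (64 * V' ^ 2) := by gcongr
      _ = 32 * V * V' * q := by
          rw [hs]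
          field_simp
          norm_num
  have h5 : q ^ 2 * V ^ 2 ≤ 128 * V * V' * q := by rw [hqq]; linarith
  have h6 : q ≤ 128 * V' / V := by
    rw [le_div_iff₀ hV]
    have : (q * V) * (q * V) ≤ (q * V) * (128 * V') := by linarith
    exact le_of_mul_le_mul_left this (by positivity)
  rw [← hqq]
  exact pow_le_pow_left₀ hq0.le h6 2

end Counting

section NodewiseNoise

variable {d p : ℕ} {P : Measure (Row d p)} {C₀ : ℝ}

/-- The penalty of the node-wise Lasso dominates the noise: with `ℓ = √(log p / n)`, all but
boundedly many coordinates have variance at most `(3/2) C₀²` and obey a Bernstein bound that beats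
the union over `p` coordinates; the remaining ones are controlled by Chebyshev's inequality. -/
lemma SubGaussianRow.nodewise_noise_tail [IsProbabilityMeasure P] (hP : SubGaussianRow P C₀)
    (hC₀ : 0 < C₀) (hZZ : (SigmaZZ P).PosDef) {A : ℝ} (j : Fin d)
    (hA : l1 (fun k => alphaStar P k j) ≤ A) {n : ℕ} (hn : 0 < n) {ℓ : ℝ} (hℓ : 0 < ℓ)
    (h1 : 32 * (1 + A ^ 2) * ℓ ≤ 3)
    (h2 : 12 * (8 * (1 + A ^ 2)) ^ 3 * (4 / 3) ^ 3 * ℓ ≤ 1 / 6) :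
    (Measure.pi fun _ : Fin n => P).real
        {U | ∃ k, n * (2 * C₀ * ℓ) ≤ |∑ i, (U i).2 k * rowResid (alphaStar P) j (U i)|}
      ≤ (128 * (1 + A ^ 2)) ^ 2 * (16 * (1 + A ^ 2) ^ 2 / (n * ℓ ^ 2))
        + p * (2 * Real.exp (-(7 / 6 * (n * ℓ ^ 2)))) := by
  classical
  set a := 1 + A ^ 2 with ha
  have ha1 : 1 ≤ a := by rw [ha]; nlinarith [sq_nonneg A]
  have ha0 : 0 < a := by linarith
  set ε := rowResid (alphaStar P) j with hε
  have hεG : IsSubG P ε (C₀ * a) := hP.isSubG_rowResid hC₀ hA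
  have hZG : ∀ k, IsSubG P (fun u : Row d p => u.2 k) (C₀ * a) := fun k =>
    (hP.isSubG_snd k).mono (by nlinarith)
  have hV : 0 < C₀ * a := by positivity
  have hn' : (0 : ℝ) < n := by exact_mod_cast hn
  set S := Finset.univ.filter fun k : Fin p =>
    3 / 2 * C₀ ^ 2 ≤ ∫ u, (u.2 k * ε u) ^ 2 ∂P with hS
  have hcard : (S.card : ℝ) ≤ (128 * a) ^ 2 := by
    have := card_le_of_large_variance (P := P) (κ := S) (L := fun k u => u.2 (k : Fin p))
      (ε := ε) hC₀ hV (fun k => by fun_prop) (fun b => ?_) hεG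
      (hP.integral_rowResid_sq_le hC₀ hZZ j) (fun k => ((hZG k).mul_sq hεG hV).1)
      (fun k => (Finset.mem_filter.1 k.2).2)
    · rw [Fintype.card_coe] at this
      refine this.trans (le_of_eq ?_)
      congr 1
      field_simp
    · -- extend the coefficients by zero outside `S`
      have h := hP.mgf_le 0 (fun k => if hk : k ∈ S then b ⟨k, hk⟩ else 0)
      have e1 : ∀ f : Fin p → ℝ → ℝ, (∀ k, f k 0 = 0) →
          ∑ k, f k (if hk : k ∈ S then b ⟨k, hk⟩ else 0) = ∑ k : S, f k (b k) := by
        intro f hf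
        rw [← Finset.sum_subset (Finset.subset_univ S), ← Finset.sum_coe_sort S]
        · exact Finset.sum_congr rfl fun k _ => by simp
        · intro k _ hk
          simp [hk, hf]
      have e2 : ∀ u : Row d p, u.1 ⬝ᵥ 0 + u.2 ⬝ᵥ (fun k => if hk : k ∈ S then b ⟨k, hk⟩ else 0)
          = ∑ k : S, b k * u.2 k := by
        intro u
        rw [dotProduct_zero, zero_add, dotProduct, e1 (fun k x => u.2 k * x) (by simp)]
        exact Finset.sum_congr rfl fun k _ => mul_comm _ _
      have e3 : sqNorm (0 : Fin d → ℝ) + sqNorm (fun k => if hk : k ∈ S then b ⟨k, hk⟩ else 0)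
          = ∑ k : S, b k ^ 2 := by
        rw [sqNorm_zero, zero_add, sqNorm, e1 (fun _ x => x ^ 2) (by simp)]
      simp_rw [e2, e3] at h
      exact h
  have h0 : ∀ k, ∫ u, u.2 k * ε u ∂P = 0 := fun k => hP.integral_snd_mul_rowResid hC₀ hZZ k j
  have hmem : ∀ k, MemLp (fun u : Row d p => u.2 k * ε u) 2 P := fun k => by
    have := ((hZG k).mul_sq hεG hV).1
    have hm : Measurable fun u : Row d p => u.2 k * ε u := (hZG k).meas.mul hεG.meas
    exact (memLp_two_iff_integrable_sq hm.aestronglyMeasurable).2 this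
  set B : ℝ := 12 * (8 * (C₀ * a)) ^ 3 with hB
  set y : ℝ := n * (2 * C₀ * ℓ) with hy
  have hy0 : 0 < y := by positivity
  have hexc : ∀ k, (Measure.pi fun _ : Fin n => P).real
      {U | y ≤ |∑ i, (U i).2 k * ε (U i)|} ≤ 16 * a ^ 2 / (n * ℓ ^ 2) := by
    intro k
    have := chebyshev_iid_sum (n := n) (hmem k) (h0 k) ((hZG k).mul_sq hεG hV).2 hy0
    simp only [mul_zero, sub_zero] at this
    refine this.trans (le_of_eq ?_)
    rw [hy]
    field_simp
    norm_num
  have hreg : ∀ k, k ∉ S → (Measure.pi fun _ : Fin n => P).real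
      {U | y ≤ |∑ i, (U i).2 k * ε (U i)|} ≤ 2 * Real.exp (-(7 / 6 * (n * ℓ ^ 2))) := by
    intro k hk
    have hv : ∫ u, (u.2 k * ε u) ^ 2 ∂P ≤ 3 / 2 * C₀ ^ 2 := by
      simp only [hS, Finset.mem_filter, Finset.mem_univ, true_and, not_le] at hk
      exact hk.le
    -- the minimizer of the Gaussian part of the exponent, at variance `(3/2) C₀²`
    set t := 4 / 3 * ℓ / C₀ with ht
    have ht0 : 0 ≤ t := by positivity
    have htb : |t| ≤ 1 / (8 * (C₀ * a)) := by
      rw [abs_of_nonneg ht0, ht, div_le_div_iff₀ hC₀ (by positivity)]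
      nlinarith
    have m₁ := (hZG k).mgf_mul_le hεG hV (h0 k) hv htb
    have m₂ := (hZG k).mgf_mul_le hεG hV (h0 k) hv (t := -t) (by rwa [abs_neg])
    rw [neg_sq, abs_neg] at m₂
    refine (chernoff_iid_sum (n := n) (y := y) ht0 m₁.1 m₂.1 m₁.2 m₂.2).trans ?_
    refine mul_le_mul_of_nonneg_left (Real.exp_le_exp.2 ?_) (by norm_num)
    rw [abs_of_nonneg ht0, hy, ht]
    have e1 : 3 / 2 * C₀ ^ 2 / 2 * (4 / 3 * ℓ / C₀) ^ 2 = 4 / 3 * ℓ ^ 2 := by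
      field_simp; norm_num
    have e2 : 12 * (8 * (C₀ * a)) ^ 3 * (4 / 3 * ℓ / C₀) ^ 3
        = 12 * (8 * a) ^ 3 * (4 / 3) ^ 3 * ℓ * ℓ ^ 2 := by
      field_simp
    have e3 : 4 / 3 * ℓ / C₀ * (n * (2 * C₀ * ℓ)) = n * (8 / 3 * ℓ ^ 2) := by
      field_simp; norm_num
    rw [e1, e2, e3]
    have h5 : 12 * (8 * a) ^ 3 * (4 / 3) ^ 3 * ℓ * ℓ ^ 2 ≤ 1 / 6 * ℓ ^ 2 := by gcongr
    have h6 : (n : ℝ) * (4 / 3 * ℓ ^ 2 + 12 * (8 * a) ^ 3 * (4 / 3) ^ 3 * ℓ * ℓ ^ 2)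
        ≤ n * (4 / 3 * ℓ ^ 2 + 1 / 6 * ℓ ^ 2) := by gcongr
    linarith
  have hset : {U : Fin n → Row d p | ∃ k, y ≤ |∑ i, (U i).2 k * ε (U i)|}
      = ⋃ k ∈ (Finset.univ : Finset (Fin p)), {U | y ≤ |∑ i, (U i).2 k * ε (U i)|} := by
    ext U; simp
  rw [hset]
  refine (measureReal_biUnion_finset_le _ _).trans ?_
  rw [← Finset.sum_add_sum_compl S]
  refine add_le_add ?_ ?_
  · refine (Finset.sum_le_card_nsmul _ _ _ fun k _ => hexc k).trans ?_
    rw [nsmul_eq_mul]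
    gcongr
  · refine (Finset.sum_le_card_nsmul _ _ _ fun k hk => hreg k (Finset.mem_compl.1 hk)).trans ?_
    rw [nsmul_eq_mul]
    have : (Sᶜ.card : ℝ) ≤ p := by
      have := Finset.card_le_univ Sᶜ
      rw [Fintype.card_fin] at this
      exact_mod_cast this
    gcongr

end NodewiseNoise

/-! ### Events of probability tending to one -/

section WHP

open scoped ENNReal

variable {Ω : ℕ → Type*} [∀ n, MeasurableSpace (Ω n)] {Pr : ∀ n, Measure (Ω n)}
  {E F G : ∀ n, Ω n → Prop}

lemma WHP.and (hE : WHP Pr E) (hF : WHP Pr F) : WHP Pr fun n ω => E n ω ∧ F n ω := by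
  have h := Tendsto.add (show Tendsto _ _ _ from hE) (show Tendsto _ _ _ from hF)
  rw [add_zero] at h
  refine tendsto_of_tendsto_of_tendsto_of_le_of_le tendsto_const_nhds h (fun _ => zero_le) ?_
  intro n
  refine (measure_mono fun ω hω => ?_).trans (measure_union_le _ _)
  exact not_and_or.1 hω

lemma WHP.mono (hE : WHP Pr E) (h : ∀ᶠ n in atTop, ∀ ω, E n ω → F n ω) : WHP Pr F := by
  refine tendsto_of_tendsto_of_tendsto_of_le_of_le' tendsto_const_nhds hE
    (Eventually.of_forall fun _ => zero_le) ?_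
  filter_upwards [h] with n hn
  exact measure_mono fun ω hω hEω => hω (hn ω hEω)

lemma whp_of_measure_le {r : ℕ → ℝ} (hr : Tendsto r atTop (𝓝 0))
    (h : ∀ᶠ n in atTop, Pr n {ω | ¬ E n ω} ≤ ENNReal.ofReal (r n)) : WHP Pr E := by
  have h0 := ENNReal.tendsto_ofReal hr
  rw [ENNReal.ofReal_zero] at h0
  exact tendsto_of_tendsto_of_tendsto_of_le_of_le' tendsto_const_nhds h0
    (Eventually.of_forall fun _ => zero_le) h

lemma WHP.forall_fintype {ι : Type*} [Finite ι] {E : ι → ∀ n, Ω n → Prop}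
    (h : ∀ i, WHP Pr (E i)) : WHP Pr fun n ω => ∀ i, E i n ω := by
  cases nonempty_fintype ι
  have hs := tendsto_finsetSum Finset.univ fun i _ => h i
  rw [Finset.sum_const_zero] at hs
  refine tendsto_of_tendsto_of_tendsto_of_le_of_le tendsto_const_nhds hs (fun _ => zero_le) ?_
  intro n
  refine (measure_mono fun ω hω => ?_).trans
    (measure_biUnion_finset_le Finset.univ fun i => {ω | ¬ E i n ω})
  simpa using hω

/-- An event has probability tending to one if, for each `ε > 0`, it contains up to probability `ε`
the intersection of an event of probability tending to one with one of probability at least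
`1 - ε`. -/
lemma whp_of_forall_eps (h : ∀ ε : ℝ, 0 < ε → ∃ F G : ∀ n, Ω n → Prop, WHP Pr F ∧
    (∀ᶠ n in atTop, Pr n {ω | ¬ G n ω} ≤ ENNReal.ofReal ε) ∧
    ∀ᶠ n in atTop, ∀ ω, F n ω → G n ω → E n ω) : WHP Pr E := by
  rw [WHP, ENNReal.tendsto_nhds_zero]
  intro e he
  obtain ⟨ε, hε0, hε⟩ : ∃ ε : ℝ, 0 < ε ∧ ENNReal.ofReal ε ≤ e / 2 := by
    rcases eq_or_ne e ⊤ with rfl | htop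
    · exact ⟨1, one_pos, by simp [ENNReal.top_div]⟩
    · refine ⟨(e / 2).toReal, ENNReal.toReal_pos (by simpa using he.ne') ?_, ?_⟩
      · exact ENNReal.div_ne_top htop (by norm_num)
      · rw [ENNReal.ofReal_toReal (ENNReal.div_ne_top htop (by norm_num))]
  obtain ⟨F, G, hF, hG, hFG⟩ := h ε hε0
  have hF' := (ENNReal.tendsto_nhds_zero.1 hF) (e / 2) (by simpa using he.ne')
  filter_upwards [hF', hG, hFG] with n h1 h2 h3
  calc Pr n {ω | ¬ E n ω} ≤ Pr n ({ω | ¬ F n ω} ∪ {ω | ¬ G n ω}) := by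
        refine measure_mono fun ω hω => ?_
        by_cases hF : F n ω
        · exact Or.inr fun hG => hω (h3 ω hF hG)
        · exact Or.inl hF
    _ ≤ _ := measure_union_le _ _
    _ ≤ e / 2 + e / 2 := add_le_add h1 (h2.trans hε)
    _ = e := ENNReal.add_halves e

/-- Bounded random variables that are close with probability tending to one have close means. -/
lemma tendsto_integral_sub_of_whp [∀ n, IsProbabilityMeasure (Pr n)] {f g : ∀ n, Ω n → ℂ}
    (hf : ∀ n, AEStronglyMeasurable (f n) (Pr n)) (hg : ∀ n, AEStronglyMeasurable (g n) (Pr n))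
    (hf1 : ∀ n ω, ‖f n ω‖ ≤ 1) (hg1 : ∀ n ω, ‖g n ω‖ ≤ 1)
    (h : ∀ ε : ℝ, 0 < ε → WHP Pr fun n ω => ‖f n ω - g n ω‖ ≤ ε) :
    Tendsto (fun n => ∫ ω, f n ω ∂(Pr n) - ∫ ω, g n ω ∂(Pr n)) atTop (𝓝 0) := by
  rw [Metric.tendsto_nhds]
  intro e he
  have hw := (ENNReal.tendsto_nhds_zero.1 (h (e / 4) (by positivity)))
    (ENNReal.ofReal (e / 8)) (by simpa using he)
  filter_upwards [hw] with n hn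
  have hfi : Integrable (f n) (Pr n) := (integrable_const (1 : ℝ)).mono' (hf n)
    (ae_of_all _ (hf1 n))
  have hgi : Integrable (g n) (Pr n) := (integrable_const (1 : ℝ)).mono' (hg n)
    (ae_of_all _ (hg1 n))
  set S := toMeasurable (Pr n) {ω | ¬ ‖f n ω - g n ω‖ ≤ e / 4} with hS
  have hSm : MeasurableSet S := measurableSet_toMeasurable _ _
  have hSle : (Pr n).real S ≤ e / 8 := by
    refine ENNReal.toReal_le_of_le_ofReal (by positivity) ?_
    rw [hS, measure_toMeasurable]
    exact hn
  have hpt : ∀ ω, ‖f n ω - g n ω‖ ≤ e / 4 + S.indicator (fun _ => (2 : ℝ)) ω := by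
    intro ω
    by_cases hω : ω ∈ S
    · rw [Set.indicator_of_mem hω]
      have := norm_sub_le (f n ω) (g n ω)
      linarith [hf1 n ω, hg1 n ω]
    · rw [Set.indicator_of_notMem hω, add_zero]
      by_contra hcon
      exact hω (subset_toMeasurable _ _ hcon)
  rw [dist_zero_right, ← integral_sub hfi hgi]
  have hb : Integrable (fun ω => e / 4 + S.indicator (fun _ => (2 : ℝ)) ω) (Pr n) :=
    (integrable_const _).add ((integrable_const _).indicator hSm)
  refine (norm_integral_le_of_norm_le hb (ae_of_all _ hpt)).trans_lt ?_
  rw [integral_add (integrable_const _) ((integrable_const _).indicator hSm),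
    integral_indicator_const _ hSm]
  simp only [integral_const, probReal_univ, smul_eq_mul, one_mul]
  linarith

end WHP

/-! ### Gaussian noise conditionally on the design -/

section Noise

variable {Ω 𝒰 : Type*} [MeasurableSpace Ω] [MeasurableSpace 𝒰] {Pr : Measure Ω}
  {ν : Measure 𝒰} {n : ℕ} {σ : NNReal} {U : Ω → 𝒰} {w : Ω → Fin n → ℝ}

lemma measurable_sqNorm {z : 𝒰 → Fin n → ℝ} (hz : Measurable z) :
    Measurable fun u => sqNorm (z u) := by
  unfold sqNorm
  fun_prop

/-- Gaussian tail of a linear form in the noise whose coefficients depend on the design. -/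
lemma noise_tail [IsProbabilityMeasure ν]
    (hlaw : HasLaw (fun ω => (U ω, w ω))
      (ν.prod (Measure.pi fun _ : Fin n => gaussianReal 0 (σ ^ 2))) Pr)
    (hσ : 0 < σ) {z : 𝒰 → Fin n → ℝ} (hz : Measurable z) {V y : ℝ} (hV : 0 < V) (hy : 0 ≤ y) :
    Pr {ω | sqNorm (z (U ω)) ≤ V ∧ y ≤ |w ω ⬝ᵥ z (U ω)|}
      ≤ ENNReal.ofReal (2 * Real.exp (-(y ^ 2 / (2 * σ ^ 2 * V)))) := by
  have hm1 := measurable_sqNorm hz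
  have hm2 : Measurable fun q : 𝒰 × (Fin n → ℝ) => |q.2 ⬝ᵥ z q.1| := by
    unfold dotProduct
    fun_prop
  have hset : MeasurableSet {q : 𝒰 × (Fin n → ℝ) | sqNorm (z q.1) ≤ V ∧ y ≤ |q.2 ⬝ᵥ z q.1|} :=
    (measurableSet_le (hm1.comp measurable_fst) measurable_const).inter
      (measurableSet_le measurable_const hm2)
  rw [hlaw.measure_eq (p := fun q : 𝒰 × (Fin n → ℝ) => sqNorm (z q.1) ≤ V ∧ y ≤ |q.2 ⬝ᵥ z q.1|)
    hset, Measure.prod_apply hset]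
  have hb : ∀ u, (Measure.pi fun _ : Fin n => gaussianReal 0 (σ ^ 2))
      (Prod.mk u ⁻¹' {q : 𝒰 × (Fin n → ℝ) | sqNorm (z q.1) ≤ V ∧ y ≤ |q.2 ⬝ᵥ z q.1|})
      ≤ ENNReal.ofReal (2 * Real.exp (-(y ^ 2 / (2 * σ ^ 2 * V)))) := by
    intro u
    by_cases hu : sqNorm (z u) ≤ V
    · have := gaussian_linear_tail σ (z u) hV hσ hu hy
      rw [← ENNReal.ofReal_toReal (measure_ne_top _ _)]
      refine ENNReal.ofReal_le_ofReal (le_trans (le_of_eq ?_) this)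
      change Measure.real _ _ = _
      congr 1
      ext x
      simp [hu]
    · have : Prod.mk u ⁻¹' {q : 𝒰 × (Fin n → ℝ) | sqNorm (z q.1) ≤ V ∧ y ≤ |q.2 ⬝ᵥ z q.1|}
          = ∅ := by
        ext x
        simp [hu]
      rw [this, measure_empty]
      exact zero_le
  refine (lintegral_mono hb).trans ?_
  rw [lintegral_const, measure_univ, mul_one]

/-- Characteristic function of a linear form in the noise, by conditioning on the design. -/
lemma noise_charFun [IsProbabilityMeasure ν]
    (hlaw : HasLaw (fun ω => (U ω, w ω))
      (ν.prod (Measure.pi fun _ : Fin n => gaussianReal 0 (σ ^ 2))) Pr)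
    {z : 𝒰 → Fin n → ℝ} (hz : Measurable z) :
    ∫ ω, Complex.exp ((w ω ⬝ᵥ z (U ω) : ℝ) * Complex.I) ∂Pr
      = ∫ ω, Complex.exp ((-(σ ^ 2 * sqNorm (z (U ω)) / 2) : ℝ)) ∂Pr := by
  have hm1 := measurable_sqNorm hz
  have hm2 : Measurable fun q : 𝒰 × (Fin n → ℝ) => q.2 ⬝ᵥ z q.1 := by
    unfold dotProduct
    fun_prop
  have hm3 : Measurable fun q : 𝒰 × (Fin n → ℝ) =>
      Complex.exp ((-(σ ^ 2 * sqNorm (z q.1) / 2) : ℝ)) :=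
    Complex.measurable_exp.comp (Complex.measurable_ofReal.comp
      ((((hm1.comp measurable_fst).const_mul _).div_const _).neg))
  have l1 := hlaw.integral_comp (f := fun q : 𝒰 × (Fin n → ℝ) =>
    Complex.exp ((q.2 ⬝ᵥ z q.1 : ℝ) * Complex.I)) (by fun_prop)
  have l2 := hlaw.integral_comp (f := fun q : 𝒰 × (Fin n → ℝ) =>
    Complex.exp ((-(σ ^ 2 * sqNorm (z q.1) / 2) : ℝ))) hm3.aestronglyMeasurable
  simp only [Function.comp_def] at l1 l2
  rw [l1, l2, integral_prod, integral_prod]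
  · refine integral_congr_ae (ae_of_all _ fun u => ?_)
    simp only [integral_const, probReal_univ, one_smul]
    have e : ∀ x : Fin n → ℝ, Complex.exp ((x ⬝ᵥ z u : ℝ) * Complex.I)
        = ∏ i, Complex.exp ((z u i : ℂ) * (x i : ℂ) * Complex.I) := by
      intro x
      rw [← Complex.exp_sum, ← Finset.sum_mul, dotProduct]
      congr 2
      push_cast
      exact Finset.sum_congr rfl fun i _ => mul_comm _ _
    simp_rw [e]
    rw [integral_fintype_prod_eq_prod
      (fun i (x : ℝ) => Complex.exp ((z u i : ℂ) * (x : ℂ) * Complex.I))]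
    have h : ∀ i, ∫ x : ℝ, Complex.exp ((z u i : ℂ) * (x : ℂ) * Complex.I)
        ∂(gaussianReal 0 (σ ^ 2)) = Complex.exp ((-(σ ^ 2 / 2 * z u i ^ 2) : ℝ)) := by
      intro i
      have := charFun_gaussianReal (μ := 0) (v := σ ^ 2) (z u i)
      rw [charFun_apply_real] at this
      rw [this]
      push_cast
      ring_nf
    simp_rw [h]
    rw [← Complex.exp_sum]
    congr 1
    simp only [sqNorm]
    push_cast
    rw [Finset.mul_sum, Finset.sum_div, ← Finset.sum_neg_distrib]
    exact Finset.sum_congr rfl fun i _ => by ring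
  · refine (integrable_const (1 : ℝ)).mono' hm3.aestronglyMeasurable (ae_of_all _ fun q => ?_)
    rw [Complex.norm_exp_ofReal]
    have : 0 ≤ (σ : ℝ) ^ 2 * sqNorm (z q.1) / 2 := by
      have := sqNorm_nonneg (z q.1)
      positivity
    exact Real.exp_le_one_iff.2 (by linarith)
  · refine (integrable_const (1 : ℝ)).mono' (by fun_prop) (ae_of_all _ fun q => ?_)
    rw [Complex.norm_exp_ofReal_mul_I]

end Noise

/-! ### The asymptotic regime -/

section Regime

variable {p s : ℕ → ℕ}

lemma tendsto_log_dim (hp : Tendsto p atTop atTop) :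
    Tendsto (fun n => Real.log (p n)) atTop atTop :=
  Real.tendsto_log_atTop.comp (tendsto_natCast_atTop_atTop.comp hp)

lemma tendsto_log_div_sqrt (hs : ∀ n, 1 ≤ s n)
    (hregime : Tendsto (fun n : ℕ => (s n : ℝ) * Real.log (p n) / √n) atTop (𝓝 0)) :
    Tendsto (fun n : ℕ => Real.log (p n) / √n) atTop (𝓝 0) := by
  refine squeeze_zero (fun n => by positivity) (fun n => ?_) hregime
  have h1 : (1 : ℝ) ≤ s n := by exact_mod_cast hs n
  have h2 : 0 ≤ Real.log (p n) := by positivity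
  gcongr
  nlinarith

lemma tendsto_rate (hs : ∀ n, 1 ≤ s n)
    (hregime : Tendsto (fun n : ℕ => (s n : ℝ) * Real.log (p n) / √n) atTop (𝓝 0)) :
    Tendsto (fun n : ℕ => √(Real.log (p n) / n)) atTop (𝓝 0) := by
  have h0 := (Real.continuous_sqrt.tendsto 0).comp (tendsto_log_div_sqrt hs hregime)
  rw [Real.sqrt_zero] at h0
  refine squeeze_zero' (Eventually.of_forall fun n => Real.sqrt_nonneg _) ?_ h0
  filter_upwards [eventually_ge_atTop 1] with n hn
  refine Real.sqrt_le_sqrt ?_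
  have h1 : (1 : ℝ) ≤ n := by exact_mod_cast hn
  have h2 : 0 ≤ Real.log (p n) := by positivity
  have h3 : √(n : ℝ) ≤ n := by
    rw [Real.sqrt_le_left (by linarith)]
    nlinarith
  have h4 : 0 < √(n : ℝ) := Real.sqrt_pos.2 (by linarith)
  exact div_le_div_of_nonneg_left h2 h4 h3

lemma natCast_mul_rate_sq {n p : ℕ} (hn : 0 < n) :
    n * √(Real.log p / n) ^ 2 = Real.log p := by
  have hn' : (0 : ℝ) < n := by exact_mod_cast hn
  rw [Real.sq_sqrt (by positivity)]
  field_simp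

end Regime

/-! ### The limit of the residual covariance -/

section Limit

lemma posSemidef_of_tendsto_omegaStar {d : ℕ} {p : ℕ → ℕ} {P : ∀ n, Measure (Row d (p n))}
    {Ωs : Matrix (Fin d) (Fin d) ℝ}
    (hres : ∀ n, (residCov (P n) (alphaStar (P n))).PosDef)
    (hΩ : Tendsto (fun n => OmegaStar (P n)) atTop (𝓝 Ωs)) : Ωs.PosSemidef := by
  have hpsd : ∀ n, (OmegaStar (P n)).PosSemidef := fun n => (hres n).inv.posSemidef
  refine Matrix.PosSemidef.of_dotProduct_mulVec_nonneg ?_ fun x => ?_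
  · have h1 : Tendsto (fun n => (OmegaStar (P n))ᴴ) atTop (𝓝 Ωsᴴ) :=
      ((continuous_id.matrix_conjTranspose).tendsto Ωs).comp hΩ
    refine tendsto_nhds_unique h1 ?_
    refine hΩ.congr fun n => ?_
    exact ((hpsd n).isHermitian).symm
  · have h1 : Continuous fun M : Matrix (Fin d) (Fin d) ℝ => star x ⬝ᵥ (M *ᵥ x) := by fun_prop
    exact ge_of_tendsto' ((h1.tendsto Ωs).comp hΩ) fun n => (hpsd n).dotProduct_mulVec_nonneg x

variable {d : ℕ} {p : ℕ → ℕ} {P : ∀ n, Measure (Row d (p n))} [∀ n, IsProbabilityMeasure (P n)]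
  {C₀ : ℝ} {Ωs : Matrix (Fin d) (Fin d) ℝ}

lemma SubGaussianRow.abs_residCov_le {d p : ℕ} {P : Measure (Row d p)} [IsProbabilityMeasure P]
    (hP : SubGaussianRow P C₀) (hC₀ : 0 < C₀) (hZZ : (SigmaZZ P).PosDef) (j k : Fin d) :
    |residCov P (alphaStar P) j k| ≤ C₀ := by
  have hj := hP.integral_rowResid_sq_le hC₀ hZZ j
  have hk := hP.integral_rowResid_sq_le hC₀ hZZ k
  have ij := hP.integrable_rowResid_mul hC₀ (alphaStar P) (alphaStar P) j j
  have ik := hP.integrable_rowResid_mul hC₀ (alphaStar P) (alphaStar P) k k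
  have ijk := hP.integrable_rowResid_mul hC₀ (alphaStar P) (alphaStar P) j k
  simp only [← sq] at ij ik
  change |∫ u, rowResid (alphaStar P) j u * rowResid (alphaStar P) k u ∂P| ≤ C₀
  refine (abs_integral_le_integral_abs).trans ?_
  refine (integral_mono ijk.abs ((ij.add ik).div_const 2) fun u => ?_).trans ?_
  · simp only [Pi.add_apply]
    rw [abs_mul]
    nlinarith [sq_nonneg (|rowResid (alphaStar P) j u| - |rowResid (alphaStar P) k u|),
      sq_abs (rowResid (alphaStar P) j u), sq_abs (rowResid (alphaStar P) k u)]
  · rw [integral_div]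
    simp only [Pi.add_apply]
    rw [integral_add ij ik]
    linarith

/-- The limit of `Ω*` is nonsingular, because sub-Gaussianity bounds the residual covariances
uniformly in `n`. -/
lemma det_pos_of_tendsto_omegaStar (hC₀ : 0 < C₀) (hsubG : ∀ n, SubGaussianRow (P n) C₀)
    (hZZ : ∀ n, (SigmaZZ (P n)).PosDef)
    (hres : ∀ n, (residCov (P n) (alphaStar (P n))).PosDef)
    (hΩ : Tendsto (fun n => OmegaStar (P n)) atTop (𝓝 Ωs)) : 0 < Ωs.det := by
  -- the determinants of the covariances are bounded above, hence those of the inverses below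
  set B : ℝ := (Fintype.card (Fin d)).factorial • C₀ ^ Fintype.card (Fin d) with hB
  have hB0 : 0 < B := by
    rw [hB, nsmul_eq_mul]
    have := Nat.factorial_pos (Fintype.card (Fin d))
    positivity
  have h1 : ∀ n, 1 / B ≤ (OmegaStar (P n)).det := by
    intro n
    have h2 := Matrix.det_le (A := residCov (P n) (alphaStar (P n))) (abv := AbsoluteValue.abs)
      (x := C₀) fun j k => (hsubG n).abs_residCov_le hC₀ (hZZ n) j k
    have h3 := (hres n).det_pos
    rw [OmegaStar, Matrix.det_nonsing_inv, Ring.inverse_eq_inv', ← one_div]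
    exact one_div_le_one_div_of_le h3 ((le_abs_self _).trans h2)
  have h2 : Tendsto (fun n => (OmegaStar (P n)).det) atTop (𝓝 Ωs.det) :=
    ((continuous_id.matrix_det).tendsto Ωs).comp hΩ
  exact (by positivity : 0 < 1 / B).trans_le (ge_of_tendsto' h2 h1)

lemma tendsto_residCov (hC₀ : 0 < C₀) (hsubG : ∀ n, SubGaussianRow (P n) C₀)
    (hZZ : ∀ n, (SigmaZZ (P n)).PosDef)
    (hres : ∀ n, (residCov (P n) (alphaStar (P n))).PosDef)
    (hΩ : Tendsto (fun n => OmegaStar (P n)) atTop (𝓝 Ωs)) :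
    Tendsto (fun n => residCov (P n) (alphaStar (P n))) atTop (𝓝 Ωs⁻¹) := by
  have hdet := det_pos_of_tendsto_omegaStar hC₀ hsubG hZZ hres hΩ
  have e : ∀ n, residCov (P n) (alphaStar (P n))
      = (OmegaStar (P n)).det⁻¹ • (OmegaStar (P n)).adjugate := by
    intro n
    rw [← Ring.inverse_eq_inv', ← Matrix.inv_def, OmegaStar,
      Matrix.nonsing_inv_nonsing_inv _ (hres n).det_pos.ne'.isUnit]
  simp_rw [e]
  rw [Matrix.inv_def, Ring.inverse_eq_inv']
  exact ((((continuous_id.matrix_det).tendsto Ωs).comp hΩ).inv₀ hdet.ne').smul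
    (((continuous_id.matrix_adjugate).tendsto Ωs).comp hΩ)

end Limit

/-! ### Laws of large numbers for the design -/

section Design

variable {d : ℕ} {C₀ D A : ℝ} {p s : ℕ → ℕ} {σ : NNReal}
  {P : ∀ n, Measure (Row d (p n))} [∀ n, IsProbabilityMeasure (P n)]
  {Ω : ℕ → Type*} [∀ n, MeasurableSpace (Ω n)] {Pr : ∀ n, Measure (Ω n)}
  {U : ∀ n, Ω n → Fin n → Row d (p n)} {w : ∀ n, Ω n → Fin n → ℝ}

lemma hasLaw_design {d p n : ℕ} {P : Measure (Row d p)} {Ω : Type*} [MeasurableSpace Ω]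
    {Pr : Measure Ω} {U : Ω → Fin n → Row d p} {w : Ω → Fin n → ℝ}
    (hlaw : HasLaw (fun ω => (U ω, w ω))
      ((Measure.pi fun _ : Fin n => P).prod
        (Measure.pi fun _ : Fin n => gaussianReal 0 (σ ^ 2))) Pr) :
    HasLaw U (Measure.pi fun _ : Fin n => P) Pr := by
  refine ⟨hlaw.aemeasurable.fst, ?_⟩
  have h : U = Prod.fst ∘ fun ω => (U ω, w ω) := rfl
  rw [h, ← AEMeasurable.map_map_of_aemeasurable measurable_fst.aemeasurable hlaw.aemeasurable,
    hlaw.map_eq, Measure.map_fst_prod]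
  simp

/-- With probability tending to one the node-wise penalty dominates the noise of the node-wise
regressions. -/
lemma whp_nodewise_noise (hC₀ : 0 < C₀) (hD : 1 ≤ D)
    (hlaw : ∀ n, HasLaw (fun ω => (U n ω, w n ω))
      ((Measure.pi fun _ : Fin n => P n).prod
        (Measure.pi fun _ : Fin n => gaussianReal 0 (σ ^ 2))) (Pr n))
    (hsubG : ∀ n, SubGaussianRow (P n) C₀) (hZZ : ∀ n, (SigmaZZ (P n)).PosDef)
    (hαs : ∀ n j, l1 (fun k => alphaStar (P n) k j) ≤ A)
    (hs : ∀ n, 1 ≤ s n) (hp : Tendsto p atTop atTop)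
    (hregime : Tendsto (fun n : ℕ => (s n : ℝ) * Real.log (p n) / √n) atTop (𝓝 0)) :
    WHP Pr fun n ω => ∀ j k, |1 / (n : ℝ) * (((fun i => designX (U n ω) i j)
      - designZ (U n ω) *ᵥ (fun k => alphaStar (P n) k j)) ᵥ* designZ (U n ω)) k|
        ≤ 2 * C₀ * D * √(Real.log (p n) / n) := by
  refine WHP.forall_fintype fun j => ?_
  have hlog := tendsto_log_dim hp
  have hrate := tendsto_rate hs hregime
  set a := 1 + A ^ 2 with ha
  have hr : Tendsto (fun n => (128 * a) ^ 2 * (16 * a ^ 2 / Real.log (p n))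
      + 2 * Real.exp (-(Real.log (p n) / 6))) atTop (𝓝 0) := by
    have h1 := (tendsto_const_nhds (x := 16 * a ^ 2)).div_atTop hlog
    have h2 := Real.tendsto_exp_neg_atTop_nhds_zero.comp
      (hlog.atTop_div_const (show (0 : ℝ) < 6 by norm_num))
    simpa using (h1.const_mul ((128 * a) ^ 2)).add (h2.const_mul 2)
  refine whp_of_measure_le hr ?_
  have e1 : ∀ᶠ n in atTop, 32 * a * √(Real.log (p n) / n) ≤ 3 := by
    have := hrate.const_mul (32 * a)
    rw [mul_zero] at this
    exact this.eventually_le_const (by norm_num)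
  have e2 : ∀ᶠ n in atTop, 12 * (8 * a) ^ 3 * (4 / 3) ^ 3 * √(Real.log (p n) / n) ≤ 1 / 6 := by
    have := hrate.const_mul (12 * (8 * a) ^ 3 * (4 / 3) ^ 3)
    rw [mul_zero] at this
    exact this.eventually_le_const (by norm_num)
  filter_upwards [e1, e2, hlog.eventually_gt_atTop 0, eventually_gt_atTop 0,
    hp.eventually_gt_atTop 0] with n h1 h2 h3 hn hpn
  have hn' : (0 : ℝ) < n := by exact_mod_cast hn
  have hp' : (0 : ℝ) < p n := by exact_mod_cast hpn
  set ℓ := √(Real.log (p n) / n) with hℓ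
  have hℓ0 : 0 < ℓ := Real.sqrt_pos.2 (by positivity)
  have htail := (hsubG n).nodewise_noise_tail hC₀ (hZZ n) j (hαs n j) hn hℓ0 h1 h2
  rw [hℓ, natCast_mul_rate_sq hn, ← hℓ] at htail
  have hexp : (p n : ℝ) * (2 * Real.exp (-(7 / 6 * Real.log (p n))))
      = 2 * Real.exp (-(Real.log (p n) / 6)) := by
    nth_rewrite 1 [← Real.exp_log hp']
    rw [mul_left_comm, ← Real.exp_add]
    ring_nf
  rw [hexp] at htail
  set ev : Set (Fin n → Row d (p n)) := {U | ∃ k, n * (2 * C₀ * ℓ) ≤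
    |∑ i, (U i).2 k * rowResid (alphaStar (P n)) j (U i)|} with hev
  have hmeas : MeasurableSet ev := by
    have : ev = ⋃ k, {U | n * (2 * C₀ * ℓ) ≤
        |∑ i, (U i).2 k * rowResid (alphaStar (P n)) j (U i)|} := by
      ext; simp [hev]
    rw [this]
    refine MeasurableSet.iUnion fun k => measurableSet_le measurable_const ?_
    simp only [rowResid_eq]
    fun_prop
  have hm := (hasLaw_design (hlaw n)).measure_eq (p := fun U => U ∈ ev) hmeas
  have hle : (Measure.pi fun _ : Fin n => P n) ev ≤ ENNReal.ofReal ((128 * a) ^ 2 *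
      (16 * a ^ 2 / Real.log (p n)) + 2 * Real.exp (-(Real.log (p n) / 6))) := by
    rw [← ENNReal.ofReal_toReal (measure_ne_top _ ev)]
    exact ENNReal.ofReal_le_ofReal htail
  refine le_trans (measure_mono fun ω hω => ?_) (hm.trans_le hle)
  -- outside the exceptional event every correlation is below the penalty level
  by_contra hcon
  refine hω fun k => ?_
  have hk : |∑ i, (U n ω i).2 k * rowResid (alphaStar (P n)) j (U n ω i)|
      < n * (2 * C₀ * ℓ) := by
    by_contra hk
    exact hcon ⟨k, not_lt.1 hk⟩
  have e : (((fun i => designX (U n ω) i j) - designZ (U n ω) *ᵥ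
      (fun k => alphaStar (P n) k j)) ᵥ* designZ (U n ω)) k
      = ∑ i, (U n ω i).2 k * rowResid (alphaStar (P n)) j (U n ω i) := by
    change ∑ i, rowResid (alphaStar (P n)) j (U n ω i) * (U n ω i).2 k = _
    exact Finset.sum_congr rfl fun i _ => mul_comm _ _
  rw [e, abs_mul, abs_of_pos (by positivity : 0 < 1 / (n : ℝ)), one_div_mul_eq_div,
    div_le_iff₀ hn']
  refine hk.le.trans ?_
  have : 2 * C₀ * ℓ ≤ 2 * C₀ * D * ℓ := by
    have : 0 < C₀ * ℓ := by positivity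
    nlinarith
  nlinarith

lemma whp_residual_gram (hC₀ : 0 < C₀)
    (hlaw : ∀ n, HasLaw (fun ω => (U n ω, w n ω))
      ((Measure.pi fun _ : Fin n => P n).prod
        (Measure.pi fun _ : Fin n => gaussianReal 0 (σ ^ 2))) (Pr n))
    (hsubG : ∀ n, SubGaussianRow (P n) C₀)
    (hαs : ∀ n j, l1 (fun k => alphaStar (P n) k j) ≤ A) {η : ℝ} (hη : 0 < η) :
    WHP Pr fun n ω => ∀ j k, |1 / (n : ℝ) *
      ((fun i => rowResid (alphaStar (P n)) j (U n ω i)) ⬝ᵥ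
        (fun i => rowResid (alphaStar (P n)) k (U n ω i)))
        - residCov (P n) (alphaStar (P n)) j k| ≤ η := by
  refine WHP.forall_fintype fun j => WHP.forall_fintype fun k => ?_
  set V := C₀ * (1 + A ^ 2) with hV
  have hV0 : 0 < V := by positivity
  have hr : Tendsto (fun n : ℕ => (64 * V ^ 2 / η ^ 2) / (n : ℝ)) atTop (𝓝 0) :=
    tendsto_const_nhds.div_atTop tendsto_natCast_atTop_atTop
  refine whp_of_measure_le hr ?_
  filter_upwards [eventually_gt_atTop 0] with n hn
  have hn' : (0 : ℝ) < n := by exact_mod_cast hn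
  have gj := (hsubG n).isSubG_rowResid hC₀ (hαs n j)
  have gk := (hsubG n).isSubG_rowResid hC₀ (hαs n k)
  have hsq := gj.mul_sq gk hV0
  have hmem : MemLp (fun u => rowResid (alphaStar (P n)) j u * rowResid (alphaStar (P n)) k u) 2
      (P n) := (memLp_two_iff_integrable_sq (gj.meas.mul gk.meas).aestronglyMeasurable).2 hsq.1
  have hch := chebyshev_iid_sum (n := n) hmem (m := residCov (P n) (alphaStar (P n)) j k) rfl
    hsq.2 (show 0 < n * η by positivity)
  have e0 : n * (64 * V ^ 2) / (n * η) ^ 2 = 64 * V ^ 2 / η ^ 2 / n := by field_simp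
  rw [e0] at hch
  set ev : Set (Fin n → Row d (p n)) := {U | n * η ≤ |∑ i, rowResid (alphaStar (P n)) j (U i) *
    rowResid (alphaStar (P n)) k (U i) - n * residCov (P n) (alphaStar (P n)) j k|} with hev
  have hmeas : MeasurableSet ev := by
    refine measurableSet_le measurable_const ?_
    simp only [rowResid_eq]
    fun_prop
  have hm := (hasLaw_design (hlaw n)).measure_eq (p := fun U => U ∈ ev) hmeas
  have hle : (Measure.pi fun _ : Fin n => P n) ev ≤ ENNReal.ofReal (64 * V ^ 2 / η ^ 2 / n) := by
    rw [← ENNReal.ofReal_toReal (measure_ne_top _ ev)]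
    exact ENNReal.ofReal_le_ofReal hch
  refine le_trans (measure_mono fun ω hω => ?_) (hm.trans_le hle)
  have hω' := not_le.1 hω
  have e : 1 / (n : ℝ) * ((fun i => rowResid (alphaStar (P n)) j (U n ω i)) ⬝ᵥ
        (fun i => rowResid (alphaStar (P n)) k (U n ω i)))
        - residCov (P n) (alphaStar (P n)) j k
      = (∑ i, rowResid (alphaStar (P n)) j (U n ω i) * rowResid (alphaStar (P n)) k (U n ω i)
        - n * residCov (P n) (alphaStar (P n)) j k) / n := by
    rw [dotProduct]
    field_simp
  rw [e, abs_div, abs_of_pos hn', lt_div_iff₀ hn', mul_comm] at hω'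
  exact hω'.le

end Design

/-! ### The residuals of the node-wise regressions -/

section ResidCol

/-- The `j`-th column of the residual matrix `X - Z a` of the design `U`. -/
noncomputable def residCol {n d p : ℕ} (U : Fin n → Row d p) (a : Matrix (Fin p) (Fin d) ℝ)
    (j : Fin d) : Fin n → ℝ :=
  fun i => resid (designX U) (designZ U) a i j

variable {n d p : ℕ} {U : Fin n → Row d p}

lemma residCol_eq (a : Matrix (Fin p) (Fin d) ℝ) (j : Fin d) :
    residCol U a j = (fun i => designX U i j) - designZ U *ᵥ (fun k => a k j) := rfl

lemma residCol_eq_rowResid (a : Matrix (Fin p) (Fin d) ℝ) (j : Fin d) :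
    residCol U a j = fun i => rowResid a j (U i) := rfl

lemma measurable_residCol {α : (Fin n → Row d p) → Matrix (Fin p) (Fin d) ℝ}
    (hα : ∀ k j, Measurable fun U => α U k j) (j : Fin d) :
    Measurable fun U => residCol U (α U) j := by
  refine measurable_pi_lambda _ fun i => ?_
  simp only [residCol_eq_rowResid, rowResid_eq]
  have := fun k => hα k j
  fun_prop

lemma abs_inv_mul_dotProduct_le {a b : Fin n → ℝ} {B r : ℝ} (hB : 0 ≤ B)
    (ha : 1 / (n : ℝ) * sqNorm a ≤ B) (hb : 1 / (n : ℝ) * sqNorm b ≤ r) :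
    |1 / (n : ℝ) * (a ⬝ᵥ b)| ≤ √(B * r) := by
  refine Real.abs_le_sqrt ?_
  have h0 : 0 ≤ 1 / (n : ℝ) * sqNorm b := mul_nonneg (by positivity) (sqNorm_nonneg b)
  calc (1 / (n : ℝ) * (a ⬝ᵥ b)) ^ 2 = (1 / (n : ℝ)) ^ 2 * (a ⬝ᵥ b) ^ 2 := by ring
    _ ≤ (1 / (n : ℝ)) ^ 2 * (sqNorm a * sqNorm b) := by
        gcongr
        exact dotProduct_sq_le a b
    _ = (1 / (n : ℝ) * sqNorm a) * (1 / (n : ℝ) * sqNorm b) := by ring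
    _ ≤ B * r := mul_le_mul ha hb h0 hB

lemma IsNodewiseLasso.abs_residCol_vecMul_le {a : Matrix (Fin p) (Fin d) ℝ} {lam : ℝ}
    (h : IsNodewiseLasso (designX U) (designZ U) lam a) (hlam : 0 ≤ lam) (j : Fin d) (k : Fin p) :
    |1 / (n : ℝ) * (residCol U a j ᵥ* designZ U) k| ≤ lam :=
  lasso_kkt hlam (h j) k

lemma IsNodewiseLasso.sqNorm_residCol_le {a : Matrix (Fin p) (Fin d) ℝ} {lam C : ℝ}
    (h : IsNodewiseLasso (designX U) (designZ U) lam a) (hlam : 0 ≤ lam)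
    (hcol : ColumnsNormalized (designX U) (designZ U) C) (j : Fin d) :
    1 / (n : ℝ) * sqNorm (residCol U a j) ≤ C :=
  (lasso_resid_sqNorm_le hlam (h j)).trans (hcol.1 j)

/-- When the node-wise penalty dominates the noise, the Gram matrices of the fitted residuals with
themselves and with the covariates of interest are close to the population residual covariance. -/
lemma IsNodewiseLasso.gram_close {a as : Matrix (Fin p) (Fin d) ℝ} {lam A C₀ η : ℝ}
    {R : Matrix (Fin d) (Fin d) ℝ} (h : IsNodewiseLasso (designX U) (designZ U) lam a)
    (hlam : 0 ≤ lam) (hη : 0 ≤ η) (hC₀ : 0 ≤ C₀)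
    (hnoise : ∀ j k, |1 / (n : ℝ) * (((fun i => designX U i j)
      - designZ U *ᵥ (fun k => as k j)) ᵥ* designZ U) k| ≤ lam)
    (hA : ∀ j, l1 (fun k => as k j) ≤ A) (hR : ∀ j k, |R j k| ≤ C₀)
    (hlln : ∀ j k, |1 / (n : ℝ) * (residCol U as j ⬝ᵥ residCol U as k) - R j k| ≤ η)
    (j k : Fin d) :
    |1 / (n : ℝ) * (residCol U a j ⬝ᵥ residCol U a k) - R j k|
        ≤ η + 2 * √((C₀ + η) * (2 * lam * A)) + 2 * lam * A ∧
    |1 / (n : ℝ) * (residCol U a j ⬝ᵥ fun i => designX U i k) - R j k|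
        ≤ η + √((C₀ + η) * (2 * lam * A)) + lam * A := by
  set q : Fin d → Fin n → ℝ := fun j => designZ U *ᵥ ((fun k => as k j) - fun k => a k j) with hq
  have hA0 : 0 ≤ A := (l1_nonneg _).trans (hA j)
  have e : ∀ j, residCol U a j = residCol U as j + q j := by
    intro j
    have e5 : q j = designZ U *ᵥ (fun k => as k j) - designZ U *ᵥ fun k => a k j :=
      mulVec_sub _ _ _
    rw [residCol_eq, residCol_eq, e5]
    abel
  have hqb : ∀ j, 1 / (n : ℝ) * sqNorm (q j) ≤ 2 * lam * A := fun j =>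
    (lasso_slow_rate hlam (h j) (hnoise j)).trans
      (mul_le_mul_of_nonneg_left (hA j) (by positivity))
  have hes : ∀ j, 1 / (n : ℝ) * sqNorm (residCol U as j) ≤ C₀ + η := by
    intro j
    rw [sqNorm_eq_dotProduct]
    linarith [(abs_le.1 (hlln j j)).2, (abs_le.1 (hR j j)).2]
  have hB : 0 ≤ C₀ + η := by linarith
  have hr : 0 ≤ 2 * lam * A := by positivity
  have h1 : ∀ j k, |1 / (n : ℝ) * (residCol U as j ⬝ᵥ q k)| ≤ √((C₀ + η) * (2 * lam * A)) :=
    fun j k => abs_inv_mul_dotProduct_le hB (hes j) (hqb k)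
  have h2 : |1 / (n : ℝ) * (q j ⬝ᵥ q k)| ≤ 2 * lam * A := by
    have := abs_inv_mul_dotProduct_le hr (hqb j) (hqb k)
    rwa [← sq, Real.sqrt_sq hr] at this
  have h1jk := abs_le.1 (h1 j k)
  have h1kj := abs_le.1 (h1 k j)
  have h2' := abs_le.1 h2
  have hl := abs_le.1 (hlln j k)
  rw [dotProduct_comm (residCol U as k) (q j)] at h1kj
  constructor
  · have e2 : 1 / (n : ℝ) * (residCol U a j ⬝ᵥ residCol U a k) - R j k
        = (1 / (n : ℝ) * (residCol U as j ⬝ᵥ residCol U as k) - R j k)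
          + 1 / (n : ℝ) * (residCol U as j ⬝ᵥ q k) + 1 / (n : ℝ) * (q j ⬝ᵥ residCol U as k)
          + 1 / (n : ℝ) * (q j ⬝ᵥ q k) := by
      rw [e j, e k, add_dotProduct, dotProduct_add, dotProduct_add]
      ring
    rw [e2]
    exact abs_le.2 ⟨by linarith, by linarith⟩
  · have h3 : |1 / (n : ℝ) * (residCol U a j ⬝ᵥ designZ U *ᵥ (fun l => as l k))| ≤ lam * A := by
      have := abs_dotProduct_le (a := fun l => 1 / (n : ℝ) * (residCol U a j ᵥ* designZ U) l)
        (v := fun l => as l k) (h.abs_residCol_vecMul_le hlam j)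
      rw [dotProduct_mulVec]
      refine le_trans (le_of_eq ?_) (this.trans (mul_le_mul_of_nonneg_left (hA k) hlam))
      congr 1
      simp [dotProduct, Finset.mul_sum, mul_assoc]
    have h3' := abs_le.1 h3
    have e2 : 1 / (n : ℝ) * (residCol U a j ⬝ᵥ fun i => designX U i k) - R j k
        = (1 / (n : ℝ) * (residCol U as j ⬝ᵥ residCol U as k) - R j k)
          + 1 / (n : ℝ) * (q j ⬝ᵥ residCol U as k)
          + 1 / (n : ℝ) * (residCol U a j ⬝ᵥ designZ U *ᵥ (fun l => as l k)) := by
      have e3 : (fun i => designX U i k)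
          = residCol U as k + designZ U *ᵥ (fun l => as l k) := by
        rw [residCol_eq]
        abel
      rw [e3, dotProduct_add]
      nth_rewrite 1 [e j]
      rw [add_dotProduct]
      ring
    rw [e2]
    exact abs_le.2 ⟨by linarith, by linarith⟩

end ResidCol

/-! ### The estimating equation -/

section Equation

variable {n d p : ℕ}

/-- The zero-bias equation, solved for the error `θs - θh` of the parameter of interest. -/
lemma IsCLasso.zero_bias {U : Fin n → Row d p} {Y w : Fin n → ℝ} {a : Matrix (Fin p) (Fin d) ℝ}
    {lam ρ : ℝ} {θh θs : Fin d → ℝ} {γh γs : Fin p → ℝ}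
    (h : IsCLasso (designX U) (designZ U) Y a lam ρ θh γh)
    (hY : Y = designX U *ᵥ θs + designZ U *ᵥ γs + w) (j : Fin d) :
    ((Matrix.of fun j k => 1 / (n : ℝ) * (residCol U a j ⬝ᵥ fun i => designX U i k))
      *ᵥ (θs - θh)) j
      = 1 / (n : ℝ) * (residCol U a j ᵥ* designZ U ⬝ᵥ (γh - γs))
        - 1 / (n : ℝ) * (w ⬝ᵥ residCol U a j) := by
  have h1 := congrFun h.1 j
  have e1 : Y - designX U *ᵥ θh - designZ U *ᵥ γh
      = designX U *ᵥ (θs - θh) - designZ U *ᵥ (γh - γs) + w := by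
    rw [hY, mulVec_sub, mulVec_sub]
    abel
  have e2 : ((resid (designX U) (designZ U) a)ᵀ *ᵥ (Y - designX U *ᵥ θh - designZ U *ᵥ γh)) j
      = residCol U a j ⬝ᵥ (Y - designX U *ᵥ θh - designZ U *ᵥ γh) := rfl
  rw [Pi.smul_apply, e2, e1, dotProduct_add, dotProduct_sub, dotProduct_mulVec,
    dotProduct_mulVec, smul_eq_mul, Pi.zero_apply] at h1
  have e3 : ((Matrix.of fun j k => 1 / (n : ℝ) * (residCol U a j ⬝ᵥ fun i => designX U i k))
      *ᵥ (θs - θh)) j = 1 / (n : ℝ) * (residCol U a j ᵥ* designX U ⬝ᵥ (θs - θh)) := by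
    change ∑ k, 1 / (n : ℝ) * (residCol U a j ⬝ᵥ fun i => designX U i k) * (θs - θh) k = _
    simp_rw [mul_assoc]
    rw [← Finset.mul_sum]
    rfl
  rw [e3, dotProduct_comm w]
  linarith

variable {Om T M : Matrix (Fin d) (Fin d) ℝ} {e m : ℝ}

lemma l1_mulVec_le {x : Fin d → ℝ} (hx : ∀ j, |x j| ≤ m) :
    l1 (Om *ᵥ x) ≤ (∑ j, ∑ k, |Om j k|) * m := by
  unfold l1
  rw [Finset.sum_mul]
  refine Finset.sum_le_sum fun j _ => ?_
  rw [Finset.sum_mul]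
  change |∑ k, Om j k * x k| ≤ _
  refine (Finset.abs_sum_le_sum_abs _ _).trans (Finset.sum_le_sum fun k _ => ?_)
  rw [abs_mul]
  exact mul_le_mul_of_nonneg_left (hx k) (abs_nonneg _)

lemma l1_sub_approx_inverse_le (hOm : Om * T = 1) (hM : ∀ j k, |M j k - T j k| ≤ e)
    (δ : Fin d → ℝ) :
    l1 (δ - Om *ᵥ (M *ᵥ δ)) ≤ (∑ j, ∑ k, |Om j k|) * (e * l1 δ) := by
  have h1 : δ - Om *ᵥ (M *ᵥ δ) = Om *ᵥ ((T - M) *ᵥ δ) := by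
    rw [sub_mulVec, mulVec_sub, mulVec_mulVec (M := Om) (N := T), hOm, one_mulVec]
  rw [h1]
  refine l1_mulVec_le fun j => ?_
  refine abs_dotProduct_le fun k => ?_
  rw [Matrix.sub_apply, abs_sub_comm]
  exact hM j k

lemma l1_le_of_approx_inverse (hOm : Om * T = 1) (hM : ∀ j k, |M j k - T j k| ≤ e)
    {δ : Fin d → ℝ} (hδ : ∀ j, |(M *ᵥ δ) j| ≤ m) (he : (∑ j, ∑ k, |Om j k|) * e ≤ 1 / 2) :
    l1 δ ≤ 2 * (∑ j, ∑ k, |Om j k|) * m := by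
  have h1 := l1_sub_approx_inverse_le hOm hM δ
  have h2 := l1_mulVec_le (Om := Om) hδ
  have h3 := l1_add_le (δ - Om *ᵥ (M *ᵥ δ)) (Om *ᵥ (M *ᵥ δ))
  rw [sub_add_cancel] at h3
  have h4 : (∑ j, ∑ k, |Om j k|) * (e * l1 δ) ≤ 1 / 2 * l1 δ := by
    rw [← mul_assoc]
    exact mul_le_mul_of_nonneg_right he (l1_nonneg δ)
  linarith

end Equation

/-! ### Stochastic order of the noise terms -/

section NoiseBounds

variable {d : ℕ} {C : ℝ} {p : ℕ → ℕ} {σ : NNReal}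
  {P : ∀ n, Measure (Row d (p n))} [∀ n, IsProbabilityMeasure (P n)]
  {Ω : ℕ → Type*} [∀ n, MeasurableSpace (Ω n)] {Pr : ∀ n, Measure (Ω n)}
  {U : ∀ n, Ω n → Fin n → Row d (p n)} {w : ∀ n, Ω n → Fin n → ℝ}

/-- Maximal correlation of the noise with the nuisance columns.  The slack `κ / √n` makes
the Chernoff bound beat the union over the `p` columns at the critical level. -/
lemma whp_noise_correlation (hσ : 0 < σ) (hC : 0 < C) {κ : ℝ} (hκ : 0 < κ)
    (hlaw : ∀ n, HasLaw (fun ω => (U n ω, w n ω))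
      ((Measure.pi fun _ : Fin n => P n).prod
        (Measure.pi fun _ : Fin n => gaussianReal 0 (σ ^ 2))) (Pr n))
    (hp : Tendsto p atTop atTop)
    (hcol : WHP Pr fun n ω => ColumnsNormalized (designX (U n ω)) (designZ (U n ω)) C) :
    WHP Pr fun n ω => ∀ k, |1 / (n : ℝ) * (w n ω ᵥ* designZ (U n ω)) k|
      ≤ σ * √(2 * C * Real.log (p n) / n) + κ / √n := by
  have hσ' : (0 : ℝ) < σ := hσ
  have hlog := tendsto_log_dim hp
  have hmain : WHP Pr fun n ω => ColumnsNormalized (designX (U n ω)) (designZ (U n ω)) C →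
      ∀ k, |1 / (n : ℝ) * (w n ω ᵥ* designZ (U n ω)) k|
        ≤ σ * √(2 * C * Real.log (p n) / n) + κ / √n := by
    have hr : Tendsto (fun n => 2 * Real.exp (-(κ / (σ * C) * √(2 * C * Real.log (p n)))))
        atTop (𝓝 0) := by
      have h1 : Tendsto (fun n => √(2 * C * Real.log (p n))) atTop atTop :=
        Real.tendsto_sqrt_atTop.comp (hlog.const_mul_atTop (by positivity))
      have h2 := Real.tendsto_exp_neg_atTop_nhds_zero.comp
        (h1.const_mul_atTop (show 0 < κ / (σ * C) by positivity))
      simpa using h2.const_mul 2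
    refine whp_of_measure_le hr ?_
    filter_upwards [eventually_gt_atTop 0, hp.eventually_gt_atTop 0] with n hn hpn
    have hn' : (0 : ℝ) < n := by exact_mod_cast hn
    have hp' : (0 : ℝ) < p n := by exact_mod_cast hpn
    have hlog0 : 0 ≤ Real.log (p n) := by positivity
    set x := √(2 * C * Real.log (p n) / n) with hx
    set y := n * (σ * x + κ / √n) with hy
    have hx0 : 0 ≤ x := Real.sqrt_nonneg _
    have hy0 : 0 ≤ y := by positivity
    have hzm : ∀ k, Measurable fun (V : Fin n → Row d (p n)) (i : Fin n) => designZ V i k := by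
      intro k
      refine measurable_pi_lambda _ fun i => ?_
      change Measurable fun V : Fin n → Row d (p n) => (V i).2 k
      fun_prop
    have htail := fun k => noise_tail (hlaw n) hσ (hzm k) (V := n * C) (y := y) (by positivity) hy0
    have hexp : Real.exp (-(y ^ 2 / (2 * σ ^ 2 * (n * C))))
        ≤ (p n : ℝ)⁻¹ * Real.exp (-(κ / (σ * C) * √(2 * C * Real.log (p n)))) := by
      rw [← Real.exp_log (inv_pos.2 hp'), ← Real.exp_add, Real.log_inv]
      refine Real.exp_le_exp.2 ?_
      have e1 : n * x ^ 2 = 2 * C * Real.log (p n) := by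
        rw [hx, Real.sq_sqrt (by positivity)]
        field_simp
      have e2 : √(2 * C * Real.log (p n)) = √n * x := by
        rw [hx, ← Real.sqrt_mul hn'.le]
        congr 1
        field_simp
      have hsn : √(n : ℝ) ^ 2 = n := Real.sq_sqrt hn'.le
      have hsn0 : 0 < √(n : ℝ) := Real.sqrt_pos.2 hn'
      have e3 : ∀ q N : ℝ, 0 < q → q ^ 2 = N →
          (N * (σ * x + κ / q)) ^ 2 / (2 * σ ^ 2 * (N * C))
          = (N * x ^ 2) / (2 * C) + κ / (σ * C) * (q * x) + κ ^ 2 / (2 * σ ^ 2 * C) := by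
        rintro q N hq rfl
        field_simp
        ring
      rw [hy, e3 _ _ hsn0 hsn, e1, e2]
      have e4 : 2 * C * Real.log (p n) / (2 * C) = Real.log (p n) := by field_simp
      rw [e4]
      have : 0 ≤ κ ^ 2 / (2 * σ ^ 2 * C) := by positivity
      linarith
    refine le_trans (measure_mono fun ω hω => ?_ :
      _ ≤ Pr n (⋃ k ∈ (Finset.univ : Finset (Fin (p n))),
        {ω | sqNorm (fun i => designZ (U n ω) i k) ≤ n * C
          ∧ y ≤ |w n ω ⬝ᵥ fun i => designZ (U n ω) i k|})) ?_
    · obtain ⟨hc, hk⟩ := Classical.not_imp.1 hω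
      obtain ⟨k, hk⟩ := not_forall.1 hk
      refine Set.mem_biUnion (Finset.mem_coe.2 (Finset.mem_univ k)) ⟨?_, ?_⟩
      · have := hc.2 k
        rwa [one_div_mul_eq_div, div_le_iff₀ hn', mul_comm] at this
      · have h1 := (not_le.1 hk).le
        rw [abs_mul, abs_of_pos (by positivity : 0 < 1 / (n : ℝ)), one_div_mul_eq_div,
          le_div_iff₀ hn', mul_comm] at h1
        exact h1
    · refine (measure_biUnion_finset_le _ _).trans ((Finset.sum_le_sum fun k _ => htail k).trans ?_)
      rw [Finset.sum_const, Finset.card_univ, Fintype.card_fin, nsmul_eq_mul,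
        ← ENNReal.ofReal_natCast, ← ENNReal.ofReal_mul hp'.le]
      refine ENNReal.ofReal_le_ofReal ?_
      calc (p n : ℝ) * (2 * Real.exp (-(y ^ 2 / (2 * σ ^ 2 * (n * C)))))
          ≤ (p n : ℝ) * (2 * ((p n : ℝ)⁻¹ *
            Real.exp (-(κ / (σ * C) * √(2 * C * Real.log (p n)))))) := by gcongr
        _ = _ := by field_simp
  exact (hmain.and hcol).mono (Eventually.of_forall fun n ω h => h.1 h.2)

/-- Gaussian tail of the normalized score `n^{-1/2} (X - Z α)ᵀ w`. -/
lemma score_tail {d p n : ℕ} {P : Measure (Row d p)} [IsProbabilityMeasure P] {Ω : Type*}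
    [MeasurableSpace Ω] {Pr : Measure Ω} {U : Ω → Fin n → Row d p} {w : Ω → Fin n → ℝ}
    (hσ : 0 < σ) (hC : 0 < C) (hn : 0 < n)
    (hlaw : HasLaw (fun ω => (U ω, w ω))
      ((Measure.pi fun _ : Fin n => P).prod
        (Measure.pi fun _ : Fin n => gaussianReal 0 (σ ^ 2))) Pr)
    {α : (Fin n → Row d p) → Matrix (Fin p) (Fin d) ℝ}
    (hα : ∀ k j, Measurable fun U => α U k j) {B : ℝ} (hB : 0 ≤ B) :
    Pr {ω | ¬ ((∀ j, 1 / (n : ℝ) * sqNorm (residCol (U ω) (α (U ω)) j) ≤ C) →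
        ∀ j, |1 / √n * (w ω ⬝ᵥ residCol (U ω) (α (U ω)) j)| ≤ B)}
      ≤ ENNReal.ofReal (d * (2 * Real.exp (-(B ^ 2 / (2 * σ ^ 2 * C))))) := by
  have hn' : (0 : ℝ) < n := by exact_mod_cast hn
  have hsn0 : 0 < √(n : ℝ) := Real.sqrt_pos.2 hn'
  have htail := fun j => noise_tail hlaw hσ (measurable_residCol hα j) (V := n * C) (y := √n * B)
    (by positivity) (by positivity)
  refine le_trans (measure_mono fun ω hω => ?_ :
    _ ≤ Pr (⋃ j ∈ (Finset.univ : Finset (Fin d)),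
      {ω | sqNorm (residCol (U ω) (α (U ω)) j) ≤ n * C
        ∧ √n * B ≤ |w ω ⬝ᵥ residCol (U ω) (α (U ω)) j|})) ?_
  · obtain ⟨hc, hj⟩ := Classical.not_imp.1 hω
    obtain ⟨j, hj⟩ := not_forall.1 hj
    refine Set.mem_biUnion (Finset.mem_coe.2 (Finset.mem_univ j)) ⟨?_, ?_⟩
    · have := hc j
      rwa [one_div_mul_eq_div, div_le_iff₀ hn', mul_comm] at this
    · have h1 := (not_le.1 hj).le
      rw [abs_mul, abs_of_pos (by positivity : 0 < 1 / √(n : ℝ)), one_div_mul_eq_div,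
        le_div_iff₀ hsn0, mul_comm] at h1
      exact h1
  · refine (measure_biUnion_finset_le _ _).trans ((Finset.sum_le_sum fun k _ => htail k).trans ?_)
    rw [Finset.sum_const, Finset.card_univ, Fintype.card_fin, nsmul_eq_mul,
      ← ENNReal.ofReal_natCast, ← ENNReal.ofReal_mul (Nat.cast_nonneg d)]
    refine ENNReal.ofReal_le_ofReal (le_of_eq ?_)
    have e : (√(n : ℝ) * B) ^ 2 / (2 * σ ^ 2 * (n * C)) = B ^ 2 / (2 * σ ^ 2 * C) := by
      rw [mul_pow, Real.sq_sqrt hn'.le]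
      field_simp
    rw [e]

end NoiseBounds

/-! ### Consistency of the Gram matrices -/

section Gram

variable {d : ℕ} {C₀ D A : ℝ} {p s : ℕ → ℕ} {σ : NNReal}
  {P : ∀ n, Measure (Row d (p n))} [∀ n, IsProbabilityMeasure (P n)]
  {Ω : ℕ → Type*} [∀ n, MeasurableSpace (Ω n)] {Pr : ∀ n, Measure (Ω n)}
  {U : ∀ n, Ω n → Fin n → Row d (p n)} {w : ∀ n, Ω n → Fin n → ℝ}
  {α : ∀ n, (Fin n → Row d (p n)) → Matrix (Fin (p n)) (Fin d) ℝ}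
  {Ωs : Matrix (Fin d) (Fin d) ℝ}

/-- The Gram matrices of the node-wise residuals, with themselves and with the covariates of
interest, are consistent for `Ω*⁻¹`. -/
lemma whp_gram (hC₀ : 0 < C₀) (hD : 1 ≤ D)
    (hlaw : ∀ n, HasLaw (fun ω => (U n ω, w n ω))
      ((Measure.pi fun _ : Fin n => P n).prod
        (Measure.pi fun _ : Fin n => gaussianReal 0 (σ ^ 2))) (Pr n))
    (hsubG : ∀ n, SubGaussianRow (P n) C₀) (hZZ : ∀ n, (SigmaZZ (P n)).PosDef)
    (hres : ∀ n, (residCov (P n) (alphaStar (P n))).PosDef)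
    (hαs : ∀ n j, l1 (fun k => alphaStar (P n) k j) ≤ A)
    (hΩ : Tendsto (fun n => OmegaStar (P n)) atTop (𝓝 Ωs))
    (hα : WHP Pr fun n ω => IsNodewiseLasso (designX (U n ω)) (designZ (U n ω))
      (2 * C₀ * D * √(Real.log (p n) / n)) (α n (U n ω)))
    (hs : ∀ n, 1 ≤ s n) (hp : Tendsto p atTop atTop)
    (hregime : Tendsto (fun n : ℕ => (s n : ℝ) * Real.log (p n) / √n) atTop (𝓝 0))
    {η : ℝ} (hη : 0 < η) :
    WHP Pr fun n ω => ∀ j k,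
      |1 / (n : ℝ) * (residCol (U n ω) (α n (U n ω)) j ⬝ᵥ residCol (U n ω) (α n (U n ω)) k)
        - Ωs⁻¹ j k| ≤ η ∧
      |1 / (n : ℝ) * (residCol (U n ω) (α n (U n ω)) j ⬝ᵥ fun i => designX (U n ω) i k)
        - Ωs⁻¹ j k| ≤ η := by
  have hnoise := whp_nodewise_noise hC₀ hD hlaw hsubG hZZ hαs hs hp hregime
  have hlln := whp_residual_gram hC₀ hlaw hsubG hαs (show 0 < η / 4 by positivity)
  have hR := tendsto_residCov hC₀ hsubG hZZ hres hΩ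
  have hRe : ∀ᶠ n in atTop, ∀ j k,
      |residCov (P n) (alphaStar (P n)) j k - Ωs⁻¹ j k| ≤ η / 4 := by
    rw [eventually_all]
    intro j
    rw [eventually_all]
    intro k
    have h1 := (tendsto_pi_nhds.1 ((tendsto_pi_nhds.1 hR) j)) k
    filter_upwards [(Metric.tendsto_nhds.1 h1) (η / 4) (by positivity)] with n hn
    rw [Real.dist_eq] at hn
    exact hn.le
  have hlam : Tendsto (fun n : ℕ => 2 * C₀ * D * √(Real.log (p n) / n)) atTop (𝓝 0) := by
    simpa using (tendsto_rate hs hregime).const_mul (2 * C₀ * D)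
  -- the bounds of `IsNodewiseLasso.gram_close` are continuous in the penalty level
  have hb1 : ∀ᶠ n in atTop, η / 4 + 2 * √((C₀ + η / 4) *
      (2 * (2 * C₀ * D * √(Real.log (p n) / n)) * A))
      + 2 * (2 * C₀ * D * √(Real.log (p n) / n)) * A ≤ η / 2 := by
    have hc : Continuous fun x : ℝ => η / 4 + 2 * √((C₀ + η / 4) * (2 * x * A)) + 2 * x * A := by
      fun_prop
    have := (hc.tendsto 0).comp hlam
    refine (this.eventually_lt_const (u := η / 2) ?_).mono fun n hn => hn.le
    simp
    linarith
  have hb2 : ∀ᶠ n in atTop, η / 4 + √((C₀ + η / 4) *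
      (2 * (2 * C₀ * D * √(Real.log (p n) / n)) * A))
      + (2 * C₀ * D * √(Real.log (p n) / n)) * A ≤ η / 2 := by
    have hc : Continuous fun x : ℝ => η / 4 + √((C₀ + η / 4) * (2 * x * A)) + x * A := by
      fun_prop
    have := (hc.tendsto 0).comp hlam
    refine (this.eventually_lt_const (u := η / 2) ?_).mono fun n hn => hn.le
    simp
    linarith
  refine ((hα.and hnoise).and hlln).mono ?_
  filter_upwards [hRe, hb1, hb2] with n hRn h1 h2 ω ⟨⟨hαn, hno⟩, hl⟩ j k
  have hl0 : 0 ≤ 2 * C₀ * D * √(Real.log (p n) / n) := by positivity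
  have hg := hαn.gram_close hl0 (by positivity : 0 ≤ η / 4) hC₀.le hno (hαs n)
    (fun j k => (hsubG n).abs_residCov_le hC₀ (hZZ n) j k) hl j k
  have hR' := hRn j k
  have tri : ∀ x : ℝ, |x - residCov (P n) (alphaStar (P n)) j k| ≤ η / 2 →
      |x - Ωs⁻¹ j k| ≤ η := by
    intro x hx
    have := abs_sub_le x (residCov (P n) (alphaStar (P n)) j k) (Ωs⁻¹ j k)
    linarith
  exact ⟨tri _ (hg.1.trans h1), tri _ (hg.2.trans h2)⟩

end Gram

/-! ### The `ℓ₁` rate of the nuisance estimator -/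

section Rate

/-- Arithmetic of the contamination term: with `q = √n` and `L = √(log p)`, an error
`δ = O(c (L / q) l + √L / q)` of the plugged-in estimate satisfies `C δ² ≤ (κ / q) l` unless `l` is
already of the order of the target rate `L / q`. -/
lemma contamination_le {C κΩ c κ ρ l q L δ : ℝ} (hC : 0 ≤ C)
    (hκ : 0 < κ) (hq : 0 < q) (hL : 0 ≤ L) (hδ0 : 0 ≤ δ) (hl0 : 0 ≤ l) (hl : l ≤ 2 * ρ)
    (hδ : δ ≤ 2 * κΩ * (c * (L / q) * l + √L / q))
    (hsmall : 16 * C * κΩ ^ 2 * c ^ 2 * ρ * (L ^ 2 / q) ≤ κ / 2)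
    (hlarge : 16 * C * κΩ ^ 2 / κ * (L / q) ≤ l) :
    C * δ ^ 2 ≤ κ / q * l := by
  have hLs := Real.sq_sqrt hL
  have h1 : δ ^ 2 ≤ 8 * κΩ ^ 2 * (c ^ 2 * (L / q) ^ 2 * l ^ 2 + L / q ^ 2) := by
    have h2 : δ ^ 2 ≤ (2 * κΩ * (c * (L / q) * l + √L / q)) ^ 2 := pow_le_pow_left₀ hδ0 hδ 2
    have h3 : (c * (L / q) * l + √L / q) ^ 2 ≤ 2 * (c ^ 2 * (L / q) ^ 2 * l ^ 2 + L / q ^ 2) := by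
      have e : L / q ^ 2 = (√L / q) ^ 2 := by rw [div_pow, hLs]
      rw [e]
      nlinarith [sq_nonneg (c * (L / q) * l - √L / q)]
    calc δ ^ 2 ≤ 4 * κΩ ^ 2 * (c * (L / q) * l + √L / q) ^ 2 := by linarith
      _ ≤ 4 * κΩ ^ 2 * (2 * (c ^ 2 * (L / q) ^ 2 * l ^ 2 + L / q ^ 2)) := by gcongr
      _ = _ := by ring
  have h4 : 8 * C * κΩ ^ 2 * (c ^ 2 * (L / q) ^ 2 * l ^ 2) ≤ κ / 2 / q * l := by
    calc 8 * C * κΩ ^ 2 * (c ^ 2 * (L / q) ^ 2 * l ^ 2)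
        = 8 * C * κΩ ^ 2 * (c ^ 2 * (L / q) ^ 2) * l * l := by ring
      _ ≤ 8 * C * κΩ ^ 2 * (c ^ 2 * (L / q) ^ 2) * l * (2 * ρ) := by gcongr
      _ = 16 * C * κΩ ^ 2 * c ^ 2 * ρ * (L ^ 2 / q) * (l / q) := by field_simp; ring
      _ ≤ κ / 2 * (l / q) := by gcongr
      _ = _ := by ring
  have h5 : 8 * C * κΩ ^ 2 * (L / q ^ 2) ≤ κ / 2 / q * l := by
    calc 8 * C * κΩ ^ 2 * (L / q ^ 2) = κ / 2 / q * (16 * C * κΩ ^ 2 / κ * (L / q)) := by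
          field_simp; ring
      _ ≤ _ := by gcongr
  calc C * δ ^ 2 ≤ C * (8 * κΩ ^ 2 * (c ^ 2 * (L / q) ^ 2 * l ^ 2 + L / q ^ 2)) := by gcongr
    _ = 8 * C * κΩ ^ 2 * (c ^ 2 * (L / q) ^ 2 * l ^ 2) + 8 * C * κΩ ^ 2 * (L / q ^ 2) := by ring
    _ ≤ κ / 2 / q * l + κ / 2 / q * l := add_le_add h4 h5
    _ = _ := by ring

variable {n d p : ℕ} {U : Fin n → Row d p} {Y w : Fin n → ℝ} {a : Matrix (Fin p) (Fin d) ℝ}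
  {lam ρ c e : ℝ} {θh θs : Fin d → ℝ} {γh γs : Fin p → ℝ} {Ωs : Matrix (Fin d) (Fin d) ℝ}

lemma abs_inv_mul_vecMul_dotProduct_le
    (hτ : ∀ j k, |1 / (n : ℝ) * (residCol U a j ᵥ* designZ U) k| ≤ c) (v : Fin p → ℝ) (j : Fin d) :
    |1 / (n : ℝ) * (residCol U a j ᵥ* designZ U ⬝ᵥ v)| ≤ c * l1 v := by
  refine le_trans (le_of_eq ?_) (abs_dotProduct_le
    (a := fun l => 1 / (n : ℝ) * (residCol U a j ᵥ* designZ U) l) (v := v) (hτ j))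
  congr 1
  simp [dotProduct, Finset.mul_sum, mul_assoc]

/-- The zero-bias equation bounds the error of the parameter of interest by that of the nuisance
parameter and the score. -/
lemma IsCLasso.l1_error_le (h : IsCLasso (designX U) (designZ U) Y a lam ρ θh γh)
    (hn : 0 < n) (hY : Y = designX U *ᵥ θs + designZ U *ᵥ γs + w) (hOm : Ωs * Ωs⁻¹ = 1)
    (hτ : ∀ j k, |1 / (n : ℝ) * (residCol U a j ᵥ* designZ U) k| ≤ c)
    (hM : ∀ j k, |1 / (n : ℝ) * (residCol U a j ⬝ᵥ fun i => designX U i k) - Ωs⁻¹ j k| ≤ e)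
    (he : (∑ j, ∑ k, |Ωs j k|) * e ≤ 1 / 2) {b : ℝ}
    (hb : ∀ j, |1 / √n * (w ⬝ᵥ residCol U a j)| ≤ b) :
    l1 (θs - θh) ≤ 2 * (∑ j, ∑ k, |Ωs j k|) * (c * l1 (γh - γs) + b / √n) := by
  have hn' : (0 : ℝ) < n := by exact_mod_cast hn
  have hsn0 : 0 < √(n : ℝ) := Real.sqrt_pos.2 hn'
  refine l1_le_of_approx_inverse (M := Matrix.of fun j k => 1 / (n : ℝ) *
    (residCol U a j ⬝ᵥ fun i => designX U i k)) hOm hM (fun j => ?_) he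
  rw [h.zero_bias hY j]
  have h1 := abs_inv_mul_vecMul_dotProduct_le hτ (γh - γs) j
  have h2 : |1 / (n : ℝ) * (w ⬝ᵥ residCol U a j)| ≤ b / √n := by
    have e1 : 1 / (n : ℝ) * (w ⬝ᵥ residCol U a j)
        = 1 / √n * (w ⬝ᵥ residCol U a j) / √n := by
      field_simp
      rw [Real.sq_sqrt hn'.le]
      ring
    rw [e1, abs_div, abs_of_pos hsn0]
    exact div_le_div_of_nonneg_right (hb j) hsn0.le
  have h3 := abs_sub (1 / (n : ℝ) * (residCol U a j ᵥ* designZ U ⬝ᵥ (γh - γs)))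
    (1 / (n : ℝ) * (w ⬝ᵥ residCol U a j))
  linarith

/-- Linear expansion of the estimator of the parameter of interest around the score. -/
lemma IsCLasso.expansion_error_le (h : IsCLasso (designX U) (designZ U) Y a lam ρ θh γh)
    (hn : 0 < n) (hY : Y = designX U *ᵥ θs + designZ U *ᵥ γs + w) (hOm : Ωs * Ωs⁻¹ = 1)
    (hτ : ∀ j k, |1 / (n : ℝ) * (residCol U a j ᵥ* designZ U) k| ≤ c)
    (hM : ∀ j k, |1 / (n : ℝ) * (residCol U a j ⬝ᵥ fun i => designX U i k) - Ωs⁻¹ j k| ≤ e)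
    (he0 : 0 ≤ e) (he : (∑ j, ∑ k, |Ωs j k|) * e ≤ 1 / 2) {b r : ℝ}
    (hb : ∀ j, |1 / √n * (w ⬝ᵥ residCol U a j)| ≤ b)
    (hr : √n * (c * l1 (γh - γs)) ≤ r) :
    l1 ((fun j => √n * (θh j - θs j)) - Ωs *ᵥ (fun j => 1 / √n * (w ⬝ᵥ residCol U a j)))
      ≤ (∑ j, ∑ k, |Ωs j k|) * (r + 2 * (∑ j, ∑ k, |Ωs j k|) * e * (r + b)) := by
  have hn' : (0 : ℝ) < n := by exact_mod_cast hn
  have hsn0 : 0 < √(n : ℝ) := Real.sqrt_pos.2 hn'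
  have hsn := Real.mul_self_sqrt hn'.le
  set κΩ := ∑ j, ∑ k, |Ωs j k| with hκ
  have hκ0 : 0 ≤ κΩ := Finset.sum_nonneg fun _ _ => Finset.sum_nonneg fun _ _ => abs_nonneg _
  set M : Matrix (Fin d) (Fin d) ℝ := Matrix.of fun j k => 1 / (n : ℝ) *
    (residCol U a j ⬝ᵥ fun i => designX U i k) with hMdef
  set δ := θs - θh with hδ
  set G : Fin d → ℝ := fun j => 1 / √n * (w ⬝ᵥ residCol U a j) with hG
  have h1 := l1_sub_approx_inverse_le (M := M) hOm hM δ
  have h2 := h.l1_error_le hn hY hOm hτ hM he hb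
  have h3 : √n * l1 δ ≤ 2 * κΩ * (r + b) := by
    calc √n * l1 δ ≤ √n * (2 * κΩ * (c * l1 (γh - γs) + b / √n)) := by gcongr
      _ = 2 * κΩ * (√n * (c * l1 (γh - γs)) + b) := by field_simp
      _ ≤ _ := by gcongr
  have hR : ∀ j, |(√n • (M *ᵥ δ) + G) j| ≤ r := by
    intro j
    have e1 : (√n • (M *ᵥ δ) + G) j
        = √n * (1 / (n : ℝ) * (residCol U a j ᵥ* designZ U ⬝ᵥ (γh - γs))) := by
      rw [Pi.add_apply, Pi.smul_apply, h.zero_bias hY j, hG, smul_eq_mul, mul_sub]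
      have e2 : √n * (1 / (n : ℝ) * (w ⬝ᵥ residCol U a j)) = 1 / √n * (w ⬝ᵥ residCol U a j) := by
        field_simp
        rw [Real.sq_sqrt hn'.le]
      rw [e2, sub_add_cancel]
    rw [e1, abs_mul, abs_of_pos hsn0]
    exact (mul_le_mul_of_nonneg_left (abs_inv_mul_vecMul_dotProduct_le hτ _ j) hsn0.le).trans hr
  have e3 : (fun j => √n * (θh j - θs j)) - Ωs *ᵥ G
      = -(√n • (δ - Ωs *ᵥ (M *ᵥ δ))) - Ωs *ᵥ (√n • (M *ᵥ δ) + G) := by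
    have e4 : (fun j => √n * (θh j - θs j)) = -(√n • δ) := by
      ext j
      simp only [hδ, Pi.neg_apply, Pi.smul_apply, Pi.sub_apply, smul_eq_mul]
      ring
    rw [e4, mulVec_add, mulVec_smul, smul_sub (√(n : ℝ)) δ]
    abel
  rw [e3]
  refine (l1_sub_le _ _).trans ?_
  rw [l1_neg, l1_smul, abs_of_pos hsn0]
  have h4 := l1_mulVec_le (Om := Ωs) hR
  have h5 : √n * l1 (δ - Ωs *ᵥ (M *ᵥ δ)) ≤ κΩ * (e * (2 * κΩ * (r + b))) := by
    calc √n * l1 (δ - Ωs *ᵥ (M *ᵥ δ)) ≤ √n * (κΩ * (e * l1 δ)) := by gcongr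
      _ = κΩ * (e * (√n * l1 δ)) := by ring
      _ ≤ _ := by gcongr
  calc _ ≤ κΩ * (e * (2 * κΩ * (r + b))) + κΩ * r := add_le_add h5 h4
    _ = _ := by ring

end Rate

section WhpRate

variable {d : ℕ} {C₀ D C μ ρ K κ e : ℝ} {p s : ℕ → ℕ}
  {θs : ℕ → Fin d → ℝ} {γs : ∀ n, Fin (p n) → ℝ} {lam : ℕ → ℝ}
  {Ω : ℕ → Type*} [∀ n, MeasurableSpace (Ω n)] {Pr : ∀ n, Measure (Ω n)}
  {U : ∀ n, Ω n → Fin n → Row d (p n)} {w Y : ∀ n, Ω n → Fin n → ℝ}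
  {a : ∀ n, Ω n → Matrix (Fin (p n)) (Fin d) ℝ}
  {θh : ∀ n, Ω n → Fin d → ℝ} {γh : ∀ n, Ω n → Fin (p n) → ℝ} {Ωs : Matrix (Fin d) (Fin d) ℝ}

/-- `ℓ₁` rate of the nuisance estimator, from the stochastic bounds on the score, the Gram matrix
and the noise correlations. -/
lemma whp_l1_rate (hC₀ : 0 < C₀) (hD : 1 ≤ D) (hC : 0 < C) (hμ : 0 < μ) (hκ : 0 < κ)
    (hOm : Ωs * Ωs⁻¹ = 1) (he : (∑ j, ∑ k, |Ωs j k|) * e ≤ 1 / 2)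
    (hY : ∀ n ω, Y n ω = designX (U n ω) *ᵥ θs n + designZ (U n ω) *ᵥ γs n + w n ω)
    (hs : ∀ n, 1 ≤ s n) (hsparse : ∀ n, (supp (γs n)).card ≤ s n) (hρ : ∀ n, l1 (γs n) ≤ ρ)
    (hREC : WHP Pr fun n ω => REC (designZ (U n ω)) (supp (γs n)) μ)
    (hcol : WHP Pr fun n ω => ColumnsNormalized (designX (U n ω)) (designZ (U n ω)) C)
    (hα : WHP Pr fun n ω => IsNodewiseLasso (designX (U n ω)) (designZ (U n ω))
      (2 * C₀ * D * √(Real.log (p n) / n)) (a n ω))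
    (hgram : WHP Pr fun n ω => ∀ j k,
      |1 / (n : ℝ) * (residCol (U n ω) (a n ω) j ⬝ᵥ fun i => designX (U n ω) i k)
        - Ωs⁻¹ j k| ≤ e)
    (hscore : WHP Pr fun n ω => ∀ j,
      |1 / √n * (w n ω ⬝ᵥ residCol (U n ω) (a n ω) j)| ≤ √√(Real.log (p n)))
    (hnoise : WHP Pr fun n ω => ∀ k,
      |1 / (n : ℝ) * (w n ω ᵥ* designZ (U n ω)) k| ≤ lam n / 2 - κ / √n)
    (hlam_upper : ∀ᶠ n in atTop, lam n ≤ K * √(Real.log (p n) / n))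
    (hest : WHP Pr fun n ω => IsCLasso (designX (U n ω)) (designZ (U n ω)) (Y n ω) (a n ω)
      (lam n) ρ (θh n ω) (γh n ω))
    (hp : Tendsto p atTop atTop)
    (hregime : Tendsto (fun n : ℕ => (s n : ℝ) * Real.log (p n) / √n) atTop (𝓝 0)) :
    ∃ B : ℝ, WHP Pr fun n ω => l1 (γh n ω - γs n) ≤ B * (s n * √(Real.log (p n) / n)) := by
  set κΩ := ∑ j, ∑ k, |Ωs j k| with hκΩ
  have hκΩ0 : 0 ≤ κΩ := Finset.sum_nonneg fun _ _ => Finset.sum_nonneg fun _ _ => abs_nonneg _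
  refine ⟨8 * |K| / μ + 16 * C * κΩ ^ 2 / κ, ?_⟩
  refine ((((hREC.and hcol).and (hα.and hgram)).and (hscore.and hnoise)).and hest).mono ?_
  have hsm : ∀ᶠ n in atTop, 16 * C * κΩ ^ 2 * (2 * C₀ * D) ^ 2 * ρ *
      (Real.log (p n) / √n) ≤ κ / 2 := by
    have := (tendsto_log_div_sqrt hs hregime).const_mul
      (16 * C * κΩ ^ 2 * (2 * C₀ * D) ^ 2 * ρ)
    rw [mul_zero] at this
    exact this.eventually_le_const (by positivity)
  filter_upwards [hsm, hlam_upper, eventually_gt_atTop 0, hp.eventually_gt_atTop 0] with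
    n h1 h2 hn hpn ω ⟨⟨⟨⟨hRE, hco⟩, hαn, hg⟩, hsc, hno⟩, hes⟩
  have hn' : (0 : ℝ) < n := by exact_mod_cast hn
  have hq : 0 < √(n : ℝ) := Real.sqrt_pos.2 hn'
  have hlog0 : 0 ≤ Real.log (p n) := by positivity
  set L := √(Real.log (p n)) with hL
  have hL0 : 0 ≤ L := Real.sqrt_nonneg _
  have hrate : √(Real.log (p n) / n) = L / √n := Real.sqrt_div hlog0 _
  rw [hrate] at h2 hαn ⊢
  have hLsq : Real.log (p n) = L ^ 2 := (Real.sq_sqrt hlog0).symm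
  rw [hLsq] at h1
  have hs1 : (1 : ℝ) ≤ s n := by exact_mod_cast hs n
  have hLq : 0 ≤ L / √n := by positivity
  have hκ' : 0 < κ / √(n : ℝ) := by positivity
  have hlam : 0 < lam n := by
    have := (abs_nonneg _).trans (hno ⟨0, hpn⟩)
    linarith
  rcases le_total (l1 (γh n ω - γs n)) (16 * C * κΩ ^ 2 / κ * (L / √n)) with hsmall | hlarge
  · have h3 : 16 * C * κΩ ^ 2 / κ * (L / √n) ≤ 16 * C * κΩ ^ 2 / κ * (s n * (L / √n)) := by
      gcongr
      nlinarith
    have h4 : 0 ≤ 8 * |K| / μ * (s n * (L / √n)) := by positivity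
    rw [add_mul]
    linarith
  · have hl : l1 (γh n ω - γs n) ≤ 2 * ρ := by
      have := l1_sub_le (γh n ω) (γs n)
      linarith [hes.2.1, hρ n]
    have hlam1 : 0 ≤ 2 * C₀ * D * (L / √n) := by positivity
    have hδ := hes.l1_error_le hn (hY n ω) hOm
      (fun j k => hαn.abs_residCol_vecMul_le hlam1 j k) hg he hsc
    have hcont := contamination_le hC.le hκ hq hL0
      (l1_nonneg _) (l1_nonneg (γh n ω - γs n)) hl hδ h1 hlarge
    have hyd : Y n ω - designX (U n ω) *ᵥ θh n ω
        = designX (U n ω) *ᵥ (θs n - θh n ω) + designZ (U n ω) *ᵥ γs n + w n ω := by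
      rw [hY, mulVec_sub]
      abel
    have hr := constrained_lasso_l1_rate hlam hC.le hμ hes.2.1 (hρ n) hes.2.2 hyd hno hco.1
      hcont hRE
    refine hr.trans ?_
    have hcard : ((supp (γs n)).card : ℝ) ≤ s n := by exact_mod_cast hsparse n
    have hK : lam n ≤ |K| * (L / √n) := h2.trans (by gcongr; exact le_abs_self K)
    have h5 : 8 * lam n * (supp (γs n)).card / μ ≤ 8 * (|K| * (L / √n)) * s n / μ :=
      div_le_div_of_nonneg_right (mul_le_mul (by linarith) hcard (Nat.cast_nonneg _)
        (by positivity)) hμ.le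
    have h6 : 0 ≤ 16 * C * κΩ ^ 2 / κ * (s n * (L / √n)) := by positivity
    have h7 : 8 * (|K| * (L / √n)) * s n / μ = 8 * |K| / μ * (s n * (L / √n)) := by ring
    rw [add_mul]
    linarith

end WhpRate

/-! ### Asymptotic linearity of the estimator -/

section Expansion

variable {d : ℕ} {σ : NNReal} {C₀ D C μ ρ A K : ℝ} {p s : ℕ → ℕ}
  {P : ∀ n, Measure (Row d (p n))} [∀ n, IsProbabilityMeasure (P n)]
  {θs : ℕ → Fin d → ℝ} {γs : ∀ n, Fin (p n) → ℝ} {lam : ℕ → ℝ}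
  {Ω : ℕ → Type*} [∀ n, MeasurableSpace (Ω n)] {Pr : ∀ n, Measure (Ω n)}
  {U : ∀ n, Ω n → Fin n → Row d (p n)} {w Y : ∀ n, Ω n → Fin n → ℝ}
  {α : ∀ n, (Fin n → Row d (p n)) → Matrix (Fin (p n)) (Fin d) ℝ}
  {θh : ∀ n, Ω n → Fin d → ℝ} {γh : ∀ n, Ω n → Fin (p n) → ℝ} {Ωs : Matrix (Fin d) (Fin d) ℝ}

lemma whp_residCol_normalized (hC₀ : 0 < C₀) (hD : 1 ≤ D)
    (hcol : WHP Pr fun n ω => ColumnsNormalized (designX (U n ω)) (designZ (U n ω)) C)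
    (hα : WHP Pr fun n ω => IsNodewiseLasso (designX (U n ω)) (designZ (U n ω))
      (2 * C₀ * D * √(Real.log (p n) / n)) (α n (U n ω))) :
    WHP Pr fun n ω => ∀ j, 1 / (n : ℝ) * sqNorm (residCol (U n ω) (α n (U n ω)) j) ≤ C :=
  (hcol.and hα).mono <| Eventually.of_forall fun n ω h j =>
    h.2.sqNorm_residCol_le (by positivity) h.1 j

/-- The score is stochastically bounded, hence below `(log p)^{1/4}` with probability tending to
one. -/
lemma whp_score_le (hσ : 0 < σ) (hC : 0 < C) (hC₀ : 0 < C₀) (hD : 1 ≤ D)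
    (hα_meas : ∀ n k j, Measurable fun U' => α n U' k j)
    (hlaw : ∀ n, HasLaw (fun ω => (U n ω, w n ω))
      ((Measure.pi fun _ : Fin n => P n).prod
        (Measure.pi fun _ : Fin n => gaussianReal 0 (σ ^ 2))) (Pr n))
    (hcol : WHP Pr fun n ω => ColumnsNormalized (designX (U n ω)) (designZ (U n ω)) C)
    (hα : WHP Pr fun n ω => IsNodewiseLasso (designX (U n ω)) (designZ (U n ω))
      (2 * C₀ * D * √(Real.log (p n) / n)) (α n (U n ω)))
    (hp : Tendsto p atTop atTop) :
    WHP Pr fun n ω => ∀ j,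
      |1 / √n * (w n ω ⬝ᵥ residCol (U n ω) (α n (U n ω)) j)| ≤ √√(Real.log (p n)) := by
  have hσ' : (0 : ℝ) < σ := hσ
  have hr : Tendsto (fun n => (d : ℝ) * (2 *
      Real.exp (-((√√(Real.log (p n))) ^ 2 / (2 * σ ^ 2 * C))))) atTop (𝓝 0) := by
    have h1 : Tendsto (fun n => (√√(Real.log (p n))) ^ 2 / (2 * σ ^ 2 * C)) atTop atTop := by
      have h2 : Tendsto (fun n => √(Real.log (p n))) atTop atTop :=
        Real.tendsto_sqrt_atTop.comp (tendsto_log_dim hp)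
      simp only [Real.sq_sqrt (Real.sqrt_nonneg _)]
      exact h2.atTop_div_const (by positivity)
    simpa using ((Real.tendsto_exp_neg_atTop_nhds_zero.comp h1).const_mul 2).const_mul (d : ℝ)
  have hscore : WHP Pr fun n ω =>
      (∀ j, 1 / (n : ℝ) * sqNorm (residCol (U n ω) (α n (U n ω)) j) ≤ C) →
      ∀ j, |1 / √n * (w n ω ⬝ᵥ residCol (U n ω) (α n (U n ω)) j)| ≤ √√(Real.log (p n)) := by
    refine whp_of_measure_le hr ?_
    filter_upwards [eventually_gt_atTop 0] with n hn
    exact score_tail hσ hC hn (hlaw n) (hα_meas n) (Real.sqrt_nonneg _)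
  exact ((whp_residCol_normalized hC₀ hD hcol hα).and hscore).mono <|
    Eventually.of_forall fun n ω h => h.2 h.1

/-- The slack `4 σ C² d / √n` of the penalty level leaves `σ C² d / √n` above the noise. -/
lemma whp_noise_le_penalty (hσ : 0 < σ) (hC : 0 < C) (hd : 0 < d)
    (hlaw : ∀ n, HasLaw (fun ω => (U n ω, w n ω))
      ((Measure.pi fun _ : Fin n => P n).prod
        (Measure.pi fun _ : Fin n => gaussianReal 0 (σ ^ 2))) (Pr n))
    (hρ : ∀ n, l1 (γs n) ≤ ρ)
    (hcol : WHP Pr fun n ω => ColumnsNormalized (designX (U n ω)) (designZ (U n ω)) C)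
    (hlam_lower : WHP Pr fun n ω =>
      2 * σ * √(2 * C * Real.log (p n) / n) + 4 * σ * C ^ 2 * d / √n
        + 8 * C * d * ρ * supNorm ((1 / (n : ℝ)) •
            ((resid (designX (U n ω)) (designZ (U n ω)) (α n (U n ω)))ᵀ
              * designZ (U n ω))) ≤ lam n)
    (hp : Tendsto p atTop atTop) :
    WHP Pr fun n ω => ∀ k,
      |1 / (n : ℝ) * (w n ω ᵥ* designZ (U n ω)) k| ≤ lam n / 2 - σ * C ^ 2 * d / √n := by
  have hσ' : (0 : ℝ) < σ := hσ
  have hd' : (0 : ℝ) < d := by exact_mod_cast hd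
  have hκ : 0 < σ * C ^ 2 * d := by positivity
  have hno := whp_noise_correlation hσ hC hκ hlaw hp hcol
  refine (hno.and hlam_lower).mono <| Eventually.of_forall fun n ω h k => ?_
  have hρ0 : 0 ≤ ρ := (l1_nonneg (γs n)).trans (hρ n)
  have h1 := h.1 k
  have h2 := h.2
  have h3 : 0 ≤ supNorm ((1 / (n : ℝ)) •
      ((resid (designX (U n ω)) (designZ (U n ω)) (α n (U n ω)))ᵀ * designZ (U n ω))) :=
    Real.iSup_nonneg fun _ => abs_nonneg _
  have h4 : 0 ≤ 8 * C * d * ρ * supNorm ((1 / (n : ℝ)) •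
      ((resid (designX (U n ω)) (designZ (U n ω)) (α n (U n ω)))ᵀ * designZ (U n ω))) := by
    positivity
  have h5 : 4 * σ * C ^ 2 * d / √n = 4 * (σ * C ^ 2 * d / √n) := by ring
  linarith

/-- Asymptotic linearity: `√n (θ̂ - θ*)` is `Ω*` times the score, up to an error that vanishes in
probability. -/
lemma whp_expansion (hσ : 0 < σ) (hC₀ : 0 < C₀) (hD : 1 ≤ D) (hC : 0 < C) (hμ : 0 < μ)
    (hα_meas : ∀ n k j, Measurable fun U' => α n U' k j)
    (hlaw : ∀ n, HasLaw (fun ω => (U n ω, w n ω))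
      ((Measure.pi fun _ : Fin n => P n).prod
        (Measure.pi fun _ : Fin n => gaussianReal 0 (σ ^ 2))) (Pr n))
    (hY : ∀ n ω, Y n ω = designX (U n ω) *ᵥ θs n + designZ (U n ω) *ᵥ γs n + w n ω)
    (hsubG : ∀ n, SubGaussianRow (P n) C₀) (hZZ : ∀ n, (SigmaZZ (P n)).PosDef)
    (hres : ∀ n, (residCov (P n) (alphaStar (P n))).PosDef)
    (hαs : ∀ n j, l1 (fun k => alphaStar (P n) k j) ≤ A)
    (hΩ : Tendsto (fun n => OmegaStar (P n)) atTop (𝓝 Ωs))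
    (hs : ∀ n, 1 ≤ s n) (hsparse : ∀ n, (supp (γs n)).card ≤ s n) (hρ : ∀ n, l1 (γs n) ≤ ρ)
    (hREC : WHP Pr fun n ω => REC (designZ (U n ω)) (supp (γs n)) μ)
    (hcol : WHP Pr fun n ω => ColumnsNormalized (designX (U n ω)) (designZ (U n ω)) C)
    (hα : WHP Pr fun n ω => IsNodewiseLasso (designX (U n ω)) (designZ (U n ω))
      (2 * C₀ * D * √(Real.log (p n) / n)) (α n (U n ω)))
    (hlam_lower : WHP Pr fun n ω =>
      2 * σ * √(2 * C * Real.log (p n) / n) + 4 * σ * C ^ 2 * d / √n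
        + 8 * C * d * ρ * supNorm ((1 / (n : ℝ)) •
            ((resid (designX (U n ω)) (designZ (U n ω)) (α n (U n ω)))ᵀ
              * designZ (U n ω))) ≤ lam n)
    (hlam_upper : ∀ᶠ n in atTop, lam n ≤ K * √(Real.log (p n) / n))
    (hest : WHP Pr fun n ω => IsCLasso (designX (U n ω)) (designZ (U n ω)) (Y n ω)
      (α n (U n ω)) (lam n) ρ (θh n ω) (γh n ω))
    (hp : Tendsto p atTop atTop)
    (hregime : Tendsto (fun n : ℕ => (s n : ℝ) * Real.log (p n) / √n) atTop (𝓝 0))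
    {ε : ℝ} (hε : 0 < ε) :
    WHP Pr fun n ω => l1 ((fun j => √n * (θh n ω j - θs n j))
      - Ωs *ᵥ (fun j => 1 / √n * (w n ω ⬝ᵥ residCol (U n ω) (α n (U n ω)) j))) ≤ ε := by
  rcases Nat.eq_zero_or_pos d with rfl | hd
  · simp [WHP, l1, hε.le]
  have hσ' : (0 : ℝ) < σ := hσ
  have hd' : (0 : ℝ) < d := by exact_mod_cast hd
  set κΩ := ∑ j, ∑ k, |Ωs j k| with hκΩ
  have hκΩ0 : 0 ≤ κΩ := Finset.sum_nonneg fun _ _ => Finset.sum_nonneg fun _ _ => abs_nonneg _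
  have hOm : Ωs * Ωs⁻¹ = 1 :=
    mul_nonsing_inv _ (det_pos_of_tendsto_omegaStar hC₀ hsubG hZZ hres hΩ).ne'.isUnit
  have hgram := fun {η : ℝ} (hη : 0 < η) =>
    whp_gram hC₀ hD hlaw hsubG hZZ hres hαs hΩ hα hs hp hregime hη
  have hscale : ∀ x : ℝ, 0 ≤ x → x ≤ 1 / (2 * (κΩ + 1)) → κΩ * x ≤ 1 / 2 := fun x hx0 hx => by
    calc κΩ * x ≤ (κΩ + 1) * (1 / (2 * (κΩ + 1))) := by gcongr; linarith
      _ = 1 / 2 := by field_simp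
  have hscore := whp_score_le hσ hC hC₀ hD hα_meas hlaw hcol hα hp
  obtain ⟨B', hB'⟩ := whp_l1_rate (e := 1 / (2 * (κΩ + 1))) hC₀ hD hC hμ
    (show 0 < σ * C ^ 2 * d by positivity) hOm (hscale _ (by positivity) le_rfl) hY hs hsparse hρ
    hREC hcol hα ((hgram (show 0 < 1 / (2 * (κΩ + 1)) by positivity)).mono
      (Eventually.of_forall fun n ω h j k => (h j k).2)) hscore
    (whp_noise_le_penalty hσ hC hd hlaw hρ hcol hlam_lower hp) hlam_upper hest hp hregime
  have hnorm := whp_residCol_normalized hC₀ hD hcol hα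
  refine whp_of_forall_eps fun δ hδ => ?_
  -- a level that the score exceeds with probability at most `δ`
  obtain ⟨B, hB0, hB⟩ : ∃ B : ℝ, 0 ≤ B ∧
      d * (2 * Real.exp (-(B ^ 2 / (2 * σ ^ 2 * C)))) ≤ δ := by
    have h1 : Tendsto (fun B : ℝ => (d : ℝ) * (2 * Real.exp (-(B ^ 2 / (2 * σ ^ 2 * C)))))
        atTop (𝓝 0) := by
      have h2 : Tendsto (fun B : ℝ => B ^ 2 / (2 * σ ^ 2 * C)) atTop atTop :=
        (tendsto_pow_atTop two_ne_zero).atTop_div_const (by positivity)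
      simpa using ((Real.tendsto_exp_neg_atTop_nhds_zero.comp h2).const_mul 2).const_mul (d : ℝ)
    obtain ⟨B, hB⟩ := ((h1.eventually_le_const hδ).and (eventually_ge_atTop 0)).exists
    exact ⟨B, hB.2, hB.1⟩
  set r := min 1 (ε / (2 * (κΩ + 1))) with hr
  have hr0 : 0 < r := lt_min one_pos (by positivity)
  set e := min (1 / (2 * (κΩ + 1))) (ε / (4 * (κΩ + 1) ^ 2 * (1 + B))) with he
  have he0 : 0 < e := lt_min (by positivity) (by positivity)
  have hfin : κΩ * (r + 2 * κΩ * e * (r + B)) ≤ ε := by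
    calc κΩ * (r + 2 * κΩ * e * (r + B))
        ≤ (κΩ + 1) * (ε / (2 * (κΩ + 1)) + 2 * (κΩ + 1) *
            (ε / (4 * (κΩ + 1) ^ 2 * (1 + B))) * (1 + B)) := by
          have := min_le_left 1 (ε / (2 * (κΩ + 1)))
          have := min_le_right 1 (ε / (2 * (κΩ + 1)))
          have := min_le_right (1 / (2 * (κΩ + 1))) (ε / (4 * (κΩ + 1) ^ 2 * (1 + B)))
          have : κΩ ≤ κΩ + 1 := by linarith
          gcongr
      _ = ε := by field_simp; ring
  have hsmall : ∀ᶠ n : ℕ in atTop,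
      2 * C₀ * D * B' * ((s n : ℝ) * Real.log (p n) / √n) ≤ r := by
    have := hregime.const_mul (2 * C₀ * D * B')
    rw [mul_zero] at this
    exact this.eventually_le_const hr0
  refine ⟨_, fun n ω => (∀ j, 1 / (n : ℝ) * sqNorm (residCol (U n ω) (α n (U n ω)) j) ≤ C) →
    ∀ j, |1 / √n * (w n ω ⬝ᵥ residCol (U n ω) (α n (U n ω)) j)| ≤ B,
    ((hnorm.and hB').and (hα.and hest)).and (hgram he0), ?_, ?_⟩
  · filter_upwards [eventually_gt_atTop 0] with n hn
    exact (score_tail hσ hC hn (hlaw n) (hα_meas n) hB0).trans (ENNReal.ofReal_le_ofReal hB)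
  · filter_upwards [hsmall, eventually_gt_atTop 0] with n h1 hn ω
      ⟨⟨⟨hno, hl⟩, hαn, hes⟩, hg⟩ hsc
    have hn' : (0 : ℝ) < n := by exact_mod_cast hn
    have hlam0 : 0 ≤ 2 * C₀ * D * √(Real.log (p n) / n) := by positivity
    refine (hes.expansion_error_le hn (hY n ω) hOm
      (fun j k => hαn.abs_residCol_vecMul_le hlam0 j k) (fun j k => (hg j k).2) he0.le
      (hscale e he0.le (min_le_left _ _)) (hsc hno) (r := r) ?_).trans hfin
    calc √n * (2 * C₀ * D * √(Real.log (p n) / n) * l1 (γh n ω - γs n))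
        ≤ √n * (2 * C₀ * D * √(Real.log (p n) / n) * (B' * (s n * √(Real.log (p n) / n)))) := by
          gcongr
      _ = 2 * C₀ * D * B' * (s n * (n * √(Real.log (p n) / n) ^ 2) / √n) := by
          have hsq := Real.sq_sqrt hn'.le
          have h0 : √(n : ℝ) ≠ 0 := (Real.sqrt_pos.2 hn').ne'
          field_simp
          rw [hsq]
      _ = 2 * C₀ * D * B' * (s n * Real.log (p n) / √n) := by rw [natCast_mul_rate_sq hn]
      _ ≤ r := h1

end Expansion

/-! ### Limit in distribution -/

section Limit

lemma norm_exp_ofReal_mul_I_sub_le (x y : ℝ) :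
    ‖Complex.exp (x * Complex.I) - Complex.exp (y * Complex.I)‖ ≤ |x - y| := by
  have h : Complex.exp (x * Complex.I) - Complex.exp (y * Complex.I)
      = Complex.exp (y * Complex.I) * (Complex.exp (Complex.I * ((x - y : ℝ) : ℂ)) - 1) := by
    rw [mul_sub, ← Complex.exp_add, mul_one]
    congr 2
    push_cast
    ring
  rw [h, norm_mul, Complex.norm_exp_ofReal_mul_I, one_mul]
  exact Real.norm_exp_I_mul_ofReal_sub_one_le

lemma abs_exp_neg_sub_le {x y : ℝ} (hx : 0 ≤ x) (hy : 0 ≤ y) :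
    |Real.exp (-x) - Real.exp (-y)| ≤ |x - y| := by
  wlog hxy : x ≤ y generalizing x y
  · rw [abs_sub_comm, abs_sub_comm x]
    exact this hy hx (le_of_not_ge hxy)
  have h1 : Real.exp (-y) ≤ Real.exp (-x) := Real.exp_le_exp.2 (by linarith)
  have h2 : Real.exp (-x) ≤ 1 := Real.exp_le_one_iff.2 (by linarith)
  have h3 : Real.exp (-y) = Real.exp (-x) * Real.exp (x - y) := by
    rw [← Real.exp_add]
    congr 1
    ring
  have h4 := Real.add_one_le_exp (x - y)
  rw [abs_of_nonneg (by linarith), abs_of_nonpos (by linarith)]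
  nlinarith [Real.exp_pos (-x)]

/-- The squared norm of a linear combination of the normalized residuals is a quadratic form in
their Gram matrix, so it inherits the closeness of that matrix to its limit. -/
lemma abs_sqNorm_sum_residCol_sub_le {n d p : ℕ} {U : Fin n → Row d p}
    {a : Matrix (Fin p) (Fin d) ℝ} {R : Matrix (Fin d) (Fin d) ℝ} {η : ℝ}
    (hg : ∀ j k, |1 / (n : ℝ) * (residCol U a j ⬝ᵥ residCol U a k) - R j k| ≤ η)
    (h : Fin d → ℝ) :
    |sqNorm (fun i => 1 / √n * ∑ j, h j * residCol U a j i) - h ⬝ᵥ R *ᵥ h| ≤ l1 h ^ 2 * η := by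
  have e1 : sqNorm (fun i => 1 / √n * ∑ j, h j * residCol U a j i)
      = ∑ j, ∑ k, h j * h k * (1 / (n : ℝ) * (residCol U a j ⬝ᵥ residCol U a k)) := by
    have h0 : ∀ i, (1 / √(n : ℝ) * ∑ j, h j * residCol U a j i) ^ 2
        = ∑ j, ∑ k, h j * h k * (1 / (n : ℝ) * (residCol U a j i * residCol U a k i)) := by
      intro i
      rw [mul_pow, div_pow, one_pow, Real.sq_sqrt (Nat.cast_nonneg n), sq, Finset.sum_mul_sum,
        Finset.mul_sum]
      refine Finset.sum_congr rfl fun j _ => ?_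
      rw [Finset.mul_sum]
      exact Finset.sum_congr rfl fun k _ => by ring
    simp only [sqNorm, h0]
    rw [Finset.sum_comm]
    refine Finset.sum_congr rfl fun j _ => ?_
    rw [Finset.sum_comm]
    refine Finset.sum_congr rfl fun k _ => ?_
    rw [dotProduct, Finset.mul_sum, Finset.mul_sum]
  have e2 : h ⬝ᵥ R *ᵥ h = ∑ j, ∑ k, h j * h k * R j k := by
    simp only [dotProduct, mulVec, Finset.mul_sum]
    exact Finset.sum_congr rfl fun j _ => Finset.sum_congr rfl fun k _ => by ring
  rw [e1, e2, ← Finset.sum_sub_distrib]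
  refine (Finset.abs_sum_le_sum_abs _ _).trans ?_
  rw [l1, sq, Finset.sum_mul_sum, Finset.sum_mul]
  refine Finset.sum_le_sum fun j _ => ?_
  rw [← Finset.sum_sub_distrib, Finset.sum_mul]
  refine (Finset.abs_sum_le_sum_abs _ _).trans (Finset.sum_le_sum fun k _ => ?_)
  rw [← mul_sub, abs_mul, abs_mul]
  exact mul_le_mul_of_nonneg_left (hg j k) (by positivity)

variable {d : ℕ} {σ : NNReal} {p : ℕ → ℕ}
  {P : ∀ n, Measure (Row d (p n))} [∀ n, IsProbabilityMeasure (P n)]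
  {Ω : ℕ → Type*} [∀ n, MeasurableSpace (Ω n)] {Pr : ∀ n, Measure (Ω n)}
  [∀ n, IsProbabilityMeasure (Pr n)]
  {U : ∀ n, Ω n → Fin n → Row d (p n)} {w : ∀ n, Ω n → Fin n → ℝ}
  {α : ∀ n, (Fin n → Row d (p n)) → Matrix (Fin (p n)) (Fin d) ℝ}
  {R Ωs : Matrix (Fin d) (Fin d) ℝ}

/-- Given the design, the score is Gaussian with covariance `σ²` times the Gram matrix of the
residuals; its characteristic function converges once that Gram matrix does. -/
lemma tendsto_charFun_score (hα_meas : ∀ n k j, Measurable fun U' => α n U' k j)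
    (hlaw : ∀ n, HasLaw (fun ω => (U n ω, w n ω))
      ((Measure.pi fun _ : Fin n => P n).prod
        (Measure.pi fun _ : Fin n => gaussianReal 0 (σ ^ 2))) (Pr n))
    (hgram : ∀ η : ℝ, 0 < η → WHP Pr fun n ω => ∀ j k,
      |1 / (n : ℝ) * (residCol (U n ω) (α n (U n ω)) j ⬝ᵥ residCol (U n ω) (α n (U n ω)) k)
        - R j k| ≤ η)
    (h : Fin d → ℝ) (hR : 0 ≤ h ⬝ᵥ R *ᵥ h) :
    Tendsto (fun n => ∫ ω, Complex.exp
      ((h ⬝ᵥ fun j => 1 / √n * (w n ω ⬝ᵥ residCol (U n ω) (α n (U n ω)) j) : ℝ) * Complex.I)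
        ∂(Pr n)) atTop (𝓝 (Real.exp (-(σ ^ 2 * (h ⬝ᵥ R *ᵥ h) / 2)) : ℝ)) := by
  set z : ∀ n, (Fin n → Row d (p n)) → Fin n → ℝ :=
    fun n U' i => 1 / √n * ∑ j, h j * residCol U' (α n U') j i with hz
  have hzm : ∀ n, Measurable (z n) := fun n => by
    refine measurable_pi_lambda _ fun i => ?_
    have := fun j => (measurable_pi_apply i).comp (measurable_residCol (hα_meas n) j)
    simp only [Function.comp_def] at this
    simp only [hz]
    fun_prop
  have e1 : ∀ (n : ℕ) (ω : Ω n), (h ⬝ᵥ fun j => 1 / √n * (w n ω ⬝ᵥ residCol (U n ω) (α n (U n ω)) j))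
      = w n ω ⬝ᵥ z n (U n ω) := by
    intro n ω
    simp only [hz, dotProduct, Finset.mul_sum]
    rw [Finset.sum_comm]
    exact Finset.sum_congr rfl fun i _ => Finset.sum_congr rfl fun j _ => by ring
  simp only [e1]
  simp_rw [fun n => noise_charFun (hlaw n) (hzm n)]
  have hconst : ∀ n, ∫ _ : Ω n, (Real.exp (-(σ ^ 2 * (h ⬝ᵥ R *ᵥ h) / 2)) : ℂ) ∂(Pr n)
      = Real.exp (-(σ ^ 2 * (h ⬝ᵥ R *ᵥ h) / 2)) := fun n => by simp
  have hle : ∀ x : ℝ, 0 ≤ x → ‖(Real.exp (-x) : ℂ)‖ ≤ 1 := fun x hx => by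
    rw [Complex.norm_real, Real.norm_of_nonneg (Real.exp_pos _).le]
    exact Real.exp_le_one_iff.2 (by linarith)
  have hnn : ∀ n ω, 0 ≤ σ ^ 2 * sqNorm (z n (U n ω)) / 2 := fun n ω => by
    have := sqNorm_nonneg (z n (U n ω))
    positivity
  have key := tendsto_integral_sub_of_whp (Pr := Pr)
    (f := fun n ω => Complex.exp ((-(σ ^ 2 * sqNorm (z n (U n ω)) / 2) : ℝ)))
    (g := fun n _ => (Real.exp (-(σ ^ 2 * (h ⬝ᵥ R *ᵥ h) / 2)) : ℂ))
    (fun n => ?_) (fun n => aestronglyMeasurable_const) (fun n ω => ?_) (fun n ω => ?_) ?_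
  · simp only [hconst] at key
    have h2 := key.add_const ((Real.exp (-(σ ^ 2 * (h ⬝ᵥ R *ᵥ h) / 2)) : ℝ) : ℂ)
    rw [zero_add] at h2
    exact h2.congr fun n => sub_add_cancel _ _
  · have hm : Measurable fun U' => Complex.exp ((-(σ ^ 2 * sqNorm (z n U') / 2) : ℝ)) := by
      have := measurable_sqNorm (hzm n)
      fun_prop
    exact (hm.comp_aemeasurable (hasLaw_design (hlaw n)).aemeasurable).aestronglyMeasurable
  · rw [← Complex.ofReal_exp]
    exact hle _ (hnn n ω)
  · exact hle _ (by positivity)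
  · intro ε hε
    refine (hgram (ε / (σ ^ 2 * l1 h ^ 2 + 1)) (by positivity)).mono <|
      Eventually.of_forall fun n ω hg => ?_
    have h1 := abs_sqNorm_sum_residCol_sub_le hg h
    rw [← Complex.ofReal_exp, ← Complex.ofReal_sub, Complex.norm_real, Real.norm_eq_abs]
    refine (abs_exp_neg_sub_le (hnn n ω) (by positivity)).trans ?_
    have e2 : σ ^ 2 * sqNorm (z n (U n ω)) / 2 - σ ^ 2 * (h ⬝ᵥ R *ᵥ h) / 2
        = σ ^ 2 / 2 * (sqNorm (z n (U n ω)) - h ⬝ᵥ R *ᵥ h) := by ring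
    rw [e2, abs_mul, abs_of_nonneg (by positivity)]
    calc (σ : ℝ) ^ 2 / 2 * |sqNorm (z n (U n ω)) - h ⬝ᵥ R *ᵥ h|
        ≤ σ ^ 2 / 2 * (l1 h ^ 2 * (ε / (σ ^ 2 * l1 h ^ 2 + 1))) := by gcongr
      _ = (σ ^ 2 * l1 h ^ 2 / 2) / (σ ^ 2 * l1 h ^ 2 + 1) * ε := by ring
      _ ≤ 1 * ε := by
          gcongr
          rw [div_le_one (by positivity)]
          have : 0 ≤ (σ : ℝ) ^ 2 * l1 h ^ 2 := by positivity
          linarith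
      _ = ε := one_mul ε

/-- An estimator that is asymptotically `Ωs` times a score with conditional covariance close to
`σ² Ωs⁻¹` is asymptotically `N(0, σ² Ωs)`. -/
lemma tendstoInDistribution_of_expansion {T : ∀ n, Ω n → Fin d → ℝ}
    (hT : ∀ n, Measurable (T n)) (hα_meas : ∀ n k j, Measurable fun U' => α n U' k j)
    (hlaw : ∀ n, HasLaw (fun ω => (U n ω, w n ω))
      ((Measure.pi fun _ : Fin n => P n).prod
        (Measure.pi fun _ : Fin n => gaussianReal 0 (σ ^ 2))) (Pr n))
    (hpsd : Ωs.PosSemidef) (hOm : Ωs * Ωs⁻¹ = 1)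
    (hgram : ∀ η : ℝ, 0 < η → WHP Pr fun n ω => ∀ j k,
      |1 / (n : ℝ) * (residCol (U n ω) (α n (U n ω)) j ⬝ᵥ residCol (U n ω) (α n (U n ω)) k)
        - Ωs⁻¹ j k| ≤ η)
    (hexp : ∀ ε : ℝ, 0 < ε → WHP Pr fun n ω => l1 (T n ω
      - Ωs *ᵥ (fun j => 1 / √n * (w n ω ⬝ᵥ residCol (U n ω) (α n (U n ω)) j))) ≤ ε) :
    TendstoInDistribution (fun n ω => WithLp.toLp 2 (T n ω) : ∀ n, Ω n → EuclideanSpace ℝ (Fin d))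
      atTop id Pr (multivariateGaussian 0 ((σ : ℝ) ^ 2 • Ωs)) := by
  have hTm : ∀ n, AEMeasurable (fun ω => (WithLp.toLp 2 (T n ω) : EuclideanSpace ℝ (Fin d)))
      (Pr n) := fun n => by
    have := hT n
    exact Measurable.aemeasurable (by fun_prop)
  refine ⟨hTm, aemeasurable_id, ?_⟩
  refine ProbabilityMeasure.tendsto_iff_tendsto_charFun.2 fun t => ?_
  simp only [ProbabilityMeasure.coe_mk, Measure.map_id]
  rw [charFun_multivariateGaussian (hpsd.smul (by positivity))]
  set h : Fin d → ℝ := t.ofLp ᵥ* Ωs with hh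
  have hsymm : Ωsᵀ = Ωs := by simpa using hpsd.isHermitian.eq
  have hq : h ⬝ᵥ Ωs⁻¹ *ᵥ h = t.ofLp ⬝ᵥ Ωs *ᵥ t.ofLp := by
    have e1 : h = Ωs *ᵥ t.ofLp := by rw [hh, ← hsymm, vecMul_transpose, hsymm]
    rw [hh, ← dotProduct_mulVec, mulVec_mulVec, hOm, one_mulVec, ← hh, e1]
  have hq0 : 0 ≤ h ⬝ᵥ Ωs⁻¹ *ᵥ h := by
    rw [hq]
    simpa using hpsd.dotProduct_mulVec_nonneg t.ofLp
  have hlim := tendsto_charFun_score hα_meas hlaw hgram h hq0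
  set G : ∀ n, Ω n → Fin d → ℝ :=
    fun n ω j => 1 / √n * (w n ω ⬝ᵥ residCol (U n ω) (α n (U n ω)) j) with hG
  have hGm : ∀ n, AEMeasurable (fun ω => h ⬝ᵥ G n ω) (Pr n) := fun n => by
    have hw : AEMeasurable (w n) (Pr n) := (hlaw n).aemeasurable.snd
    have hU : AEMeasurable (U n) (Pr n) := (hasLaw_design (hlaw n)).aemeasurable
    have hr := fun j => (measurable_residCol (hα_meas n) j).comp_aemeasurable hU
    have hwi := fun i => (measurable_pi_apply i).comp_aemeasurable hw
    have hri := fun j i => (measurable_pi_apply i).comp_aemeasurable (hr j)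
    simp only [Function.comp_def] at hwi hri
    simp only [hG, dotProduct]
    fun_prop
  have hcf : ∀ n, charFun ((Pr n).map fun ω => (WithLp.toLp 2 (T n ω) : EuclideanSpace ℝ (Fin d))) t
      = ∫ ω, Complex.exp ((t.ofLp ⬝ᵥ T n ω : ℝ) * Complex.I) ∂(Pr n) := by
    intro n
    rw [charFun_apply, integral_map (hTm n) (by fun_prop)]
    refine integral_congr_ae (Eventually.of_forall fun ω => ?_)
    simp [EuclideanSpace.inner_eq_star_dotProduct]
  simp only [hcf]
  have key := tendsto_integral_sub_of_whp (Pr := Pr)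
    (f := fun n ω => Complex.exp ((t.ofLp ⬝ᵥ T n ω : ℝ) * Complex.I))
    (g := fun n ω => Complex.exp ((h ⬝ᵥ G n ω : ℝ) * Complex.I))
    (fun n => ?_) (fun n => ?_) (fun n ω => (Complex.norm_exp_ofReal_mul_I _).le)
    (fun n ω => (Complex.norm_exp_ofReal_mul_I _).le) ?_
  · have h2 : Tendsto (fun n => ∫ ω, Complex.exp ((t.ofLp ⬝ᵥ T n ω : ℝ) * Complex.I) ∂(Pr n))
        atTop (𝓝 (0 + (Real.exp (-(σ ^ 2 * (h ⬝ᵥ Ωs⁻¹ *ᵥ h) / 2)) : ℝ))) :=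
      (key.add hlim).congr fun n => sub_add_cancel _ _
    convert h2 using 2
    rw [hq, zero_add, inner_zero_right, smul_mulVec, dotProduct_smul]
    simp
  · have : Measurable fun ω => t.ofLp ⬝ᵥ T n ω := by
      have := hT n
      simp only [dotProduct]
      fun_prop
    exact Measurable.aestronglyMeasurable (by fun_prop)
  · have := hGm n
    exact AEMeasurable.aestronglyMeasurable (by fun_prop)
  · intro ε hε
    refine (hexp (ε / (l1 t.ofLp + 1)) (div_pos hε (by linarith [l1_nonneg t.ofLp]))).mono <|
      Eventually.of_forall fun n ω hn => ?_
    refine (norm_exp_ofReal_mul_I_sub_le _ _).trans ?_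
    have e1 : t.ofLp ⬝ᵥ T n ω - h ⬝ᵥ G n ω = t.ofLp ⬝ᵥ (T n ω - Ωs *ᵥ G n ω) := by
      rw [dotProduct_sub, hh, dotProduct_mulVec]
    rw [e1]
    have ht0 := l1_nonneg t.ofLp
    have ht : ∀ j, |t.ofLp j| ≤ l1 t.ofLp := fun j =>
      Finset.single_le_sum (f := fun j => |t.ofLp j|) (fun _ _ => abs_nonneg _) (Finset.mem_univ j)
    calc |t.ofLp ⬝ᵥ (T n ω - Ωs *ᵥ G n ω)| ≤ l1 t.ofLp * l1 (T n ω - Ωs *ᵥ G n ω) :=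
          abs_dotProduct_le ht
      _ ≤ (l1 t.ofLp + 1) * (ε / (l1 t.ofLp + 1)) := by
          have h0 := l1_nonneg (T n ω - Ωs *ᵥ G n ω)
          gcongr
          linarith
      _ = ε := by field_simp

end Limit

end CLasso

theorem corollary1
    -- fixed dimension `d` of the parameter of interest; constants not depending on `n`
    (d : ℕ) (σ : NNReal) (C₀ D C μ ρ A K : ℝ)
    (hσ : 0 < σ) (hC₀ : 0 < C₀) (hD : 1 ≤ D) (hC : 0 < C) (hμ : 0 < μ)
    -- nuisance dimension, sparsity level, law of a row of the design and true parameters,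
    -- all allowed to change with the sample size `n`
    (p s : ℕ → ℕ)
    (P : ∀ n, Measure (CLasso.Row d (p n))) [∀ n, IsProbabilityMeasure (P n)]
    (θs : ℕ → Fin d → ℝ) (γs : ∀ n, Fin (p n) → ℝ) (lam : ℕ → ℝ)
    -- the data: rows `U` of the design and noise `w`
    (Ω : ℕ → Type*) [∀ n, MeasurableSpace (Ω n)]
    (Pr : ∀ n, Measure (Ω n)) [∀ n, IsProbabilityMeasure (Pr n)]
    (U : ∀ n, Ω n → Fin n → CLasso.Row d (p n)) (w Y : ∀ n, Ω n → Fin n → ℝ)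
    -- `α` is a measurable function of the design, `(θh, γh)` is the estimator
    (α : ∀ n, (Fin n → CLasso.Row d (p n)) → Matrix (Fin (p n)) (Fin d) ℝ)
    (hα_meas : ∀ n k j, Measurable fun U' => α n U' k j)
    (θh : ∀ n, Ω n → Fin d → ℝ) (hθh_meas : ∀ n, Measurable (θh n))
    (γh : ∀ n, Ω n → Fin (p n) → ℝ)
    -- rows i.i.d. with law `P n`, noise `N(0, σ² Iₙ)` independent of the design, linear model
    (hlaw : ∀ n, HasLaw (fun ω => (U n ω, w n ω))
      ((Measure.pi fun _ : Fin n => P n).prod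
        (Measure.pi fun _ : Fin n => gaussianReal 0 (σ ^ 2))) (Pr n))
    (hY : ∀ n ω, Y n ω =
      CLasso.designX (U n ω) *ᵥ θs n + CLasso.designZ (U n ω) *ᵥ γs n + w n ω)
    -- sub-Gaussian design, nondegenerate population quantities, bounded `α*`
    (hsubG : ∀ n, CLasso.SubGaussianRow (P n) C₀)
    (hZZ : ∀ n, (CLasso.SigmaZZ (P n)).PosDef)
    (hres : ∀ n, (CLasso.residCov (P n) (CLasso.alphaStar (P n))).PosDef)
    (hαs : ∀ n j, CLasso.l1 (fun k => CLasso.alphaStar (P n) k j) ≤ A)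
    -- `Ω*` (constant, or more generally convergent, along the sequence)
    (Ωs : Matrix (Fin d) (Fin d) ℝ)
    (hΩ : Tendsto (fun n => CLasso.OmegaStar (P n)) atTop (𝓝 Ωs))
    -- sparse truth, feasible for the constraint
    (hs : ∀ n, 1 ≤ s n) (hsparse : ∀ n, (CLasso.supp (γs n)).card ≤ s n)
    (hρ : ∀ n, CLasso.l1 (γs n) ≤ ρ)
    -- restricted eigenvalue condition and column normalization
    (hREC : CLasso.WHP Pr fun n ω =>
      CLasso.REC (CLasso.designZ (U n ω)) (CLasso.supp (γs n)) μ)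
    (hcol : CLasso.WHP Pr fun n ω =>
      CLasso.ColumnsNormalized (CLasso.designX (U n ω)) (CLasso.designZ (U n ω)) C)
    -- `α` from node-wise regression with `λ_j = 2 C₀ D √(log p / n)`
    (hα : CLasso.WHP Pr fun n ω =>
      CLasso.IsNodewiseLasso (CLasso.designX (U n ω)) (CLasso.designZ (U n ω))
        (2 * C₀ * D * √(Real.log (p n) / n)) (α n (U n ω)))
    -- the penalty level of the Constrained Lasso
    (hlam_lower : CLasso.WHP Pr fun n ω =>
      2 * σ * √(2 * C * Real.log (p n) / n) + 4 * σ * C ^ 2 * d / √n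
        + 8 * C * d * ρ * CLasso.supNorm ((1 / (n : ℝ)) •
            ((CLasso.resid (CLasso.designX (U n ω)) (CLasso.designZ (U n ω)) (α n (U n ω)))ᵀ
              * CLasso.designZ (U n ω))) ≤ lam n)
    (hlam_upper : ∀ᶠ n in atTop, lam n ≤ K * √(Real.log (p n) / n))
    -- the Constrained Lasso estimator
    (hest : CLasso.WHP Pr fun n ω =>
      CLasso.IsCLasso (CLasso.designX (U n ω)) (CLasso.designZ (U n ω)) (Y n ω)
        (α n (U n ω)) (lam n) ρ (θh n ω) (γh n ω))
    -- the asymptotic regime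
    (hp : Tendsto p atTop atTop)
    (hregime : Tendsto (fun n : ℕ => (s n : ℝ) * Real.log (p n) / √n) atTop (𝓝 0)) :
    TendstoInDistribution
      (fun n ω => WithLp.toLp 2 (fun j => √n * (θh n ω j - θs n j)) :
        ∀ n, Ω n → EuclideanSpace ℝ (Fin d))
      atTop id Pr (multivariateGaussian 0 ((σ : ℝ) ^ 2 • Ωs)) ∧
    ∀ n, CLasso.IsEfficientInformation (P n) σ (θs n) (γs n)
      (((σ : ℝ) ^ 2 • CLasso.OmegaStar (P n))⁻¹) := by
  refine ⟨?_, fun n => CLasso.isEfficientInformation_of_posDef (hsubG n) hC₀ (hZZ n) (hres n) hσ _ _⟩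
  have hOm : Ωs * Ωs⁻¹ = 1 := Matrix.mul_nonsing_inv _
    (CLasso.det_pos_of_tendsto_omegaStar hC₀ hsubG hZZ hres hΩ).ne'.isUnit
  have hT : ∀ n : ℕ, Measurable fun ω : Ω n => (fun j => √n * (θh n ω j - θs n j) : Fin d → ℝ) := fun n => by
    have := hθh_meas n
    fun_prop
  refine CLasso.tendstoInDistribution_of_expansion hT hα_meas hlaw
    (CLasso.posSemidef_of_tendsto_omegaStar hres hΩ) hOm (fun η hη => ?_) (fun ε hε => ?_)
  · exact (CLasso.whp_gram hC₀ hD hlaw hsubG hZZ hres hαs hΩ hα hs hp hregime hη).mono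
      (Eventually.of_forall fun n ω h j k => (h j k).1)
  · exact CLasso.whp_expansion hσ hC₀ hD hC hμ hα_meas hlaw hY hsubG hZZ hres hαs hΩ hs hsparse hρ
      hREC hcol hα hlam_lower hlam_upper hest hp hregime hε
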